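/- Work in $\mathbb{R}^3$ with Lebesgue measure $dV$ and surface area $dA$ (normalized two-dimensional Hausdorff measure). A *pressure body* is a closed region $A\subset\mathbb{R}^3$ with an object-fixed scalar field $p_A\ge 0$ on $A$ that is locally Lipschitz and zero on $\partial A$; nothing else (in particular no equilibrium condition) is required of $p_A$. Given a surface $S$ and sets $V,W$, the contact is called *regular* if $\int_S p\,dA<\infty$ and, up to zero area, every point of $S$ where $p>0$ lies on a local $C^1$ surface separating $V$ from $W$; the normal $n$ points from $V$ to $W$. There is no friction and no dissipation: the only forces are the tractions $\pm p\,n$. **(1) One pressure field, in the frame fixed to the object.** Let $(A,p_0)$ be a pressure body, $D$ a measurable region, $\Phi_t$ a motion of $\mathbb{R}^3$ by diffeomorphisms (the map and its inverse jointly $C^2$ in time and space), not necessarily rigid, with velocity field $v$; let $A$ or $D$ be bounded. Let $V^\cap(t)=A\cap\Phi_t(D)$ be the displaced overlap volume and $$U(t)=\int_{V^\cap(t)}p_0\,dV ,\qquad P(t)=\int_{\partial V^\cap(t)} v\cdot p_0\,n\;dA ,$$ with $n$ the outward normal; $P$ is the power delivered against the pressure forces. Then $U(t)$ is a convergent integral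 for every $t$. At every time $t$ at which $S=\partial V^\cap(t)$, $V=V^\cap(t)$, $W=\mathbb{R}^3\setminus V^\cap(t)$ is regular, $P(t)$ is a convergent integral and $U'(t)=P(t)$. If the boundary is regular for almost every $t\in[t_0,t_1]$, then $P$ is integrable on $[t_0,t_1]$ and $\int_{t_0}^{t_1}P\,dt=U(t_1)-U(t_0)$. In particular, if $V^\cap(t_0)=\emptyset$, the work needed to displace the field is $\int_{t_0}^{t_1}P\,dt=U(t_1)=\int_{V^\cap(t_1)}p_0\,dV$, and if $V^\cap(t_1)=V^\cap(t_0)$ the work is $0$. **(2) Contact of two objects.** Let $A,B$ be pressure bodies, at least one of them bounded, placed in space by rigid poses, with $p_A,p_B$ carried along. Their contact surface is $S^\cap=\{x\in A\cap B: p_A(x)=p_B(x)\}$, the displaced volumes are $V_A^\cap=\{x\in A\cap B:p_A(x)<p_B(x)\}$ and $V_B^\cap=\{x\in A\cap B:p_B(x)<p_A(x)\}$, and the strain energy is $$U=\int_{V_A^\cap}p_A\,dV+\int_{V_B^\cap}p_B\,dV .$$ Both integrals converge, and $U$ depends only on the relative pose of the two objects. Let $A$ and $B$ undergo rigid motions that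 are $C^1$ in time, with velocity fields $v_A,v_B$, such that for every $t\in[t_0,t_1]$ the set of points of $S^\cap(t)$ with positive pressure has volume zero, and for almost every $t\in[t_0,t_1]$ the contact is regular ($S=S^\cap$, $V=V_A^\cap$, $W=V_B^\cap$, $p=p_A=p_B$ on $S^\cap$). With $n_A$ the normal of $S^\cap$ pointing from $V_A^\cap$ to $V_B^\cap$ and $n_B=-n_A$, let $$P(t)=\int_{S^\cap(t)}v_A\cdot p\,n_A\,dA+\int_{S^\cap(t)}v_B\cdot p\,n_B\,dA$$ be the power of the pressure forces on the pair of objects. Then at every $t\in[t_0,t_1]$ at which the contact is regular, both surface integrals converge and $U'(t)=-P(t)$ (derivative relative to $[t_0,t_1]$); $P$ is integrable on $[t_0,t_1]$; and the work done by the pressure forces on the objects is $$\int_{t_0}^{t_1}P\,dt=U(t_0)-U(t_1).$$ In particular: if the objects are disjoint at $t_0$, then $U(t_1)$ is the work done against the pressure forces; if they are disjoint at $t_0$ and at $t_1$, the net work is $0$; if the relative pose at $t_1$ is the one at $t_0$, the net work is $0$; and any two such motions (possibly over different time intervals) with the same initial and the same final relative pose have the same work. Thus the contact model is conservative for every such pressure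 field. -/

import Mathlib

open MeasureTheory Set Filter Topology
open scoped MeasureTheory

noncomputable section

/-- Physical space, Euclidean three-space. `volume` is Lebesgue measure and `μHE[2]` is surface
area (the two-dimensional Hausdorff measure, normalized to agree with area on planes). -/
abbrev Space3 : Type := EuclideanSpace ℝ (Fin 3)

/-- A pose of a rigid object: the isometry carrying object-fixed coordinates to world coordinates. -/
abbrev Pose : Type := Space3 ≃ᵃⁱ[ℝ] Space3

/-- An object with an immutable, object-fixed pressure field: a closed region together with a
nonnegative, locally Lipschitz scalar field on it that vanishes on the surface of the region.
No equilibrium condition is imposed. The values of `pressure` off `carrier` are irrelevant. -/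
structure PressureBody where
  carrier : Set Space3
  pressure : Space3 → ℝ
  isClosed_carrier : IsClosed carrier
  pressure_nonneg : ∀ x ∈ carrier, 0 ≤ pressure x
  pressure_frontier : ∀ x ∈ frontier carrier, pressure x = 0
  locallyLipschitz_pressure : LocallyLipschitzOn carrier pressure

/-! ### Oriented contact surfaces and the power of normal tractions -/

/-- `n` is the unit normal at `x`, pointing from `V` to `W`, of a `C¹` surface through `x` which
separates `V` from `W` near `x`: the surface is `ψ = 0`, with `V` on the side `ψ < 0` and `W` on
the side `ψ > 0`. For `W = Vᶜ` this is the outward unit normal of `V`. -/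
def IsInterfaceNormal (V W : Set Space3) (x n : Space3) : Prop :=
  ∃ ψ : Space3 → ℝ, ContDiffAt ℝ 1 ψ x ∧ ψ x = 0 ∧ gradient ψ x ≠ 0 ∧
    n = ‖gradient ψ x‖⁻¹ • gradient ψ x ∧
    ∀ᶠ y in 𝓝 x, (ψ y < 0 → y ∈ V \ W) ∧ (0 < ψ y → y ∈ W \ V)

open Classical in
/-- The unit normal at `x` pointing from `V` to `W`, where it exists (it is then unique), and zero
elsewhere. -/
def interfaceNormal (V W : Set Space3) (x : Space3) : Space3 :=
  if h : ∃ n, IsInterfaceNormal V W x n then h.choose else 0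

/-- The part under positive pressure of the surface `S` is, up to a set of zero area, a `C¹`
interface between `V` and `W`, and the total normal load on `S` is finite. Corners, edges and other
singularities of zero area are allowed. -/
structure IsRegularContact (p : Space3 → ℝ) (S V W : Set Space3) : Prop where
  finite_load : IntegrableOn p S μHE[2]
  ae_interface : ∀ᵐ x ∂(μHE[2] : Measure Space3).restrict S,
    0 < p x → ∃ n, IsInterfaceNormal V W x n

/-- The power density `p (v · n)` of the normal traction `p n`, with `n` pointing from `V` to `W`,
at points moving with velocity `v`. -/
def powerDensity (p : Space3 → ℝ) (V W : Set Space3) (v : Space3 → Space3) (x : Space3) : ℝ :=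
  inner ℝ (v x) (p x • interfaceNormal V W x)

/-- The power `∫_S v · p n dA` of the normal traction `p n` on `S`. -/
def tractionPower (p : Space3 → ℝ) (S V W : Set Space3) (v : Space3 → Space3) : ℝ :=
  ∫ x in S, powerDensity p V W v x ∂μHE[2]

/-- The velocity at time `t` of the material point which is then at `x`. -/
def materialVelocity (Φ : ℝ → Space3 → Space3) (Φinv : ℝ → Space3 → Space3) (t : ℝ) (x : Space3) :
    Space3 :=
  deriv (fun s => Φ s (Φinv t x)) t

/-! ### One pressure field, displaced by a moving region (object-fixed frame) -/

/-- A motion of space, not necessarily rigid, by `C²` diffeomorphisms that is `C²` in time. -/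
structure IsSmoothMotion (Φ : ℝ → Space3 ≃ Space3) : Prop where
  contDiff : ContDiff ℝ 2 (fun q : ℝ × Space3 => Φ q.1 q.2)
  contDiff_symm : ContDiff ℝ 2 (fun q : ℝ × Space3 => (Φ q.1).symm q.2)

namespace PressureBody

/-- The part of the object overlapped at time `t` by the region which `Φ` carries along from its
reference shape `D`. -/
def overlapVolume (A : PressureBody) (D : Set Space3) (Φ : ℝ → Space3 ≃ Space3) (t : ℝ) :
    Set Space3 :=
  A.carrier ∩ Φ t '' D

/-- The integral of the pressure field over a set of displaced material. -/
def fieldEnergy (A : PressureBody) (V : Set Space3) : ℝ :=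
  ∫ x in V, A.pressure x

/-- The displaced volume has a regular boundary at time `t`. -/
def RegularOverlap (A : PressureBody) (D : Set Space3) (Φ : ℝ → Space3 ≃ Space3) (t : ℝ) : Prop :=
  IsRegularContact A.pressure (frontier (A.overlapVolume D Φ t))
    (A.overlapVolume D Φ t) (A.overlapVolume D Φ t)ᶜ

/-- The velocity field of the moving region. -/
def intruderVelocity (Φ : ℝ → Space3 ≃ Space3) (t : ℝ) : Space3 → Space3 :=
  materialVelocity (fun s => Φ s) (fun s => (Φ s).symm) t

/-- The power `∫ v · p n dA` over the boundary of the displaced volume, with outward normal `n`: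
the power delivered against the pressure forces. -/
def overlapPower (A : PressureBody) (D : Set Space3) (Φ : ℝ → Space3 ≃ Space3) (t : ℝ) : ℝ :=
  tractionPower A.pressure (frontier (A.overlapVolume D Φ t))
    (A.overlapVolume D Φ t) (A.overlapVolume D Φ t)ᶜ (intruderVelocity Φ t)

/-! ### Contact of two objects (world frame) -/

/-- The region occupied by the (undeformed) object in the pose `g`. -/
def placed (A : PressureBody) (g : Pose) : Set Space3 := g '' A.carrier

/-- The pressure field of the object in the pose `g`. -/
def placedPressure (A : PressureBody) (g : Pose) (x : Space3) : ℝ := A.pressure (g.symm x)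

end PressureBody

open PressureBody

/-- The contact surface: the equal-pressure points of the overlap of the two objects. -/
def contactSurface (A B : PressureBody) (g h : Pose) : Set Space3 :=
  {x ∈ A.placed g ∩ B.placed h | A.placedPressure g x = B.placedPressure h x}

/-- The volume of `A` displaced by `B`: the part of the overlap between the surface of `A` and the
contact surface, where the pressure field of `A` is the smaller one. -/
def displacedVolume (A B : PressureBody) (g h : Pose) : Set Space3 :=
  {x ∈ A.placed g ∩ B.placed h | A.placedPressure g x < B.placedPressure h x}

/-- The strain energy of `A` in contact with `B`. -/
def strainEnergy (A B : PressureBody) (g h : Pose) : ℝ :=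
  ∫ x in displacedVolume A B g h, A.placedPressure g x

/-- The strain energy of the mutual displacement of the pressure fields of `A` and `B`. -/
def contactEnergy (A B : PressureBody) (g h : Pose) : ℝ :=
  strainEnergy A B g h + strainEnergy B A h g

/-- The contact surface is regular, separating the displaced volumes of the two objects. -/
def RegularConfiguration (A B : PressureBody) (g h : Pose) : Prop :=
  IsRegularContact (A.placedPressure g) (contactSurface A B g h)
    (displacedVolume A B g h) (displacedVolume B A h g)

/-- The part of the contact surface under positive pressure encloses no volume of equal pressure. -/
def NoEqualPressureVolume (A B : PressureBody) (g h : Pose) : Prop :=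
  volume {x ∈ contactSurface A B g h | 0 < A.placedPressure g x} = 0

/-- A continuously differentiable rigid motion. -/
def IsRigidMotion (g : ℝ → Pose) : Prop := ∀ y : Space3, ContDiff ℝ 1 (fun t => g t y)

/-- The velocity field of a rigid motion. -/
def rigidVelocity (g : ℝ → Pose) (t : ℝ) : Space3 → Space3 :=
  materialVelocity (fun s => g s) (fun s => (g s).symm) t

/-- The power of the pressure forces which act on `A` in its contact with `B`. The traction on `A`
is `p n`, with `n` the normal of the contact surface pointing from the displaced volume of `A` to
that of `B`, that is, into the remaining material of `A`. -/
def powerOn (A B : PressureBody) (g h : ℝ → Pose) (t : ℝ) : ℝ :=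
  tractionPower (A.placedPressure (g t)) (contactSurface A B (g t) (h t))
    (displacedVolume A B (g t) (h t)) (displacedVolume B A (h t) (g t)) (rigidVelocity g t)

/-- The total power of the pressure forces on the two objects (no dissipation, no friction). -/
def contactPower (A B : PressureBody) (g h : ℝ → Pose) (t : ℝ) : ℝ :=
  powerOn A B g h t + powerOn B A h g t

/-- The work done by the pressure forces on the two objects from time `t₀` to time `t₁`. -/
def contactWork (A B : PressureBody) (g h : ℝ → Pose) (t₀ t₁ : ℝ) : ℝ :=
  ∫ t in t₀..t₁, contactPower A B g h t

/-- `g`, `h` are rigid motions of `A` and `B` for which, from time `t₀` to time `t₁`, the equal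
pressure set has no volume, and the contact surface is regular at almost all times. -/
structure IsAdmissibleMotion (A B : PressureBody) (g h : ℝ → Pose) (t₀ t₁ : ℝ) : Prop where
  le : t₀ ≤ t₁
  left : IsRigidMotion g
  right : IsRigidMotion h
  no_volume : ∀ t ∈ Icc t₀ t₁, NoEqualPressureVolume A B (g t) (h t)
  ae_regular : ∀ᵐ t ∂volume.restrict (Icc t₀ t₁), RegularConfiguration A B (g t) (h t)

/-- The pose of the second object relative to the first. -/
def relativePose (g h : Pose) : Pose := g⁻¹ * h

end

/-! The energy is the volume integral of a Lipschitz function of compact support which is carried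
along by the motion. Hence it is Lipschitz in time, so it is the integral of its derivative, and the
work formulas follow once the derivative at regular times is identified with the power (up to sign).
Continuity of the power in time is never needed.

For one field, the pressure is extended by zero and cut off to a function `q`. The energy is then
the integral of `q` over the moving region, and Reynolds' formula
(`IsSmoothMotion.hasDerivAt_setIntegral`) gives the integral of div (`q` v) as its derivative. For
two objects, the energy equals the integral of min (`a`, `b`), where `a` and `b` are the two fields
extended by zero (`IsTruncatedPair.contactEnergy_eq`). Almost everywhere the minimum follows its
smaller argument, whose time derivative is minus the directional derivative along the rigid
velocity, and a rigid velocity has no divergence (`IsRigidMotion.hasDerivAt_integral_min`). Points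
of equal positive pressure have no volume, and at points of zero pressure the derivative vanishes
because the fields have a minimum there.

Both volume integrals become the power by a divergence theorem, `gaussGreen_traction`, for a
Lipschitz field on a set whose boundary is only known to be a C¹ interface up to zero area where the
field is positive. Near an interface point the set lies below a graph of small slope. Along the axis
of the graph, Fubini and the fundamental theorem of calculus are exact. Any other direction can be
tilted slightly along the axis so that it points into the set, where translation gives a sign
(`abs_setIntegral_lineDeriv_sub_le`). The resulting error is a small multiple of the surface
integral of the field, so errors add up under a partition of unity instead of multiplying
(`gaussGreen_of_approxGaussGreenAt`).

Singular points are removed by a capacity argument (`gaussGreen_truncated`). Where the field is at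
least δ they form a compact set of zero area, covered by balls with small sum of r². A cut-off with
slope of order 1/r on a ball of volume of order r³ costs only r², and its effect on the surface is
small since the load is a finite measure. Finally δ tends to zero. -/

open scoped NNReal ENNReal Manifold ContDiff

/-! ### Divergence theorem up to a small error on Lipschitz subgraphs of small slope. -/

section LineFubini

set_option linter.unusedSectionVars false

variable {E : Type*} [NormedAddCommGroup E] [InnerProductSpace ℝ E] [FiniteDimensional ℝ E]
  [MeasurableSpace E] [BorelSpace E]

/-- Splitting a Euclidean space into a line and its orthogonal complement. -/
noncomputable def orthogonalLineEquiv {e : E} (he : ‖e‖ = 1) : (ℝ ∙ e)ᗮ × ℝ ≃ᵐ E :=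
  ((MeasurableEquiv.prodCongr (MeasurableEquiv.refl _)
    (LinearIsometryEquiv.toSpanUnitSingleton (𝕜 := ℝ) e he).toMeasurableEquiv).trans
      MeasurableEquiv.prodComm).trans ((ℝ ∙ e).measurableEquivProd (0 : E)).symm

theorem orthogonalLineEquiv_apply {e : E} (he : ‖e‖ = 1) (q : (ℝ ∙ e)ᗮ × ℝ) :
    orthogonalLineEquiv he q = (q.1 : E) + q.2 • e := by
  change ((ℝ ∙ e).measurableEquivProd (0 : E)).symm
    (LinearIsometryEquiv.toSpanUnitSingleton (𝕜 := ℝ) e he q.2, q.1) = _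
  simp [add_comm]

theorem measurePreserving_orthogonalLineEquiv {e : E} (he : ‖e‖ = 1) :
    MeasurePreserving (orthogonalLineEquiv he) volume volume := by
  have h1 : MeasurePreserving ((ℝ ∙ e).measurableEquivProd (0 : E)) volume volume := by
    have := (ℝ ∙ e).measurePreserving_measurableEquivProd (0 : E)
    rwa [InnerProductSpace.euclideanHausdorffMeasure_eq_volume] at this
  have h2 := (LinearIsometryEquiv.toSpanUnitSingleton (𝕜 := ℝ) e he).measurePreserving
  have h3 := (MeasurePreserving.id (volume : Measure (ℝ ∙ e)ᗮ)).prod h2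
  exact (h3.trans Measure.measurePreserving_swap).trans (h1.symm _)

theorem integral_eq_integral_orthogonal_line {e : E} (he : ‖e‖ = 1) {f : E → ℝ}
    (hf : Integrable f) :
    ∫ x, f x = ∫ y : (ℝ ∙ e)ᗮ, ∫ z : ℝ, f (y + z • e) := by
  have h := measurePreserving_orthogonalLineEquiv he
  rw [← h.integral_comp (orthogonalLineEquiv he).measurableEmbedding f]
  have hi := (h.integrable_comp_emb (orthogonalLineEquiv he).measurableEmbedding).2 hf
  simp only [Function.comp_def, orthogonalLineEquiv_apply] at hi ⊢
  rw [Measure.volume_eq_prod] at hi ⊢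
  exact integral_prod _ hi

/-- For a compactly supported Lipschitz function, the integral of the derivative over a half-line
is the value at its endpoint. -/
theorem integral_Iio_deriv_of_lipschitz {f : ℝ → ℝ} {K : ℝ≥0} (hf : LipschitzWith K f)
    (hc : HasCompactSupport f) (a : ℝ) : ∫ z in Iio a, deriv f z = f a := by
  obtain ⟨R, hR⟩ := hc.isBounded.subset_closedBall 0
  -- A point at or below `a` and strictly to the left of the support, so that `f m = 0`.
  set m := min (-R) a - 1 with hm
  have hm1 : m < -R := by have := min_le_left (-R) a; linarith
  have hm2 : m ≤ a := by have := min_le_right (-R) a; linarith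
  have h0 : ∀ z ≤ m, z ∉ tsupport f := by
    intro z hz hz'
    have := hR hz'
    rw [mem_closedBall_zero_iff, Real.norm_eq_abs, abs_le] at this
    linarith [this.1]
  have h1 : ∫ z in m..a, deriv f z = f a - f m :=
    ((hf.lipschitzOnWith (s := uIcc m a)).absolutelyContinuousOnInterval).integral_deriv_eq_sub
  rw [image_eq_zero_of_notMem_tsupport (h0 m le_rfl), sub_zero,
    intervalIntegral.integral_of_le hm2] at h1
  rw [← integral_Iic_eq_integral_Iio, ← h1]
  apply setIntegral_eq_of_subset_of_forall_sdiff_eq_zero measurableSet_Iic Ioc_subset_Iic_self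
  intro z hz
  have hz' : z ≤ m := by
    by_contra h
    exact hz.2 ⟨not_le.1 h, hz.1⟩
  exact image_eq_zero_of_notMem_tsupport fun h => h0 z hz' (tsupport_deriv_subset (𝕜 := ℝ) h)

theorem lineDeriv_eq_zero_of_notMem_tsupport {u : E → ℝ} {x : E} (hx : x ∉ tsupport u) (b : E) :
    lineDeriv ℝ u x b = 0 := by
  have : u =ᶠ[𝓝 x] fun _ => 0 := notMem_tsupport_iff_eventuallyEq.1 hx
  rw [this.lineDeriv_eq]
  simp [lineDeriv]

theorem integrable_lineDeriv_of_lipschitz {u : E → ℝ} {K : ℝ≥0} (hu : LipschitzWith K u)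
    (hc : HasCompactSupport u) (b : E) : Integrable (fun x => lineDeriv ℝ u x b) := by
  have : IntegrableOn (fun x => lineDeriv ℝ u x b) (tsupport u) := by
    apply Measure.integrableOn_of_bounded (M := K * ‖b‖) hc.measure_lt_top.ne
    · exact aestronglyMeasurable_lineDeriv hu.continuous _
    · exact .of_forall fun x => norm_lineDeriv_le_of_lipschitz ℝ hu
  rw [← integrableOn_univ]
  exact this.of_forall_sdiff_eq_zero MeasurableSet.univ
      fun x hx => lineDeriv_eq_zero_of_notMem_tsupport hx.2 b

/-- The divergence theorem on the subgraph of a measurable function, for fields in the direction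
of the axis. -/
theorem integral_subgraph_lineDeriv {e : E} (he : ‖e‖ = 1) {f : (ℝ ∙ e)ᗮ → ℝ} {s : Set E}
    (hs : MeasurableSet s) (hsf : ∀ y : (ℝ ∙ e)ᗮ, ∀ z : ℝ, (y : E) + z • e ∈ s ↔ z < f y)
    {u : E → ℝ} {K : ℝ≥0} (hu : LipschitzWith K u) (hc : HasCompactSupport u) :
    ∫ x in s, lineDeriv ℝ u x e = ∫ y : (ℝ ∙ e)ᗮ, u (y + f y • e) := by
  rw [← integral_indicator hs, integral_eq_integral_orthogonal_line he
    ((integrable_lineDeriv_of_lipschitz hu hc e).indicator hs)]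
  congr 1 with y
  have hline : LipschitzWith 1 (fun z : ℝ => (y : E) + z • e) := by
    apply LipschitzWith.of_dist_le_mul
    intro a c
    rw [dist_eq_norm, dist_eq_norm, add_sub_add_left_eq_sub, ← sub_smul, norm_smul, he]
    simp
  have hcl : HasCompactSupport (fun z : ℝ => u ((y : E) + z • e)) := by
    apply hc.comp_isClosedEmbedding
    apply Isometry.isClosedEmbedding
    apply Isometry.of_dist_eq
    intro a c
    rw [dist_eq_norm, dist_eq_norm, add_sub_add_left_eq_sub, ← sub_smul, norm_smul, he]
    simp
  refine Eq.trans ?_ (integral_Iio_deriv_of_lipschitz (hu.comp hline) hcl (f y))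
  rw [← integral_indicator measurableSet_Iio]
  congr 1 with z
  by_cases hz : z < f y
  · rw [indicator_of_mem ((hsf y z).2 hz), indicator_of_mem (mem_Iio.2 hz), lineDeriv]
    have : (fun t : ℝ => u ((y : E) + z • e + t • e)) =
        fun t => (fun r : ℝ => u ((y : E) + r • e)) (t + z) := by
      ext t; congr 1; rw [add_smul]; abel
    rw [this]
    refine (deriv_comp_add_const (fun r : ℝ => u ((y : E) + r • e)) z 0).trans ?_
    rw [zero_add]
    rfl
  · rw [indicator_of_notMem (fun h => hz ((hsf y z).1 h)), indicator_of_notMem (by simpa using hz)]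

/-- The integral of a directional derivative of a nonnegative function is nonpositive over a set
that moves into itself in this direction. -/
theorem setIntegral_lineDeriv_nonpos {s : Set E} (hs : MeasurableSet s) {b : E}
    (hb : ∀ h : ℝ, 0 < h → ∀ x ∈ s, x + h • b ∈ s)
    {u : E → ℝ} {K : ℝ≥0} (hu : LipschitzWith K u) (hc : HasCompactSupport u) (h0 : ∀ x, 0 ≤ u x) :
    ∫ x in s, lineDeriv ℝ u x b ≤ 0 := by
  -- `T` contains the support of every translate of `u` by `t • b` with 0 < `t` ≤ 1. Cutting `s`
  -- down to `T` changes no integral below and makes its indicator integrable, as required for the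
  -- limit of difference quotients.
  set T := Metric.cthickening ‖b‖ (tsupport u) with hT
  have hTc : IsCompact T := IsCompact.cthickening hc
  have hTm : MeasurableSet T := hTc.isClosed.measurableSet
  have hu0 : ∀ x ∉ T, u x = 0 := fun x hx => image_eq_zero_of_notMem_tsupport
    fun h => hx (Metric.self_subset_cthickening _ h)
  have hg : Integrable ((s ∩ T).indicator (fun _ => (1 : ℝ))) :=
    (integrable_indicator_iff (hs.inter hTm)).2
      (integrableOn_const ((measure_mono inter_subset_right).trans_lt hTc.measure_lt_top).ne)
  have hlim := hu.integral_inv_smul_sub_mul_tendsto_integral_lineDeriv_mul hg b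
  have hmul : ∀ F : E → ℝ, (fun x => F x * (s ∩ T).indicator (fun _ => (1 : ℝ)) x) =
      (s ∩ T).indicator F := by
    intro F; ext x; by_cases hx : x ∈ s ∩ T <;> simp [hx]
  have hcut : ∀ F : E → ℝ, (∀ x ∉ T, F x = 0) →
      ∫ x, F x * (s ∩ T).indicator (fun _ => (1 : ℝ)) x = ∫ x in s, F x := by
    intro F hF
    rw [hmul, integral_indicator (hs.inter hTm)]
    symm
    apply setIntegral_eq_of_subset_of_forall_sdiff_eq_zero hs inter_subset_left
    exact fun x hx => hF x fun h => hx.2 ⟨hx.1, h⟩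
  rw [hcut] at hlim
  swap
  · intro x hx
    exact lineDeriv_eq_zero_of_notMem_tsupport
      (fun h => hx (Metric.self_subset_cthickening _ h)) b
  refine le_of_tendsto hlim ?_
  filter_upwards [Ioc_mem_nhdsGT zero_lt_one] with t ht
  rw [hcut]
  swap
  · intro x hx
    have hx2 : u (x + t • b) = 0 := by
      apply image_eq_zero_of_notMem_tsupport
      intro h
      refine hx (Metric.mem_cthickening_of_dist_le _ _ _ _ h ?_)
      rw [dist_eq_norm, sub_add_cancel_left, norm_neg, norm_smul, Real.norm_eq_abs,
        abs_of_pos ht.1]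
      exact mul_le_of_le_one_left (norm_nonneg _) ht.2
    simp [hx2, hu0 x hx]
  have hui : Integrable u := hu.continuous.integrable_of_hasCompactSupport hc
  have hui' : Integrable (fun x => u (x + t • b)) := hui.comp_add_right (t • b)
  simp only [smul_eq_mul]
  rw [integral_const_mul, integral_sub hui'.integrableOn hui.integrableOn]
  refine mul_nonpos_of_nonneg_of_nonpos (inv_nonneg.2 ht.1.le) (sub_nonpos.2 ?_)
  -- After translating the right-hand side by `t • b`, the inequality holds pointwise, because `x ∈
  -- s` implies `x + t • b ∈ s`.
  rw [← integral_indicator hs, ← integral_indicator hs,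
    ← integral_add_right_eq_self (s.indicator u) (t • b)]
  refine integral_mono (hui'.indicator hs) ((hui.indicator hs).comp_add_right (t • b)) fun x => ?_
  by_cases hx : x ∈ s
  · simp [hx, hb t ht.1 x hx]
  · simp only [hx, not_false_eq_true, indicator_of_notMem]
    exact indicator_nonneg (fun _ _ => h0 _) _

/-- The level set `⟪e, x⟫ + φ x = 0`, with `φ` a contraction, is a Lipschitz graph over the
orthogonal complement of `e`. -/
theorem exists_lipschitz_graph {e : E} (he : ‖e‖ = 1) {φ : E → ℝ} {ε : ℝ≥0}
    (hφ : LipschitzWith ε φ) (hε : (ε : ℝ) ≤ 1 / 2) :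
    ∃ f : (ℝ ∙ e)ᗮ → ℝ, LipschitzWith (2 * ε) f ∧ ∀ (y : (ℝ ∙ e)ᗮ) (z : ℝ),
      (inner ℝ e ((y : E) + z • e) + φ (y + z • e) < 0 ↔ z < f y) ∧
      (inner ℝ e ((y : E) + z • e) + φ (y + z • e) = 0 ↔ z = f y) := by
  have hin : ∀ (y : (ℝ ∙ e)ᗮ) (z : ℝ), inner ℝ e ((y : E) + z • e) = z := by
    intro y z
    rw [inner_add_right, inner_smul_right, real_inner_self_eq_norm_sq, he,
      Submodule.mem_orthogonal_singleton_iff_inner_right.1 y.2]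
    simp
  have hφ' : ∀ a c, |φ a - φ c| ≤ ε * ‖a - c‖ := fun a c => by
    simpa [dist_eq_norm] using hφ.dist_le_mul a c
  have hline : ∀ (y : (ℝ ∙ e)ᗮ) (z z' : ℝ), ‖((y : E) + z • e) - (y + z' • e)‖ = |z - z'| := by
    intro y z z'
    rw [add_sub_add_left_eq_sub, ← sub_smul, norm_smul, he, mul_one, Real.norm_eq_abs]
  -- On the line over `y` the level set equation reads `z = -φ (y + z • e)`, a fixed point problem
  -- for a contraction.
  have hcontr : ∀ y : (ℝ ∙ e)ᗮ, ContractingWith ε (fun z : ℝ => -φ (y + z • e)) := by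
    refine fun y => ⟨by rw [← NNReal.coe_lt_coe]; push_cast; linarith, ?_⟩
    apply LipschitzWith.of_dist_le_mul
    intro z z'
    rw [dist_neg_neg, Real.dist_eq, Real.dist_eq, ← hline y z z']
    exact hφ' _ _
  set f : (ℝ ∙ e)ᗮ → ℝ := fun y => (hcontr y).fixedPoint with hf
  have hfix : ∀ y, φ (y + f y • e) = - f y := by
    intro y
    have := (hcontr y).fixedPoint_isFixedPt
    rw [Function.IsFixedPt] at this
    linarith
  refine ⟨f, ?_, ?_⟩
  · apply LipschitzWith.of_dist_le_mul
    intro y y'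
    have h1 := hφ' (y + f y • e) (y' + f y' • e)
    rw [hfix, hfix] at h1
    have h2 : ‖((y : E) + f y • e) - (y' + f y' • e)‖ ≤ ‖(y : E) - y'‖ + |f y - f y'| := by
      have : ((y : E) + f y • e) - (y' + f y' • e) = (y - y') + (f y - f y') • e := by
        rw [sub_smul]; abel
      rw [this]
      refine (norm_add_le _ _).trans ?_
      rw [norm_smul, he, mul_one, Real.norm_eq_abs]
    have h3 : |f y - f y'| = |-f y - -f y'| := by rw [← abs_neg]; congr 1; ring
    rw [← h3] at h1
    have h4 : (ε : ℝ) * ‖((y : E) + f y • e) - (y' + f y' • e)‖ ≤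
      ε * (‖(y : E) - y'‖ + |f y - f y'|) := by gcongr
    -- Since ε ≤ 1/2, the term with `f` on the right is absorbed at the cost of a factor 2; hence
    -- the Lipschitz constant `2 * ε`.
    have h5 : (ε : ℝ) * |f y - f y'| ≤ 1 / 2 * |f y - f y'| := by gcongr
    rw [Real.dist_eq, dist_eq_norm]
    push_cast
    have h6 : ‖(y : E) - y'‖ = ‖y - y'‖ := by rw [← Submodule.coe_sub, Submodule.coe_norm]
    rw [h6] at h4
    linarith
  · intro y z
    rw [hin]
    have h1 := hφ' (y + z • e) (y + f y • e)
    rw [hline, hfix] at h1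
    have h2 : |φ (y + z • e) - - f y| ≤ 1 / 2 * |z - f y| := h1.trans (by gcongr)
    rw [abs_le] at h2
    rcases lt_trichotomy z (f y) with h | h | h
    · rw [abs_of_neg (by linarith)] at h2
      constructor <;> constructor <;> intro _ <;> linarith
    · subst h
      rw [hfix]
      simp
    · rw [abs_of_pos (by linarith)] at h2
      constructor <;> constructor <;> intro _ <;> linarith

theorem lipschitz_image_euclideanHausdorffMeasure_le {X Y : Type*} [MetricSpace X]
    [MeasurableSpace X] [BorelSpace X] [MetricSpace Y] [MeasurableSpace Y] [BorelSpace Y]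
    {K : ℝ≥0} {f : X → Y} (hf : LipschitzWith K f) (d : ℕ) (s : Set X) :
    (μHE[d] : Measure Y) (f '' s) ≤ (K : ℝ≥0∞) ^ d * (μHE[d] : Measure X) s := by
  rw [Measure.euclideanHausdorffMeasure_def, Measure.euclideanHausdorffMeasure_def,
    Measure.smul_apply, Measure.smul_apply, mul_smul_comm]
  gcongr
  simpa using hf.hausdorffMeasure_image_le (d := d) (by positivity) s

/-- Comparison of surface measure on a Lipschitz graph with the measure of its projection. -/
theorem lintegral_graph_le {e : E} (he : ‖e‖ = 1) {f : (ℝ ∙ e)ᗮ → ℝ} {K : ℝ≥0}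
    (hf : LipschitzWith K f) {d : ℕ} (hd : Module.finrank ℝ (ℝ ∙ e)ᗮ = d)
    {u : E → ℝ≥0∞} (hu : Measurable u) :
    (∫⁻ x in range (fun y : (ℝ ∙ e)ᗮ => (y : E) + f y • e), u x ∂μHE[d] ≤
      (1 + K : ℝ≥0∞) ^ d * ∫⁻ y : (ℝ ∙ e)ᗮ, u (y + f y • e)) ∧
    ∫⁻ y : (ℝ ∙ e)ᗮ, u (y + f y • e) ≤
      ∫⁻ x in range (fun y : (ℝ ∙ e)ᗮ => (y : E) + f y • e), u x ∂μHE[d] := by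
  set G : (ℝ ∙ e)ᗮ → E := fun y => (y : E) + f y • e with hG
  set π : E → (ℝ ∙ e)ᗮ := fun x => (ℝ ∙ e)ᗮ.orthogonalProjectionOnto x with hπ
  have hvol : (volume : Measure (ℝ ∙ e)ᗮ) = μHE[d] := by
    rw [← hd]; exact InnerProductSpace.euclideanHausdorffMeasure_eq_volume.symm
  have hπ1 : LipschitzWith 1 π := by
    apply LipschitzWith.of_dist_le_mul
    intro a c
    rw [dist_eq_norm, dist_eq_norm, hπ, ← map_sub, NNReal.coe_one, one_mul]
    exact Submodule.norm_orthogonalProjectionOnto_apply_le _ _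
  have hπG : ∀ y, π (G y) = y := by
    intro y
    simp only [hπ, hG, map_add, map_smul]
    rw [Submodule.orthogonalProjectionOnto_mem_subspace_eq_self,
      Submodule.orthogonalProjectionOnto_apply_of_mem_orthogonal]
    · simp
    · exact Submodule.le_orthogonal_orthogonal _ (Submodule.mem_span_singleton_self e)
  have hGL : LipschitzWith (1 + K) G := by
    apply LipschitzWith.of_dist_le_mul
    intro y y'
    have : G y - G y' = (y - y' : E) + (f y - f y') • e := by simp only [hG, sub_smul]; abel
    rw [dist_eq_norm, this]
    refine (norm_add_le _ _).trans ?_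
    rw [norm_smul, he, mul_one, ← dist_eq_norm, ← dist_eq_norm]
    push_cast
    rw [add_mul, one_mul]
    exact add_le_add le_rfl (hf.dist_le_mul _ _)
  have hGcl : Topology.IsClosedEmbedding G :=
    Function.LeftInverse.isClosedEmbedding hπG hπ1.continuous hGL.continuous
  -- The graph map is `(1 + K)`-Lipschitz and the projection is a 1-Lipschitz inverse of it. So the
  -- projected surface measure lies between `volume` and `(1 + K) ^ d • volume`, and no area formula
  -- is needed.
  set ν : Measure (ℝ ∙ e)ᗮ := ((μHE[d] : Measure E).restrict (range G)).map π with hν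
  have hνs : ∀ s, MeasurableSet s → ν s = (μHE[d] : Measure E) (G '' s) := by
    intro s hs
    rw [hν, Measure.map_apply hπ1.continuous.measurable hs,
      Measure.restrict_apply (hπ1.continuous.measurable hs)]
    congr 1
    ext x
    constructor
    · rintro ⟨h1, y, rfl⟩
      rw [mem_preimage, hπG] at h1
      exact ⟨y, h1, rfl⟩
    · rintro ⟨y, hy, rfl⟩
      exact ⟨by rwa [mem_preimage, hπG], y, rfl⟩
  have hν1 : ν ≤ ((1 + K : ℝ≥0∞) ^ d) • volume := by
    refine Measure.le_iff.2 fun s hs => ?_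
    rw [hνs s hs, hvol]
    simpa using lipschitz_image_euclideanHausdorffMeasure_le hGL d s
  have hν2 : volume ≤ ν := by
    refine Measure.le_iff.2 fun s hs => ?_
    rw [hνs s hs, hvol]
    have := lipschitz_image_euclideanHausdorffMeasure_le hπ1 d (G '' s)
    rw [← image_comp, show π ∘ G = id from funext hπG, image_id] at this
    simpa using this
  have key : ∫⁻ x in range G, u x ∂μHE[d] = ∫⁻ y, u (G y) ∂ν := by
    refine Eq.trans ?_
      (lintegral_map (hu.comp hGL.continuous.measurable) hπ1.continuous.measurable).symm
    refine setLIntegral_congr_fun hGcl.isClosed_range.measurableSet ?_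
    rintro _ ⟨y, rfl⟩
    simp only [Function.comp_apply, hπG]
  rw [key]
  constructor
  · refine (lintegral_mono' hν1 le_rfl).trans ?_
    rw [lintegral_smul_measure, smul_eq_mul]
  · exact lintegral_mono' hν2 le_rfl

/-- Line derivatives need not be additive in the direction at every point; by Rademacher's theorem
they are almost everywhere. -/
theorem integral_lineDeriv_add_smul {u : E → ℝ} {K : ℝ≥0} (hu : LipschitzWith K u)
    (hc : HasCompactSupport u) (s : Set E) (b c : E) (r : ℝ) :
    ∫ x in s, lineDeriv ℝ u x (b + r • c) =
      (∫ x in s, lineDeriv ℝ u x b) + r * ∫ x in s, lineDeriv ℝ u x c := by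
  rw [← integral_const_mul, ← integral_add (integrable_lineDeriv_of_lipschitz hu hc b).integrableOn
    ((integrable_lineDeriv_of_lipschitz hu hc c).integrableOn.const_mul r)]
  refine integral_congr_ae (ae_restrict_of_ae ?_)
  filter_upwards [hu.ae_differentiableAt (μ := volume)] with x hx
  rw [hx.lineDeriv_eq_fderiv, hx.lineDeriv_eq_fderiv, hx.lineDeriv_eq_fderiv, map_add, map_smul,
    smul_eq_mul]

theorem setIntegral_lineDeriv_neg {u : E → ℝ} {K : ℝ≥0} (hu : LipschitzWith K u)
    (hc : HasCompactSupport u) (s : Set E) (b : E) :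
    ∫ x in s, lineDeriv ℝ u x (-b) = -∫ x in s, lineDeriv ℝ u x b := by
  have := integral_lineDeriv_add_smul hu hc s (0 : E) b (-1)
  have h00 : ∫ x in s, lineDeriv ℝ u x (0 : E) = 0 := by simp [lineDeriv]
  rw [h00] at this
  simpa using this

/-- An approximate divergence theorem on a Lipschitz subgraph with small slope. -/
theorem abs_setIntegral_lineDeriv_sub_le {e : E} (he : ‖e‖ = 1) {φ : E → ℝ} {ε : ℝ≥0}
    (hφ : LipschitzWith ε φ) (hε : (ε : ℝ) ≤ 1 / 2) (hd : Module.finrank ℝ (ℝ ∙ e)ᗮ = 2)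
    {u : E → ℝ} {K : ℝ≥0} (hu : LipschitzWith K u) (hc : HasCompactSupport u)
    (h0 : ∀ x, 0 ≤ u x) (b : E) :
    IntegrableOn u {x | inner ℝ e x + φ x = 0} μHE[2] ∧
    |(∫ x in {x | inner ℝ e x + φ x < 0}, lineDeriv ℝ u x b) -
        inner ℝ b e * ∫ x in {x | inner ℝ e x + φ x = 0}, u x ∂μHE[2]| ≤
      8 * ε * ‖b‖ * ∫ x in {x | inner ℝ e x + φ x = 0}, u x ∂μHE[2] := by
  obtain ⟨f, hf, hfψ⟩ := exists_lipschitz_graph he hφ hε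
  have hψc : Continuous fun x => inner ℝ e x + φ x := by
    have := hφ.continuous
    fun_prop
  set s := {x | inner ℝ e x + φ x < 0} with hs
  have hsm : MeasurableSet s := (isOpen_lt hψc continuous_const).measurableSet
  have hrange : {x | inner ℝ e x + φ x = 0} = range (fun y : (ℝ ∙ e)ᗮ => (y : E) + f y • e) := by
    ext x
    obtain ⟨q, rfl⟩ := (orthogonalLineEquiv he).surjective x
    rw [orthogonalLineEquiv_apply, mem_ofPred_eq, (hfψ q.1 q.2).2]
    constructor
    · intro h
      exact ⟨q.1, by simp only [h]⟩
    · rintro ⟨y, hy⟩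
      have := (hfψ q.1 q.2).2
      rw [← hy] at this
      exact this.1 ((hfψ y (f y)).2.2 rfl)
  obtain ⟨hl1, hl2⟩ := lintegral_graph_le he hf hd (u := fun x => ENNReal.ofReal (u x))
    hu.continuous.measurable.ennreal_ofReal
  rw [← hrange] at hl1 hl2
  set S := {x | inner ℝ e x + φ x = 0} with hS
  -- By Pythagoras, points of the graph over a large `y` leave the support of `u`, so the function
  -- on the base has compact support.
  have hfin1 : ∀ y : (ℝ ∙ e)ᗮ, ‖(y : E)‖ ≤ ‖(y : E) + f y • e‖ := by
    intro y
    have hxy := norm_add_sq_eq_norm_sq_add_norm_sq_of_inner_eq_zero (y : E) (f y • e) (by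
      rw [inner_smul_right, Submodule.mem_orthogonal_singleton_iff_inner_left.1 y.2, mul_zero])
    nlinarith [norm_nonneg (y : E), norm_nonneg ((y : E) + f y • e), mul_self_nonneg ‖f y • e‖]
  have hGcont : Continuous fun y : (ℝ ∙ e)ᗮ => u ((y : E) + f y • e) := by
    have := hf.continuous
    have := hu.continuous
    fun_prop
  have hGc : HasCompactSupport fun y : (ℝ ∙ e)ᗮ => u ((y : E) + f y • e) := by
    obtain ⟨R, hR⟩ := hc.isBounded.subset_closedBall 0
    refine HasCompactSupport.intro (isCompact_closedBall 0 R) fun y hy => ?_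
    apply image_eq_zero_of_notMem_tsupport
    intro h
    have := hR h
    rw [mem_closedBall_zero_iff] at this hy
    exact hy ((hfin1 y).trans this)
  have hGi : Integrable fun y : (ℝ ∙ e)ᗮ => u ((y : E) + f y • e) :=
    hGcont.integrable_of_hasCompactSupport hGc
  set I := ∫ y : (ℝ ∙ e)ᗮ, u ((y : E) + f y • e) with hI
  have hIl : ∫⁻ y : (ℝ ∙ e)ᗮ, ENNReal.ofReal (u ((y : E) + f y • e)) = ENNReal.ofReal I :=
    (ofReal_integral_eq_lintegral_ofReal hGi (.of_forall fun _ => h0 _)).symm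
  rw [hIl] at hl1 hl2
  have hui : IntegrableOn u S μHE[2] := by
    refine ⟨hu.continuous.measurable.aestronglyMeasurable, ?_⟩
    rw [hasFiniteIntegral_iff_ofReal (.of_forall h0)]
    refine hl1.trans_lt (ENNReal.mul_lt_top ?_ ENNReal.ofReal_lt_top)
    exact ENNReal.pow_lt_top (by finiteness)
  set H := ∫ x in S, u x ∂μHE[2] with hH
  have hI0 : 0 ≤ I := integral_nonneg fun _ => h0 _
  have hH0 : 0 ≤ H := integral_nonneg fun _ => h0 _
  have hHl : ∫⁻ x in S, ENNReal.ofReal (u x) ∂μHE[2] = ENNReal.ofReal H :=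
    (ofReal_integral_eq_lintegral_ofReal hui (.of_forall fun _ => h0 _)).symm
  rw [hHl] at hl1 hl2
  have hIH : I ≤ H := (ENNReal.ofReal_le_ofReal_iff hH0).1 hl2
  have hHI : H ≤ (1 + 2 * ε) ^ 2 * I := by
    have : ((1 : ℝ≥0∞) + ((2 * ε : ℝ≥0) : ℝ≥0∞)) ^ 2 = ENNReal.ofReal ((1 + 2 * ε) ^ 2) := by
      rw [ENNReal.ofReal_pow (by positivity), ENNReal.ofReal_add (by positivity) (by positivity)]
      simp [ENNReal.ofReal_mul]
    rw [this, ← ENNReal.ofReal_mul (by positivity)] at hl1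
    exact (ENNReal.ofReal_le_ofReal_iff (by positivity)).1 hl1
  refine ⟨hui, ?_⟩
  have haxis : ∫ x in s, lineDeriv ℝ u x e = I :=
    integral_subgraph_lineDeriv he hsm (fun y z => (hfψ y z).1) hu hc
  -- Directions in the downward cone of aperture ε move the subgraph into itself, because `φ` is
  -- ε-Lipschitz.
  have hmono : ∀ d : E, inner ℝ e d ≤ -(ε * ‖d‖) → ∫ x in s, lineDeriv ℝ u x d ≤ 0 := by
    intro d hd
    refine setIntegral_lineDeriv_nonpos hsm (fun h hh x hx => ?_) hu hc h0
    rw [hs, mem_ofPred_eq] at hx ⊢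
    have h1 : |φ (x + h • d) - φ x| ≤ ε * (h * ‖d‖) := by
      have := hφ.dist_le_mul (x + h • d) x
      rwa [Real.dist_eq, dist_eq_norm, add_sub_cancel_left, norm_smul, Real.norm_eq_abs,
        abs_of_pos hh] at this
    rw [inner_add_right, inner_smul_right]
    have h2 := (abs_le.1 h1).2
    have h3 := mul_le_mul_of_nonneg_left hd hh.le
    linarith
  have hupper : ∀ b : E, (∫ x in s, lineDeriv ℝ u x b) - inner ℝ b e * I ≤ 2 * ε * ‖b‖ * I := by
    intro b
    -- Removing the axial part of `b` and then moving down by `k` gives a vector of length at most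
    -- ‖b‖ + k. It lies in the cone, since ε ‖b‖ = k/2 and ε k ≤ k/2.
    set k := 2 * (ε : ℝ) * ‖b‖ with hk
    have hk0 : 0 ≤ k := by positivity
    have hd := hmono (b + (-(inner ℝ b e + k)) • e) ?_
    · rw [integral_lineDeriv_add_smul hu hc, haxis] at hd
      linarith
    · have h1 : inner ℝ e (b + (-(inner ℝ b e + k)) • e) = -k := by
        rw [inner_add_right, inner_smul_right, real_inner_self_eq_norm_sq, he,
          real_inner_comm e b]
        ring
      have h2 : ‖b + (-(inner ℝ b e + k)) • e‖ ≤ ‖b‖ + k := by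
        have h3 : b + (-(inner ℝ b e + k)) • e = (b - inner ℝ b e • e) + (-k) • e := by
          rw [neg_add, add_smul, neg_smul]; abel
        have h4 : ‖b - inner ℝ b e • e‖ ^ 2 = ‖b‖ ^ 2 - (inner ℝ b e) ^ 2 := by
          rw [norm_sub_sq_real, inner_smul_right, norm_smul, he, mul_one, Real.norm_eq_abs, sq_abs]
          ring
        have h5 : ‖b - inner ℝ b e • e‖ ≤ ‖b‖ := by
          apply (pow_le_pow_iff_left₀ (norm_nonneg _) (norm_nonneg _) two_ne_zero).1
          rw [h4]; nlinarith [sq_nonneg (inner ℝ b e)]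
        rw [h3]
        refine (norm_add_le _ _).trans ?_
        rw [norm_smul, he, mul_one, norm_neg, Real.norm_eq_abs, abs_of_nonneg hk0]
        linarith
      rw [h1]
      have h6 : (ε : ℝ) * ‖b + (-(inner ℝ b e + k)) • e‖ ≤ ε * (‖b‖ + k) := by gcongr
      have h7 : (ε : ℝ) * k ≤ 1 / 2 * k := by gcongr
      have h8 : (ε : ℝ) * ‖b‖ = k / 2 := by rw [hk]; ring
      linarith
  have hneg := setIntegral_lineDeriv_neg hu hc s b
  have hA : |(∫ x in s, lineDeriv ℝ u x b) - inner ℝ b e * I| ≤ 2 * ε * ‖b‖ * I := by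
    rw [abs_le]
    have h1 := hupper b
    have h2 := hupper (-b)
    rw [hneg, inner_neg_left, norm_neg] at h2
    constructor <;> linarith
  -- The base integral `I` is exchanged for the surface integral `H`: (1 + 2ε)² ≤ 1 + 6ε for ε ≤
  -- 1/2. With the 2 of `hA` this makes the constant 8.
  have hB : |inner ℝ b e * I - inner ℝ b e * H| ≤ 6 * ε * ‖b‖ * I := by
    rw [← mul_sub, abs_mul]
    have h1 : |inner ℝ b e| ≤ ‖b‖ := by simpa [he] using abs_real_inner_le_norm b e
    have h2 : |I - H| ≤ 6 * ε * I := by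
      rw [abs_sub_comm, abs_of_nonneg (by linarith)]
      have : (ε : ℝ) * ε * I ≤ 1 / 2 * ε * I := by gcongr
      nlinarith
    calc |inner ℝ b e| * |I - H| ≤ ‖b‖ * (6 * ε * I) := by gcongr
      _ = _ := by ring
  have hC : 8 * ε * ‖b‖ * I ≤ 8 * ε * ‖b‖ * H := by gcongr
  have hT := abs_sub_le (∫ x in s, lineDeriv ℝ u x b) (inner ℝ b e * I) (inner ℝ b e * H)
  linarith

/-- By Fubini, because every line parallel to `e` meets the graph in exactly one point. -/
theorem volume_lipschitz_graph_eq_zero {e : E} (he : ‖e‖ = 1) {φ : E → ℝ} {ε : ℝ≥0}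
    (hφ : LipschitzWith ε φ) (hε : (ε : ℝ) ≤ 1 / 2) :
    volume {x | inner ℝ e x + φ x = 0} = 0 := by
  obtain ⟨f, -, hfψ⟩ := exists_lipschitz_graph he hφ hε
  have hc := hφ.continuous
  have hm : MeasurableSet {x | inner ℝ e x + φ x = 0} :=
    (isClosed_eq (by fun_prop) continuous_const).measurableSet
  rw [← (measurePreserving_orthogonalLineEquiv he).measure_preimage hm.nullMeasurableSet,
    Measure.volume_eq_prod,
    Measure.measure_prod_null ((orthogonalLineEquiv he).measurable hm)]
  refine .of_forall fun y => ?_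
  have : Prod.mk y ⁻¹' (orthogonalLineEquiv he ⁻¹' {x | inner ℝ e x + φ x = 0}) = {f y} := by
    ext z
    rw [mem_preimage, mem_preimage, orthogonalLineEquiv_apply]
    exact (hfψ y z).2
  change volume (Prod.mk y ⁻¹' (orthogonalLineEquiv he ⁻¹' {x | inner ℝ e x + φ x = 0})) = 0
  rw [this]
  exact Real.volume_singleton

/-- The whole space moves into itself in the directions `b` and `-b`, so the integral and its
negative are both nonpositive. -/
theorem integral_lineDeriv_eq_zero {u : E → ℝ} {K : ℝ≥0} (hu : LipschitzWith K u)
    (hc : HasCompactSupport u) (h0 : ∀ x, 0 ≤ u x) (b : E) : ∫ x, lineDeriv ℝ u x b = 0 := by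
  have h : ∀ b : E, ∫ x, lineDeriv ℝ u x b ≤ 0 := fun b => by
    simpa using setIntegral_lineDeriv_nonpos (s := univ) MeasurableSet.univ
      (b := b) (fun _ _ _ _ => mem_univ _) hu hc h0
  have h2 := setIntegral_lineDeriv_neg hu hc univ b
  rw [setIntegral_univ, setIntegral_univ] at h2
  linarith [h b, h (-b)]

end LineFubini

/-! ### Uniqueness, continuity and local flatness of interface normals. -/

section InterfaceNormal

variable {V W : Set Space3} {x n n' : Space3}

theorem hasDerivAt_comp_line_of_gradient {ψ : Space3 → ℝ} (hψ : DifferentiableAt ℝ ψ x)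
    (d : Space3) :
    HasDerivAt (fun t : ℝ => ψ (x + t • d)) (inner ℝ (gradient ψ x) d) 0 := by
  have h1 : HasFDerivAt ψ (fderiv ℝ ψ x) (x + (0 : ℝ) • d) := by simpa using hψ.hasFDerivAt
  have h2 : HasDerivAt (fun t : ℝ => x + t • d) d 0 := by
    simpa using ((hasDerivAt_id (0 : ℝ)).smul_const d).const_add x
  have h3 := h1.comp_hasDerivAt (0 : ℝ) h2
  rwa [← inner_gradient_left] at h3

theorem eventually_pos_of_hasDerivAt {f : ℝ → ℝ} {c : ℝ} (hf : HasDerivAt f c 0) (h0 : f 0 = 0)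
    (hc : 0 < c) : ∀ᶠ t in 𝓝[>] (0 : ℝ), 0 < f t := by
  have h := (hasDerivAt_iff_tendsto_slope_zero.1 hf).mono_left (nhdsGT_le_nhdsNE (0 : ℝ))
  filter_upwards [h.eventually (lt_mem_nhds hc), self_mem_nhdsWithin] with t ht ht0
  simp only [zero_add, h0, sub_zero, smul_eq_mul] at ht
  exact (pos_iff_pos_of_mul_pos ht).1 (inv_pos.2 ht0)

theorem tendsto_line_nhds (d : Space3) :
    Tendsto (fun t : ℝ => x + t • d) (𝓝[>] 0) (𝓝 x) := by
  have : Continuous fun t : ℝ => x + t • d := by fun_prop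
  simpa using (this.tendsto 0).mono_left nhdsWithin_le_nhds

theorem IsInterfaceNormal.norm_eq_one (h : IsInterfaceNormal V W x n) : ‖n‖ = 1 := by
  obtain ⟨ψ, -, -, hg, rfl, -⟩ := h
  rw [norm_smul, norm_inv, norm_norm, inv_mul_cancel₀ (norm_ne_zero_iff.2 hg)]

theorem IsInterfaceNormal.swap (h : IsInterfaceNormal V W x n) : IsInterfaceNormal W V x (-n) := by
  obtain ⟨ψ, h1, h2, h3, h4, h5⟩ := h
  have hg : gradient (fun y => -ψ y) x = -gradient ψ x := by
    rw [gradient, fderiv_fun_neg, map_neg, gradient]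
  refine ⟨fun y => -ψ y, h1.neg, by simp [h2], by simpa [hg] using h3, ?_, ?_⟩
  · rw [hg, h4, norm_neg, smul_neg]
  · filter_upwards [h5] with y hy
    exact ⟨fun h => hy.2 (by linarith), fun h => hy.1 (by linarith)⟩

/-- If the half-space conditions are satisfied, then the derivative in a direction pointing into
`V` is eventually in `V`. -/
theorem eventually_line_mem {ψ : Space3 → ℝ} (hd : DifferentiableAt ℝ ψ x) (h0 : ψ x = 0)
    (hs : ∀ᶠ y in 𝓝 x, (ψ y < 0 → y ∈ V \ W) ∧ (0 < ψ y → y ∈ W \ V)) {d : Space3} :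
    (inner ℝ (gradient ψ x) d < 0 → ∀ᶠ t in 𝓝[>] (0 : ℝ), x + t • d ∈ V \ W) ∧
    (0 < inner ℝ (gradient ψ x) d → ∀ᶠ t in 𝓝[>] (0 : ℝ), x + t • d ∈ W \ V) := by
  have h1 := hasDerivAt_comp_line_of_gradient hd d
  constructor
  · intro h
    have h2 := eventually_pos_of_hasDerivAt h1.neg (by simp [h0]) (neg_pos.2 h)
    filter_upwards [h2, (tendsto_line_nhds d).eventually hs] with t ht1 ht2
    exact ht2.1 (by simpa using ht1)
  · intro h
    have h2 := eventually_pos_of_hasDerivAt h1 (by simp [h0]) h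
    filter_upwards [h2, (tendsto_line_nhds d).eventually hs] with t ht1 ht2
    exact ht2.2 ht1

theorem IsInterfaceNormal.frequently (h : IsInterfaceNormal V W x n) :
    (∃ᶠ y in 𝓝 x, y ∈ V \ W) ∧ ∃ᶠ y in 𝓝 x, y ∈ W \ V := by
  obtain ⟨ψ, h1, h2, h3, -, h5⟩ := h
  have hd := h1.differentiableAt one_ne_zero
  have hpos : 0 < inner ℝ (gradient ψ x) (gradient ψ x) := real_inner_self_pos.2 h3
  constructor
  · refine (tendsto_line_nhds (-gradient ψ x)).frequently ?_
    exact ((eventually_line_mem hd h2 h5).1 (by rw [inner_neg_right]; linarith)).frequently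
  · exact (tendsto_line_nhds (gradient ψ x)).frequently
      ((eventually_line_mem hd h2 h5).2 hpos).frequently

theorem IsInterfaceNormal.mem_frontier (h : IsInterfaceNormal V W x n) : x ∈ frontier V := by
  obtain ⟨h1, h2⟩ := h.frequently
  refine ⟨mem_closure_iff_frequently.2 (h1.mono fun y hy => hy.1), fun hi => ?_⟩
  obtain ⟨y, hy1, hy2⟩ := (h2.and_eventually (mem_interior_iff_mem_nhds.1 hi)).exists
  exact hy1.2 hy2

/-- A direction with `⟪n, d⟫ < 0 < ⟪n', d⟫` would lead into `V \ W` and `W \ V` at once. If the unit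
vectors differ, `d = n' - n` is such a direction. -/
theorem IsInterfaceNormal.unique (h : IsInterfaceNormal V W x n) (h' : IsInterfaceNormal V W x n') :
    n = n' := by
  have hn := h.norm_eq_one
  have hn' := h'.norm_eq_one
  obtain ⟨ψ, h1, h2, h3, h4, h5⟩ := h
  obtain ⟨ψ', h1', h2', h3', h4', h5'⟩ := h'
  have hd := h1.differentiableAt one_ne_zero
  have hd' := h1'.differentiableAt one_ne_zero
  have key : ∀ d, inner ℝ n d < 0 → inner ℝ n' d ≤ 0 := by
    intro d hdn
    by_contra hcon
    push Not at hcon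
    rw [h4, real_inner_smul_left] at hdn
    rw [h4', real_inner_smul_left] at hcon
    have e1 : inner ℝ (gradient ψ x) d < 0 := by
      by_contra hc
      exact absurd hdn (not_lt.2 (mul_nonneg (inv_nonneg.2 (norm_nonneg _)) (not_lt.1 hc)))
    have e2 : 0 < inner ℝ (gradient ψ' x) d := by
      by_contra hc
      exact absurd hcon (not_lt.2
        (mul_nonpos_of_nonneg_of_nonpos (inv_nonneg.2 (norm_nonneg _)) (not_lt.1 hc)))
    obtain ⟨t, ht1, ht2⟩ := (((eventually_line_mem hd h2 h5).1 e1).and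
      ((eventually_line_mem hd' h2' h5').2 e2)).exists
    exact ht1.2 ht2.1
  refine (inner_eq_one_iff_of_norm_eq_one (𝕜 := ℝ) hn hn').1 (le_antisymm ?_ ?_)
  · simpa [hn, hn'] using real_inner_le_norm n n'
  · by_contra hc
    push Not at hc
    have := key (n' - n) (by rw [inner_sub_right, real_inner_self_eq_norm_sq, hn]; linarith)
    rw [inner_sub_right, real_inner_self_eq_norm_sq, hn', real_inner_comm] at this
    linarith

theorem IsInterfaceNormal.interfaceNormal_eq (h : IsInterfaceNormal V W x n) :
    interfaceNormal V W x = n := by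
  have h' : ∃ n, IsInterfaceNormal V W x n := ⟨n, h⟩
  rw [interfaceNormal, dif_pos h']
  exact h'.choose_spec.unique h

theorem norm_interfaceNormal_le_one (V W : Set Space3) (x : Space3) :
    ‖interfaceNormal V W x‖ ≤ 1 := by
  by_cases h : ∃ n, IsInterfaceNormal V W x n
  · obtain ⟨n, hn⟩ := h
    rw [hn.interfaceNormal_eq, hn.norm_eq_one]
  · rw [interfaceNormal, dif_neg h]; simp

theorem continuousAt_gradient {ψ : Space3 → ℝ} (h : ContDiffAt ℝ 1 ψ x) :
    ContinuousAt (gradient ψ) x := by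
  have := h.continuousAt_fderiv one_ne_zero
  exact ((InnerProductSpace.toDual ℝ Space3).symm.continuous.continuousAt).comp this

/-- Near a point of a `C¹` interface, the interface is a level set, and its normal is the
normalized gradient. -/
theorem eventually_interfaceNormal_eq {ψ : Space3 → ℝ} (h1 : ContDiffAt ℝ 1 ψ x)
    (h3 : gradient ψ x ≠ 0)
    (h5 : ∀ᶠ y in 𝓝 x, (ψ y < 0 → y ∈ V \ W) ∧ (0 < ψ y → y ∈ W \ V)) :
    ∀ᶠ y in 𝓝 x, ((∃ n, IsInterfaceNormal V W y n) ↔ ψ y = 0) ∧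
      ((∃ n, IsInterfaceNormal V W y n) →
        interfaceNormal V W y = ‖gradient ψ y‖⁻¹ • gradient ψ y) := by
  filter_upwards [h1.eventually (by simp), (continuousAt_gradient h1).eventually_ne h3,
    h5.eventually_nhds] with y hy1 hy2 hy3
  have hto : ψ y = 0 → IsInterfaceNormal V W y (‖gradient ψ y‖⁻¹ • gradient ψ y) :=
    fun h0 => ⟨ψ, hy1, h0, hy2, rfl, hy3⟩
  have hfrom : (∃ n, IsInterfaceNormal V W y n) → ψ y = 0 := by
    rintro ⟨n, hn⟩
    obtain ⟨f1, f2⟩ := hn.frequently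
    rcases lt_trichotomy (ψ y) 0 with h | h | h
    · obtain ⟨z, ⟨hz1, hz2⟩, hz3⟩ :=
        (f2.and_eventually ((hy1.continuousAt.eventually_lt_const h).and hy3)).exists
      exact absurd (hz3.2.1 hz3.1).1 hz2
    · exact h
    · obtain ⟨z, ⟨hz1, hz2⟩, hz3⟩ :=
        (f1.and_eventually ((hy1.continuousAt.eventually_const_lt h).and hy3)).exists
      exact absurd (hz3.2.2 hz3.1).1 hz2
  exact ⟨⟨hfrom, fun h => ⟨_, hto h⟩⟩, fun h => (hto (hfrom h)).interfaceNormal_eq⟩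

/-- A single defining function `ψ` serves all interface points near a given one, so the normal is
locally a normalized continuous gradient. This makes the chosen normals measurable. -/
theorem continuousOn_interfaceNormal (V W : Set Space3) :
    ContinuousOn (interfaceNormal V W) {x | ∃ n, IsInterfaceNormal V W x n} := by
  rintro x ⟨n, hn⟩
  have hnx := hn.interfaceNormal_eq
  obtain ⟨ψ, h1, h2, h3, h4, h5⟩ := hn
  have hc : ContinuousAt (fun y => ‖gradient ψ y‖⁻¹ • gradient ψ y) x := by
    have hg := continuousAt_gradient h1
    exact (hg.norm.inv₀ (norm_ne_zero_iff.2 h3)).smul hg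
  refine hc.continuousWithinAt.congr_of_eventuallyEq ?_ (by rw [hnx, h4])
  filter_upwards [self_mem_nhdsWithin, mem_nhdsWithin_of_mem_nhds
    (eventually_interfaceNormal_eq h1 h3 h5)] with y hy1 hy2
  exact hy2.2 hy1

/-- Near a point of a `C¹` interface, the interface is an almost flat Lipschitz graph. -/
theorem IsInterfaceNormal.exists_almost_flat (h : IsInterfaceNormal V W x n) {ε : ℝ≥0}
    (hε : 0 < ε) :
    ∃ φ : Space3 → ℝ, LipschitzWith ε φ ∧ ∀ᶠ y in 𝓝 x,
      (inner ℝ n y + φ y < 0 → y ∈ V \ W) ∧ (0 < inner ℝ n y + φ y → y ∈ W \ V) ∧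
      ((∃ m, IsInterfaceNormal V W y m) ↔ inner ℝ n y + φ y = 0) ∧
      ((∃ m, IsInterfaceNormal V W y m) → ‖interfaceNormal V W y - n‖ ≤ ε) := by
  have hcont : ∀ᶠ y in 𝓝 x, (∃ m, IsInterfaceNormal V W y m) →
      ‖interfaceNormal V W y - n‖ ≤ ε := by
    have h1 := continuousOn_interfaceNormal V W x ⟨n, h⟩
    have h2 := h1.eventually (Metric.closedBall_mem_nhds _ (NNReal.coe_pos.2 hε))
    rw [h.interfaceNormal_eq, eventually_nhdsWithin_iff] at h2
    filter_upwards [h2] with y hy hy'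
    simpa [dist_eq_norm] using hy hy'
  obtain ⟨ψ, h1, h2, h3, h4, h5⟩ := h
  set c := ‖gradient ψ x‖⁻¹ with hc
  have hc0 : 0 < c := inv_pos.2 (norm_pos_iff.2 h3)
  -- Strict differentiability of a C¹ function makes `c * ψ - ⟪n, ·⟫` Lipschitz near `x` with a
  -- constant as small as desired; its extension to all of space is `φ`.
  have hstrict : HasStrictFDerivAt (fun y => c * ψ y) (innerSL ℝ n) x := by
    have := (h1.hasStrictFDerivAt one_ne_zero).const_mul c
    have e : innerSL ℝ n = c • fderiv ℝ ψ x := by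
      refine ContinuousLinearMap.ext fun d => ?_
      rw [h4, smul_apply, innerSL_apply_apply, real_inner_smul_left,
        inner_gradient_left, smul_eq_mul]
    rwa [e]
  obtain ⟨s, hs, hap⟩ := hstrict.approximates_deriv_on_nhds (c := ε) (Or.inr hε)
  have hlip : LipschitzOnWith ε (fun y => c * ψ y - inner ℝ n y) s := hap.lipschitzOnWith
  obtain ⟨φ, hφ, hφs⟩ := hlip.extend_real
  refine ⟨φ, hφ, ?_⟩
  filter_upwards [hs, h5, eventually_interfaceNormal_eq h1 h3 h5, hcont] with y hy1 hy2 hy3 hy4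
  have e : inner ℝ n y + φ y = c * ψ y := by rw [← hφs hy1]; ring
  rw [e]
  refine ⟨fun h => hy2.1 ?_, fun h => hy2.2 ?_, ?_, hy4⟩
  · by_contra hh; exact absurd h (not_lt.2 (mul_nonneg hc0.le (not_lt.1 hh)))
  · exact (mul_pos_iff_of_pos_left hc0).1 h
  · rw [hy3.1, mul_eq_zero, or_iff_right hc0.ne']

end InterfaceNormal

/-! ### Products and globalization of locally Lipschitz functions. -/

section LocallyLipschitz

theorem LocallyLipschitz.mul_real {E : Type*} [PseudoMetricSpace E] {u v : E → ℝ}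
    (hu : LocallyLipschitz u)
    (hv : LocallyLipschitz v) : LocallyLipschitz (fun x => u x * v x) := by
  intro x
  obtain ⟨K, s, hs, hK⟩ := hu x
  obtain ⟨L, t, ht, hL⟩ := hv x
  have hub : ∀ᶠ y in 𝓝 x, |u y| < |u x| + 1 :=
    (hu.continuous.abs.tendsto x).eventually_lt_const (by linarith)
  have hvb : ∀ᶠ y in 𝓝 x, |v y| < |v x| + 1 :=
    (hv.continuous.abs.tendsto x).eventually_lt_const (by linarith)
  refine ⟨(|u x| + 1).toNNReal * L + (|v x| + 1).toNNReal * K, _,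
    inter_mem (inter_mem hs ht) (inter_mem hub hvb), ?_⟩
  apply LipschitzOnWith.of_dist_le_mul
  rintro y ⟨⟨hys, hyt⟩, hyu, hyv⟩ z ⟨⟨hzs, hzt⟩, hzu, hzv⟩
  have h1 := hK.dist_le_mul y hys z hzs
  have h2 := hL.dist_le_mul y hyt z hzt
  rw [Real.dist_eq] at h1 h2 ⊢
  have hyu' : |u y| < |u x| + 1 := hyu
  have hzv' : |v z| < |v x| + 1 := hzv
  push_cast
  rw [Real.coe_toNNReal _ (by positivity), Real.coe_toNNReal _ (by positivity)]
  calc |u y * v y - u z * v z| = |u y * (v y - v z) + v z * (u y - u z)| := by congr 1; ring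
    _ ≤ |u y| * |v y - v z| + |v z| * |u y - u z| := by
      rw [← abs_mul, ← abs_mul]; exact abs_add_le _ _
    _ ≤ (|u x| + 1) * (L * dist y z) + (|v x| + 1) * (K * dist y z) := by gcongr
    _ = _ := by ring

/-- Compactness gives a constant on a ball one unit larger than a ball containing the support. A
point of the smaller ball and a point outside the larger one are at distance at least 1, so there
the bound of `u` serves as a Lipschitz constant. -/
theorem LocallyLipschitz.exists_lipschitzWith_of_hasCompactSupport {E : Type*}
    [NormedAddCommGroup E] [NormedSpace ℝ E] [FiniteDimensional ℝ E] {u : E → ℝ}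
        (hu : LocallyLipschitz u) (hc : HasCompactSupport u) :
    ∃ K, LipschitzWith K u := by
  obtain ⟨R, hR⟩ := hc.isBounded.subset_closedBall 0
  obtain ⟨K, hK⟩ := (hu.locallyLipschitzOn (s :=
      Metric.closedBall 0 (R + 1))).exists_lipschitzOnWith_of_compact
    (isCompact_closedBall 0 (R + 1))
  obtain ⟨M, hM⟩ := hu.continuous.bounded_above_of_compact_support hc
  have hM0 : 0 ≤ M := (norm_nonneg _).trans (hM 0)
  have hz : ∀ x, x ∉ Metric.closedBall (0 : E) R → u x = 0 := fun x hx =>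
    image_eq_zero_of_notMem_tsupport fun h => hx (hR h)
  have key : ∀ x y, x ∈ Metric.closedBall (0 : E) (R + 1) → y ∉ Metric.closedBall (0 : E) (R + 1) →
      |u x - u y| ≤ (K + M) * dist x y := by
    intro x y hx hy
    rw [mem_closedBall_zero_iff, not_le] at hy
    have hy' : u y = 0 := hz y (by rw [mem_closedBall_zero_iff]; linarith)
    by_cases hx' : x ∈ Metric.closedBall (0 : E) R
    · rw [mem_closedBall_zero_iff] at hx'
      have h1 : 1 ≤ dist x y := by
        have := norm_sub_norm_le y x
        rw [dist_comm, dist_eq_norm]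
        linarith
      have h2 := hM x
      rw [Real.norm_eq_abs] at h2
      rw [hy', sub_zero]
      have hK0 : (0 : ℝ) ≤ K := K.2
      nlinarith
    · rw [hz x hx', hy', sub_zero, abs_zero]
      positivity
  refine ⟨K + M.toNNReal, LipschitzWith.of_dist_le_mul fun x y => ?_⟩
  push_cast
  rw [Real.coe_toNNReal _ hM0, Real.dist_eq]
  by_cases hx : x ∈ Metric.closedBall (0 : E) (R + 1) <;>
    by_cases hy : y ∈ Metric.closedBall (0 : E) (R + 1)
  · have := hK.dist_le_mul x hx y hy
    rw [Real.dist_eq] at this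
    refine this.trans ?_
    gcongr
    linarith
  · exact key x y hx hy
  · rw [abs_sub_comm, dist_comm]; exact key y x hy hx
  · rw [mem_closedBall_zero_iff, not_le] at hx hy
    rw [hz x (by rw [mem_closedBall_zero_iff]; linarith),
      hz y (by rw [mem_closedBall_zero_iff]; linarith), sub_zero, abs_zero]
    positivity

end LocallyLipschitz

/-! ### Approximate divergence theorem near a single point. -/

section LocalGaussGreen

variable {E W S : Set Space3}

/-- Outside a null set, the function is supported on a measurable set on which the normal exists and
hence is continuous. -/
theorem aestronglyMeasurable_smul_interfaceNormal {μ : Measure Space3} {p : Space3 → ℝ}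
    (hp : Measurable p) (hreg : ∀ᵐ x ∂μ, p x ≠ 0 → ∃ n, IsInterfaceNormal E W x n) :
    AEStronglyMeasurable (fun x => p x • interfaceNormal E W x) μ := by
  set N := {x | ¬ (p x ≠ 0 → ∃ n, IsInterfaceNormal E W x n)} with hN
  have hN0 : μ (toMeasurable μ N) = 0 := by rw [measure_toMeasurable]; exact hreg
  set T := {x | p x ≠ 0} \ toMeasurable μ N with hT
  have hTm : MeasurableSet T :=
    (hp (measurableSet_singleton 0).compl).diff (measurableSet_toMeasurable _ _)
  have hTs : T ⊆ {x | ∃ n, IsInterfaceNormal E W x n} := by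
    intro x hx
    by_contra h
    exact hx.2 (subset_toMeasurable _ _ fun h' => h (h' hx.1))
  have h1 : AEStronglyMeasurable (fun x => p x • interfaceNormal E W x) (μ.restrict T) :=
    hp.aestronglyMeasurable.smul
      (((continuousOn_interfaceNormal E W).mono hTs).aestronglyMeasurable hTm)
  refine ((aestronglyMeasurable_indicator_iff hTm).2 h1).congr ?_
  have : ∀ᵐ x ∂μ, x ∉ toMeasurable μ N := measure_eq_zero_iff_ae_notMem.1 hN0
  filter_upwards [this] with x hx
  by_cases hxT : x ∈ T
  · rw [indicator_of_mem hxT]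
  · have : p x = 0 := by
      by_contra h
      exact hxT ⟨h, hx⟩
    rw [indicator_of_notMem hxT, this, zero_smul]

theorem abs_mul_inner_interfaceNormal_le {u : ℝ} (h0 : 0 ≤ u) (b x : Space3) :
    |u * inner ℝ b (interfaceNormal E W x)| ≤ ‖b‖ * u := by
  rw [abs_mul, abs_of_nonneg h0, mul_comm]
  gcongr
  refine (abs_real_inner_le_norm _ _).trans ?_
  exact mul_le_of_le_one_right (norm_nonneg _) (norm_interfaceNormal_le_one _ _ _)

theorem integrableOn_mul_inner_interfaceNormal {μ : Measure Space3} {p : Space3 → ℝ}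
    (hp : Measurable p) (h0 : ∀ x, 0 ≤ p x) (hi : Integrable p μ)
    (hreg : ∀ᵐ x ∂μ, 0 < p x → ∃ n, IsInterfaceNormal E W x n) (b : Space3) :
    Integrable (fun x => p x * inner ℝ b (interfaceNormal E W x)) μ := by
  have h1 := aestronglyMeasurable_smul_interfaceNormal (E := E) (W := W) (μ := μ) hp
    (by filter_upwards [hreg] with x hx h using hx (lt_of_le_of_ne (h0 x) h.symm))
  refine (hi.const_mul ‖b‖).mono ?_ (.of_forall fun x => ?_)
  · simp_rw [← inner_smul_right]
    exact aestronglyMeasurable_const.inner h1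
  · rw [Real.norm_eq_abs, Real.norm_eq_abs, abs_of_nonneg (mul_nonneg (norm_nonneg b) (h0 x))]
    exact abs_mul_inner_interfaceNormal_le (h0 x) b x

/-- The approximate divergence theorem for functions supported near a point `x₀`. -/
def ApproxGaussGreenAt (E W S : Set Space3) (w : Space3 → ℝ) (b x₀ : Space3) : Prop :=
  ∀ ε : ℝ, 0 < ε → ∃ r : ℝ, 0 < r ∧ ∀ (u : Space3 → ℝ) (K : ℝ≥0), LipschitzWith K u →
    HasCompactSupport u → (∀ x, 0 ≤ u x) → (∀ x, u x ≤ w x) →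
    tsupport u ⊆ Metric.ball x₀ r →
    IntegrableOn u S μHE[2] ∧
    |(∫ x in E, lineDeriv ℝ u x b) - ∫ x in S, u x * inner ℝ b (interfaceNormal E W x) ∂μHE[2]| ≤
      ε * ∫ x in S, u x ∂μHE[2]

/-- Near such a point `E` is everything or nothing, so the volume integral vanishes. The surface
integrals vanish as well, since normals exist only on the frontier while almost every point of `S`
with `w > 0` has one. -/
theorem approxGaussGreenAt_of_notMem_frontier {w : Space3 → ℝ}
    (hreg : ∀ᵐ x ∂(μHE[2] : Measure Space3).restrict S,
      0 < w x → ∃ n, IsInterfaceNormal E W x n) (b : Space3) {x₀ : Space3}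
    (hx₀ : x₀ ∉ frontier E) : ApproxGaussGreenAt E W S w b x₀ := by
  intro ε hε
  have hopen : (frontier E)ᶜ ∈ 𝓝 x₀ := isClosed_frontier.isOpen_compl.mem_nhds hx₀
  have hcases : E ∈ 𝓝 x₀ ∨ Eᶜ ∈ 𝓝 x₀ := by
    rw [← mem_interior_iff_mem_nhds, ← mem_interior_iff_mem_nhds, interior_compl]
    by_contra h
    push Not at h
    exact hx₀ ⟨not_not.1 h.2, h.1⟩
  obtain ⟨r1, hr1, hb1⟩ := Metric.mem_nhds_iff.1 hopen
  have hvol : ∃ r2 > 0, ∀ (u : Space3 → ℝ) (K : ℝ≥0), LipschitzWith K u →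
      HasCompactSupport u → (∀ x, 0 ≤ u x) → tsupport u ⊆ Metric.ball x₀ r2 →
      ∫ x in E, lineDeriv ℝ u x b = 0 := by
    rcases hcases with h | h
    · obtain ⟨r2, hr2, hb2⟩ := Metric.mem_nhds_iff.1 h
      refine ⟨r2, hr2, fun u K hu hc h0 ht => ?_⟩
      rw [← integral_lineDeriv_eq_zero hu hc h0 b]
      exact setIntegral_eq_integral_of_forall_compl_eq_zero fun x hx =>
        lineDeriv_eq_zero_of_notMem_tsupport (fun hxt => hx (hb2 (ht hxt))) b
    · obtain ⟨r2, hr2, hb2⟩ := Metric.mem_nhds_iff.1 h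
      refine ⟨r2, hr2, fun u K hu hc h0 ht => ?_⟩
      refine setIntegral_eq_zero_of_forall_eq_zero fun x hx => ?_
      exact lineDeriv_eq_zero_of_notMem_tsupport (fun hxt => hb2 (ht hxt) hx) b
  obtain ⟨r2, hr2, hvol⟩ := hvol
  refine ⟨min r1 r2, lt_min hr1 hr2, fun u K hu hc h0 huw ht => ?_⟩
  have hz : ∀ᵐ x ∂(μHE[2] : Measure Space3).restrict S, u x = 0 := by
    filter_upwards [hreg] with x hx
    by_contra h
    obtain ⟨n, hn⟩ := hx ((lt_of_le_of_ne (h0 x) (Ne.symm h)).trans_le (huw x))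
    refine hb1 ?_ hn.mem_frontier
    exact Metric.ball_subset_ball (min_le_left _ _) (ht (subset_tsupport _ h))
  have e1 : ∫ x in S, u x * inner ℝ b (interfaceNormal E W x) ∂μHE[2] = 0 :=
    integral_eq_zero_of_ae (by filter_upwards [hz] with x hx; simp [hx])
  have e2 : ∫ x in S, u x ∂μHE[2] = 0 :=
    integral_eq_zero_of_ae (by filter_upwards [hz] with x hx; simp [hx])
  refine ⟨(integrable_zero _ _ _).congr (by filter_upwards [hz] with x hx; simp [hx]), ?_⟩
  rw [e1, e2, hvol u K hu hc h0 (ht.trans (Metric.ball_subset_ball (min_le_right _ _)))]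
  simp

/-- Near `x₀` the set `E` is a subgraph of small slope up to volume zero, and its normal differs
little from `e`; so the estimate for subgraphs with the constant normal `e` applies. -/
theorem approxGaussGreenAt_of_isInterfaceNormal (hE : MeasurableSet E) (hS : MeasurableSet S)
    {w : Space3 → ℝ} (hfr : ∀ x ∈ frontier E, 0 < w x → x ∈ S)
    (hreg : ∀ᵐ x ∂(μHE[2] : Measure Space3).restrict S,
      0 < w x → ∃ n, IsInterfaceNormal E W x n) (b : Space3) {x₀ e : Space3}
    (he : IsInterfaceNormal E W x₀ e) : ApproxGaussGreenAt E W S w b x₀ := by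
  intro ε hε
  -- The factor 9 is 8 from the subgraph estimate plus 1 from the oscillation of the normal.
  obtain ⟨δ, hδ0, hδ1, hδε⟩ : ∃ δ : ℝ≥0, 0 < δ ∧ (δ : ℝ) ≤ 1 / 2 ∧ 9 * δ * ‖b‖ ≤ ε := by
    have hpos : 0 < min (1 / 2) (ε / (9 * (‖b‖ + 1))) := by positivity
    refine ⟨(min (1 / 2) (ε / (9 * (‖b‖ + 1)))).toNNReal, Real.toNNReal_pos.2 hpos, ?_, ?_⟩
    · rw [Real.coe_toNNReal _ hpos.le]; exact min_le_left _ _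
    · rw [Real.coe_toNNReal _ hpos.le]
      calc 9 * min (1 / 2) (ε / (9 * (‖b‖ + 1))) * ‖b‖
          ≤ 9 * (ε / (9 * (‖b‖ + 1))) * (‖b‖ + 1) := by
            gcongr
            · exact min_le_right _ _
            · linarith
        _ = ε := by field_simp
  have he1 := he.norm_eq_one
  obtain ⟨φ, hφ, hev⟩ := he.exists_almost_flat hδ0
  obtain ⟨r, hr, hball⟩ := Metric.eventually_nhds_iff_ball.1 hev
  refine ⟨r, hr, fun u K hu hc h0 huw ht => ?_⟩
  have hd : Module.finrank ℝ (ℝ ∙ e)ᗮ = 2 := by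
    have h3 : Module.finrank ℝ Space3 = 3 := by simp
    have := (ℝ ∙ e).finrank_add_finrank_orthogonal
    rw [finrank_span_singleton (norm_ne_zero_iff.1 (by rw [he1]; norm_num)), h3] at this
    omega
  obtain ⟨hi, hmain⟩ := abs_setIntegral_lineDeriv_sub_le he1 hφ hδ1 hd hu hc h0 b
  have hφc := hφ.continuous
  set G := {x : Space3 | inner ℝ e x + φ x = 0} with hG
  have hGm : MeasurableSet G := (isClosed_eq (by fun_prop) continuous_const).measurableSet
  have hinball : ∀ x, u x ≠ 0 → x ∈ Metric.ball x₀ r := fun x hx => ht (subset_tsupport _ hx)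
  -- Where `u > 0`, almost every point of `S` has a normal and so lies on the level set; conversely,
  -- points of the level set there are interface points, hence in the frontier and in `S` by `hfr`.
  have hmem : ∀ᵐ x ∂(μHE[2] : Measure Space3), 0 < u x → (x ∈ S ↔ x ∈ G) := by
    filter_upwards [(ae_restrict_iff' hS).1 hreg] with x hx hux
    have hw := hux.trans_le (huw x)
    have hb := hball x (hinball x hux.ne')
    constructor
    · exact fun hxS => hb.2.2.1.1 (hx hxS hw)
    · intro hxG
      obtain ⟨n, hn⟩ := hb.2.2.1.2 hxG
      exact hfr x hn.mem_frontier hw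
  have htrans : ∀ F : Space3 → ℝ, (∀ x, u x = 0 → F x = 0) →
      S.indicator F =ᵐ[μHE[2]] G.indicator F := by
    intro F hF
    filter_upwards [hmem] with x hx
    rcases (h0 x).eq_or_lt with h | h
    · simp [indicator, hF x h.symm]
    · by_cases hxS : x ∈ S
      · rw [indicator_of_mem hxS, indicator_of_mem ((hx h).1 hxS)]
      · rw [indicator_of_notMem hxS, indicator_of_notMem fun hh => hxS ((hx h).2 hh)]
  have htransi : ∀ F : Space3 → ℝ, (∀ x, u x = 0 → F x = 0) →
      ∫ x in S, F x ∂μHE[2] = ∫ x in G, F x ∂μHE[2] := by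
    intro F hF
    rw [← integral_indicator hS, ← integral_indicator hGm]
    exact integral_congr_ae (htrans F hF)
  have hiS : IntegrableOn u S μHE[2] := by
    rw [← integrable_indicator_iff hS]
    exact (integrable_congr (htrans u fun _ h => h)).2 ((integrable_indicator_iff hGm).2 hi)
  refine ⟨hiS, ?_⟩
  rw [htransi u fun _ h => h, htransi _ fun x h => by rw [h, zero_mul]]
  have hvol : ∫ x in E, lineDeriv ℝ u x b =
      ∫ x in {x | inner ℝ e x + φ x < 0}, lineDeriv ℝ u x b := by
    have hlt : MeasurableSet {x : Space3 | inner ℝ e x + φ x < 0} :=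
      (isOpen_lt (by fun_prop) continuous_const).measurableSet
    rw [← integral_indicator hE, ← integral_indicator hlt]
    refine integral_congr_ae ?_
    have h0' := volume_lipschitz_graph_eq_zero he1 hφ hδ1
    filter_upwards [measure_eq_zero_iff_ae_notMem.1 h0'] with x hx
    by_cases hxt : x ∈ tsupport u
    · have hb := hball x (ht hxt)
      rcases lt_or_gt_of_ne (show inner ℝ e x + φ x ≠ 0 from hx) with h | h
      · rw [indicator_of_mem (hb.1 h).1, indicator_of_mem (by exact h)]
      · have hx' : x ∉ {x : Space3 | inner ℝ e x + φ x < 0} := fun hh =>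
          absurd (show inner ℝ e x + φ x < 0 from hh) (not_lt.2 h.le)
        rw [indicator_of_notMem (hb.2.1 h).2, indicator_of_notMem hx']
    · simp [indicator, lineDeriv_eq_zero_of_notMem_tsupport hxt b]
  rw [hvol]
  have hregG : ∀ᵐ x ∂(μHE[2] : Measure Space3).restrict G,
      0 < u x → ∃ n, IsInterfaceNormal E W x n := by
    rw [ae_restrict_iff' hGm]
    exact .of_forall fun x hxG hux => (hball x (hinball x hux.ne')).2.2.1.2 hxG
  have hni := integrableOn_mul_inner_interfaceNormal hu.continuous.measurable h0 hi hregG b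
  have hn : |(∫ x in G, u x * inner ℝ b (interfaceNormal E W x) ∂μHE[2]) -
      inner ℝ b e * ∫ x in G, u x ∂μHE[2]| ≤ δ * ‖b‖ * ∫ x in G, u x ∂μHE[2] := by
    rw [← integral_const_mul, ← integral_const_mul, ← integral_sub hni (hi.const_mul _)]
    refine (norm_integral_le_of_norm_le (f := fun x => u x * inner ℝ b (interfaceNormal E W x) -
      inner ℝ b e * u x) (hi.const_mul (δ * ‖b‖)) ?_)
    filter_upwards [hregG] with x hx
    rcases (h0 x).eq_or_lt with h | h
    · simp [← h]
    · have h1 := (hball x (hinball x h.ne')).2.2.2 (hx h)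
      have h2 : u x * inner ℝ b (interfaceNormal E W x) - inner ℝ b e * u x =
          u x * inner ℝ b (interfaceNormal E W x - e) := by rw [inner_sub_right]; ring
      rw [h2, Real.norm_eq_abs, abs_mul, abs_of_pos h]
      have h3 := (abs_real_inner_le_norm b (interfaceNormal E W x - e)).trans
        (mul_le_mul_of_nonneg_left h1 (norm_nonneg b))
      calc u x * |inner ℝ b (interfaceNormal E W x - e)| ≤ u x * (‖b‖ * δ) := by gcongr
        _ = _ := by ring
  have hT := abs_sub_le (∫ x in {x | inner ℝ e x + φ x < 0}, lineDeriv ℝ u x b)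
    (inner ℝ b e * ∫ x in G, u x ∂μHE[2])
    (∫ x in G, u x * inner ℝ b (interfaceNormal E W x) ∂μHE[2])
  rw [abs_sub_comm] at hn
  have hI : 0 ≤ ∫ x in G, u x ∂μHE[2] := integral_nonneg fun _ => h0 _
  have := mul_le_mul_of_nonneg_right hδε hI
  linarith

end LocalGaussGreen

theorem integral_lineDeriv_finset_sum {E ι : Type*} [NormedAddCommGroup E] [InnerProductSpace ℝ E]
    [FiniteDimensional ℝ E] [MeasurableSpace E] [BorelSpace E] {t : Finset ι} {u : ι → E → ℝ}
    (hu : ∀ i ∈ t, ∃ K, LipschitzWith K (u i)) (hc : ∀ i ∈ t, HasCompactSupport (u i))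
    (s : Set E) (b : E) :
    ∫ x in s, lineDeriv ℝ (fun y => ∑ i ∈ t, u i y) x b =
      ∑ i ∈ t, ∫ x in s, lineDeriv ℝ (u i) x b := by
  rw [← integral_finsetSum t fun i hi =>
    (integrable_lineDeriv_of_lipschitz (hu i hi).choose_spec (hc i hi) b).integrableOn]
  refine integral_congr_ae (ae_restrict_of_ae ?_)
  have h : ∀ᵐ x : E, ∀ i ∈ t, DifferentiableAt ℝ (u i) x := by
    rw [Filter.eventually_all_finset]
    exact fun i hi => (hu i hi).choose_spec.ae_differentiableAt
  filter_upwards [h] with x hx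
  have h1 : HasFDerivAt (fun y => ∑ i ∈ t, u i y) (∑ i ∈ t, fderiv ℝ (u i) x) x :=
    HasFDerivAt.fun_sum fun i hi => (hx i hi).hasFDerivAt
  rw [h1.differentiableAt.lineDeriv_eq_fderiv, h1.fderiv, sum_apply]
  exact Finset.sum_congr rfl fun i hi => ((hx i hi).lineDeriv_eq_fderiv).symm

/-! ### From local to global estimates, and efficient coverings of sets of zero area. -/

section GaussGreen

variable {E W S : Set Space3}

/-- The divergence theorem for functions supported near good points. -/
theorem gaussGreen_of_approxGaussGreenAt {w u : Space3 → ℝ} {b : Space3} {K : ℝ≥0}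
    (hi : IntegrableOn w S μHE[2])
    (hreg : ∀ᵐ x ∂(μHE[2] : Measure Space3).restrict S,
      0 < w x → ∃ n, IsInterfaceNormal E W x n)
    (hu : LipschitzWith K u) (hc : HasCompactSupport u) (h0 : ∀ x, 0 ≤ u x)
    (huw : ∀ x, u x ≤ w x) (happrox : ∀ x ∈ tsupport u, ApproxGaussGreenAt E W S w b x) :
    ∫ x in E, lineDeriv ℝ u x b = ∫ x in S, u x * inner ℝ b (interfaceNormal E W x) ∂μHE[2] := by
  have hregu : ∀ᵐ x ∂(μHE[2] : Measure Space3).restrict S,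
      0 < u x → ∃ n, IsInterfaceNormal E W x n := by
    filter_upwards [hreg] with x hx h using hx (h.trans_le (huw x))
  have hiu : IntegrableOn u S μHE[2] := Integrable.mono hi
      hu.continuous.measurable.aestronglyMeasurable
    (.of_forall fun x => by
      rw [Real.norm_eq_abs, Real.norm_eq_abs, abs_of_nonneg (h0 x),
        abs_of_nonneg ((h0 x).trans (huw x))]
      exact huw x)
  have hI0 : 0 ≤ ∫ x in S, u x ∂μHE[2] := integral_nonneg fun _ => h0 _
  have key : ∀ ε : ℝ, 0 < ε →
      |(∫ x in E, lineDeriv ℝ u x b) - ∫ x in S, u x * inner ℝ b (interfaceNormal E W x) ∂μHE[2]| ≤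
      ε * ∫ x in S, u x ∂μHE[2] := by
    intro ε hε
    choose! r hr hrest using fun x hx => happrox x hx ε hε
    obtain ⟨t, ht⟩ := hc.isCompact.elim_nhds_subcover' (fun x _ => Metric.ball x (r x))
      (fun x hx => Metric.ball_mem_nhds x (hr x hx))
    obtain ⟨ρ, hρ⟩ := SmoothPartitionOfUnity.exists_isSubordinate 𝓘(ℝ, Space3)
      (isClosed_tsupport u) (fun i : t => Metric.ball (i : Space3) (r i))
      (fun _ => Metric.isOpen_ball) (fun x hx => by
        obtain ⟨i, hi, hxi⟩ := mem_iUnion₂.1 (ht hx)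
        exact mem_iUnion.2 ⟨⟨i, hi⟩, hxi⟩)
    set v : t → Space3 → ℝ := fun i x => ρ i x * u x with hv
    have hvc : ∀ i, HasCompactSupport (v i) := fun i => hc.mul_left
    have hvK : ∀ i, ∃ K, LipschitzWith K (v i) := fun i =>
      (((ρ i).contMDiff.contDiff.of_le (by simp)).locallyLipschitz.mul_real
        hu.locallyLipschitz).exists_lipschitzWith_of_hasCompactSupport (hvc i)
    have hv0 : ∀ i x, 0 ≤ v i x := fun i x => mul_nonneg (ρ.nonneg i x) (h0 x)
    have hvu : ∀ i x, v i x ≤ u x := fun i x => mul_le_of_le_one_left (h0 x) (ρ.le_one i x)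
    have hvs : ∀ i, tsupport (v i) ⊆ Metric.ball (i : Space3) (r i) := fun i =>
      (tsupport_mul_subset_left).trans (hρ i)
    have hsum : ∀ x, u x = ∑ i, v i x := by
      intro x
      by_cases hx : x ∈ tsupport u
      · have := ρ.sum_eq_one hx
        rw [finsum_eq_sum_of_fintype] at this
        rw [hv, ← Finset.sum_mul, this, one_mul]
      · simp [hv, image_eq_zero_of_notMem_tsupport hx]
    have hest := fun i : t => hrest i i.1.2 (v i) (hvK i).choose (hvK i).choose_spec (hvc i)
      (hv0 i) (fun x => (hvu i x).trans (huw x)) (hvs i)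
    have hregv : ∀ i, ∀ᵐ x ∂(μHE[2] : Measure Space3).restrict S,
        0 < v i x → ∃ n, IsInterfaceNormal E W x n := fun i => by
      filter_upwards [hregu] with x hx h using hx (h.trans_le (hvu i x))
    have e1 : ∫ x in E, lineDeriv ℝ u x b = ∑ i, ∫ x in E, lineDeriv ℝ (v i) x b := by
      rw [← integral_lineDeriv_finset_sum (fun i _ => hvK i) (fun i _ => hvc i)]
      congr 1 with x
      congr 1
      ext y
      exact hsum y
    have e2 : ∫ x in S, u x * inner ℝ b (interfaceNormal E W x) ∂μHE[2] =
        ∑ i, ∫ x in S, v i x * inner ℝ b (interfaceNormal E W x) ∂μHE[2] := by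
      rw [← integral_finsetSum _ fun i _ => integrableOn_mul_inner_interfaceNormal
        (hvK i).choose_spec.continuous.measurable (hv0 i) (hest i).1 (hregv i) b]
      congr 1 with x
      rw [← Finset.sum_mul, ← hsum]
    have e3 : ∫ x in S, u x ∂μHE[2] = ∑ i, ∫ x in S, v i x ∂μHE[2] := by
      rw [← integral_finsetSum _ fun i _ => (hest i).1]
      congr 1 with x
      exact hsum x
    -- The local errors are ε times the surface integrals of the pieces, so their sum is ε times
    -- that of `u`, however many pieces there are.
    rw [e1, e2, e3, ← Finset.sum_sub_distrib, Finset.mul_sum]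
    exact (Finset.abs_sum_le_sum_abs _ _).trans (Finset.sum_le_sum fun i _ => (hest i).2)
  have hzero : |(∫ x in E, lineDeriv ℝ u x b) -
      ∫ x in S, u x * inner ℝ b (interfaceNormal E W x) ∂μHE[2]| ≤ 0 := by
    refine le_of_forall_pos_le_add fun η hη => ?_
    rw [zero_add]
    refine (key (η / ((∫ x in S, u x ∂μHE[2]) + 1)) (by positivity)).trans ?_
    rw [div_mul_eq_mul_div, div_le_iff₀ (by positivity)]
    nlinarith
  exact sub_eq_zero.1 (abs_eq_zero.1 (le_antisymm hzero (abs_nonneg _)))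

/-- A set of zero area has coverings by small balls with an arbitrarily small sum of squared
radii. -/
theorem exists_ball_cover_of_hausdorffMeasure_two_eq_zero {X : Type*} [MetricSpace X]
    [MeasurableSpace X] [BorelSpace X] {N : Set X} (hN : (μH[2] : Measure X) N = 0) {ρ η : ℝ}
    (hρ : 0 < ρ) (hη : 0 < η) :
    ∃ (ι : Type) (x : ι → X) (r : ι → ℝ), (∀ i, x i ∈ N) ∧ (∀ i, 0 < r i ∧ r i ≤ ρ) ∧
      N ⊆ ⋃ i, Metric.ball (x i) (r i) ∧ ∀ t : Finset ι, ∑ i ∈ t, r i ^ 2 ≤ η := by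
  rw [Measure.hausdorffMeasure_apply] at hN
  have h1 := ENNReal.iSup_eq_zero.1 (ENNReal.iSup_eq_zero.1 hN (ENNReal.ofReal (ρ / 2)))
    (ENNReal.ofReal_pos.2 (by linarith))
  have h2 : (⨅ (t : ℕ → Set X) (_ : N ⊆ ⋃ n, t n) (_ : ∀ n, Metric.ediam (t n) ≤ ENNReal.ofReal
      (ρ / 2)),
      ∑' n, ⨆ _ : (t n).Nonempty, Metric.ediam (t n) ^ (2 : ℝ)) < ENNReal.ofReal (η / 4) := by
    rw [h1]; exact ENNReal.ofReal_pos.2 (by linarith)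
  simp only [iInf_lt_iff] at h2
  obtain ⟨t, htN, htd, hts⟩ := h2
  -- The covering sets may have diameter zero and need not be open. Summable increments `a k` below
  -- enlarge the diameters to positive radii of open balls centred in `N`.
  obtain ⟨s, hs0, hss⟩ := ENNReal.exists_pos_sum_of_countable
    (ENNReal.ofReal_pos.2 (show 0 < η / 4 by linarith)).ne' ℕ
  set d : ℕ → ℝ := fun k => (Metric.ediam (t k)).toReal with hd
  set a : ℕ → ℝ := fun k => min (min (ρ / 2) 1) (s k) with ha
  have ha0 : ∀ k, 0 < a k := fun k => by
    have := hs0 k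
    simp only [ha]; positivity
  have hfin : ∀ k, Metric.ediam (t k) ≠ ⊤ := fun k => ((htd k).trans_lt ENNReal.ofReal_lt_top).ne
  have hdle : ∀ k, d k ≤ ρ / 2 := fun k => ENNReal.toReal_le_of_le_ofReal (by linarith) (htd k)
  have hd0 : ∀ k, 0 ≤ d k := fun k => ENNReal.toReal_nonneg
  refine ⟨{k // (t k ∩ N).Nonempty}, fun k => k.2.some, fun k => d k + a k,
    fun k => k.2.some_mem.2, fun k => ⟨?_, ?_⟩, ?_, ?_⟩
  · have := ha0 k; have := hd0 k; linarith
  · have h3 : a k ≤ ρ / 2 := (min_le_left _ _).trans (min_le_left _ _)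
    have := hdle k
    linarith
  · intro y hy
    obtain ⟨k, hk⟩ := mem_iUnion.1 (htN hy)
    have hne : (t k ∩ N).Nonempty := ⟨y, hk, hy⟩
    refine mem_iUnion.2 ⟨⟨k, hne⟩, ?_⟩
    rw [Metric.mem_ball]
    have h4 : dist y hne.some ≤ d k := by
      rw [dist_edist]
      exact ENNReal.toReal_mono (hfin k) (Metric.edist_le_ediam_of_mem hk hne.some_mem.1)
    have := ha0 k
    linarith
  · intro T
    -- From (d + a)² ≤ 2d² + 2a² and a² ≤ a ≤ s. Each of the two sums is at most η/4, which gives η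
    -- in total.
    have h5 : ∀ k : {k // (t k ∩ N).Nonempty}, (d k + a k) ^ 2 ≤ 2 * (d k) ^ 2 + 2 * s k := by
      intro k
      have e1 : a k ≤ 1 := (min_le_left _ _).trans (min_le_right _ _)
      have e2 : a k ≤ s k := min_le_right _ _
      have e3 := ha0 k
      nlinarith [sq_nonneg (d k - a k)]
    have h6 : ∑ k ∈ T, (d k) ^ 2 ≤ η / 4 := by
      have : ENNReal.ofReal (∑ k ∈ T, (d k) ^ 2) ≤ ENNReal.ofReal (η / 4) := by
        rw [ENNReal.ofReal_sum_of_nonneg fun _ _ => sq_nonneg _]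
        refine le_trans ?_ hts.le
        refine le_trans (Finset.sum_le_sum (g := fun k : {k // (t k ∩ N).Nonempty} =>
          ⨆ _ : (t k).Nonempty, Metric.ediam (t k) ^ (2 : ℝ)) fun k _ => ?_) ?_
        · rw [iSup_pos k.2.left, ENNReal.ofReal_pow (hd0 k), ENNReal.ofReal_toReal (hfin k)]
          simp
        · refine (ENNReal.sum_le_tsum T).trans ?_
          exact ENNReal.tsum_comp_le_tsum_of_injective Subtype.val_injective
            (fun k => ⨆ _ : (t k).Nonempty, Metric.ediam (t k) ^ (2 : ℝ))
      exact (ENNReal.ofReal_le_ofReal_iff (by linarith)).1 this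
    have h7 : ∑ k ∈ T, (s k : ℝ) ≤ η / 4 := by
      have : ENNReal.ofReal (∑ k ∈ T, (s k : ℝ)) ≤ ENNReal.ofReal (η / 4) := by
        rw [ENNReal.ofReal_sum_of_nonneg fun _ _ => NNReal.coe_nonneg _]
        simp only [ENNReal.ofReal_coe_nnreal]
        refine le_trans ?_ hss.le
        refine (ENNReal.sum_le_tsum T).trans ?_
        exact ENNReal.tsum_comp_le_tsum_of_injective Subtype.val_injective
            (fun k => (s k : ℝ≥0∞))
      exact (ENNReal.ofReal_le_ofReal_iff (by linarith)).1 this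
    refine (Finset.sum_le_sum fun k _ => h5 k).trans ?_
    rw [Finset.sum_add_distrib, ← Finset.mul_sum, ← Finset.mul_sum]
    linarith

end GaussGreen

/-! ### Removal of singular sets of zero area. -/

section GaussGreen

variable {E W S : Set Space3}

/-- Off the level set of the defining function, nearby points are interior or exterior. So the
singular part of the frontier is closed. -/
theorem IsInterfaceNormal.eventually_frontier {x n : Space3} (h : IsInterfaceNormal E W x n) :
    ∀ᶠ y in 𝓝 x, y ∈ frontier E → ∃ m, IsInterfaceNormal E W y m := by
  obtain ⟨ψ, h1, h2, h3, h4, h5⟩ := h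
  filter_upwards [h1.eventually (by simp), eventually_interfaceNormal_eq h1 h3 h5,
    h5.eventually_nhds] with y hy1 hy2 hy3 hyf
  refine hy2.1.2 ?_
  rcases lt_trichotomy (ψ y) 0 with h | h | h
  · refine absurd (mem_interior_iff_mem_nhds.2 ?_) hyf.2
    filter_upwards [hy1.continuousAt.eventually_lt_const h, hy3] with z hz1 hz2
    exact (hz2.1 hz1).1
  · exact h
  · obtain ⟨z, hz1, hz2, hz3⟩ := ((mem_closure_iff_frequently.1 hyf.1).and_eventually
      ((hy1.continuousAt.eventually_const_lt h).and hy3)).exists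
    exact absurd hz1 (hz3.2 hz2).2

theorem volume_closedBall_two_mul (x : Space3) {r : ℝ} (hr : 0 ≤ r) :
    (volume (Metric.closedBall x (2 * r))).toReal =
      8 * (volume (Metric.ball (0 : Space3) 1)).toReal * r ^ 3 := by
  rw [Measure.addHaar_closedBall _ _ (by positivity), ENNReal.toReal_mul,
    ENNReal.toReal_ofReal (by positivity)]
  simp only [finrank_euclideanSpace, Fintype.card_fin]
  ring

theorem abs_cone_sub_cone_le {M r : ℝ} (hM : 0 ≤ M) (hr : 0 < r) (c y z : Space3) :
    |M * max 0 (2 - dist y c / r) - M * max 0 (2 - dist z c / r)| ≤ M / r * dist y z := by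
  rw [← mul_sub, abs_mul, abs_of_nonneg hM, div_mul_eq_mul_div, mul_div_assoc]
  gcongr
  rw [max_comm 0, max_comm 0]
  refine (abs_max_sub_max_le_abs _ _ _).trans ?_
  have : 2 - dist y c / r - (2 - dist z c / r) = (dist z c - dist y c) / r := by ring
  rw [this, abs_div, abs_of_pos hr]
  gcongr
  rw [dist_comm y z]
  exact abs_dist_sub_le _ _ _

theorem cone_eq_zero {M r : ℝ} (hr : 0 < r) {c y : Space3}
    (hy : y ∉ Metric.closedBall c (2 * r)) : M * max 0 (2 - dist y c / r) = 0 := by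
  have hy' : 2 * r < dist y c := not_le.1 hy
  rw [max_eq_left, mul_zero]
  rw [sub_nonpos, le_div_iff₀ hr]
  exact hy'.le

/-- Pointwise bound for the derivative of a function truncated by a sum of cones. -/
theorem abs_lineDeriv_min_sum_cones_le {ι : Type*} {v : Space3 → ℝ} {L : ℝ≥0}
    (hv : LipschitzWith L v) (hv0 : ∀ x, 0 ≤ v x) {M : ℝ} (hM : 0 ≤ M) (t : Finset ι)
    (c : ι → Space3) {r : ι → ℝ} (hr : ∀ i, 0 < r i) (b x : Space3) :
    |lineDeriv ℝ (fun y => min (v y) (∑ i ∈ t, M * max 0 (2 - dist y (c i) / r i))) x b| ≤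
      ∑ i ∈ t, (Metric.closedBall (c i) (2 * r i)).indicator
        (fun _ => (L + M / r i) * ‖b‖) x := by
  classical
  set g : Space3 → ℝ := fun y => min (v y) (∑ i ∈ t, M * max 0 (2 - dist y (c i) / r i)) with hg
  -- `J` lists the closed double balls containing `x`; near `x` all other cones vanish, so only `J`
  -- enters the bound.
  set J := t.filter fun i => x ∈ Metric.closedBall (c i) (2 * r i) with hJ
  have hout : ∀ᶠ y in 𝓝 x, ∀ i ∈ t, i ∉ J → M * max 0 (2 - dist y (c i) / r i) = 0 := by
    rw [Filter.eventually_all_finset]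
    intro i hi
    by_cases hiJ : i ∈ J
    · exact .of_forall fun y h => absurd hiJ h
    · have hx : x ∉ Metric.closedBall (c i) (2 * r i) := fun h =>
        hiJ (Finset.mem_filter.2 ⟨hi, h⟩)
      filter_upwards [Metric.isClosed_closedBall.isOpen_compl.mem_nhds hx] with y hy _
      exact cone_eq_zero (hr i) hy
  have hsumJ : ∀ᶠ y in 𝓝 x, ∑ i ∈ t, M * max 0 (2 - dist y (c i) / r i) =
      ∑ i ∈ J, M * max 0 (2 - dist y (c i) / r i) := by
    filter_upwards [hout] with y hy
    exact (Finset.sum_subset (Finset.filter_subset _ _) hy).symm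
  have hrhs : ∑ i ∈ t, (Metric.closedBall (c i) (2 * r i)).indicator
        (fun _ => (L + M / r i) * ‖b‖) x = ∑ i ∈ J, (L + M / r i) * ‖b‖ := by
    rw [hJ, Finset.sum_filter]
    exact Finset.sum_congr rfl fun i _ => by simp [indicator]
  rw [hrhs, ← Finset.sum_mul, ← Real.norm_eq_abs]
  have hc0 : ∀ i ∈ J, 0 ≤ (L : ℝ) + M / r i := fun i _ => by
    have := hr i
    positivity
  refine norm_lineDeriv_le_of_lip' ℝ (Finset.sum_nonneg hc0) ?_
  filter_upwards [hsumJ] with y hy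
  have hx := hsumJ.self_of_nhds
  -- Without active cones the minimum is zero near `x`. Otherwise the constant `L` of `v` is charged
  -- to one active index `j`.
  rcases J.eq_empty_or_nonempty with hJe | ⟨j, hj⟩
  · have e1 : g y = 0 := by
      simp only [hg]
      rw [hy, hJe, Finset.sum_empty]
      exact min_eq_right (hv0 y)
    have e2 : g x = 0 := by
      simp only [hg]
      rw [hx, hJe, Finset.sum_empty]
      exact min_eq_right (hv0 x)
    rw [e1, e2, hJe]
    simp
  · rw [Real.norm_eq_abs]
    simp only [hg]
    rw [hy, hx]
    refine (abs_min_sub_min_le_max _ _ _ _).trans (max_le ?_ ?_)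
    · have h1 := hv.dist_le_mul y x
      rw [Real.dist_eq, dist_eq_norm] at h1
      refine h1.trans ?_
      gcongr
      refine le_trans ?_ (Finset.single_le_sum hc0 hj)
      have := hr j
      have : 0 ≤ M / r j := by positivity
      linarith
    · rw [← Finset.sum_sub_distrib, Finset.sum_mul]
      refine (Finset.abs_sum_le_sum_abs _ _).trans (Finset.sum_le_sum fun i _ => ?_)
      refine (abs_cone_sub_cone_le hM (hr i) (c i) y x).trans ?_
      rw [dist_eq_norm]
      gcongr
      have := L.2
      simp

/-- The divergence theorem for a truncated function: singular sets of zero area do not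
contribute. -/
theorem gaussGreen_truncated (hE : MeasurableSet E) (hS : MeasurableSet S) {w : Space3 → ℝ}
    {L : ℝ≥0} (hw : LipschitzWith L w) (hwc : HasCompactSupport w) (hw0 : ∀ x, 0 ≤ w x)
    (hfr : ∀ x ∈ frontier E, 0 < w x → x ∈ S) (hi : IntegrableOn w S μHE[2])
    (hreg : ∀ᵐ x ∂(μHE[2] : Measure Space3).restrict S,
      0 < w x → ∃ n, IsInterfaceNormal E W x n) (b : Space3) {δ : ℝ} (hδ : 0 < δ) :
    ∫ x in E, lineDeriv ℝ (fun y => max (w y - δ) 0) x b =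
      ∫ x in S, max (w x - δ) 0 * inner ℝ b (interfaceNormal E W x) ∂μHE[2] := by
  set v : Space3 → ℝ := fun y => max (w y - δ) 0 with hv
  have hvL : LipschitzWith L v := by
    have := (hw.sub (LipschitzWith.const δ)).max_const 0
    simpa using this
  have hv0 : ∀ x, 0 ≤ v x := fun x => le_max_right _ _
  have hvw : ∀ x, v x ≤ w x := fun x => max_le (by linarith) (hw0 x)
  have hvpos : ∀ x, v x ≠ 0 → δ < w x := by
    intro x hx
    by_contra h
    exact hx (max_eq_right (by linarith))
  have hvc : HasCompactSupport v := hwc.mono' fun x hx => subset_tsupport _ (by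
    have := hvpos x hx
    rw [Function.mem_support]; linarith)
  obtain ⟨M, hM⟩ := hvL.continuous.bounded_above_of_compact_support hvc
  have hM0 : 0 ≤ M := (norm_nonneg _).trans (hM 0)
  have hvM : ∀ x, v x ≤ M := fun x => (le_abs_self _).trans (hM x)
  -- The singular points carrying field values at least δ: a closed set intersected with a compact
  -- one.
  set N : Set Space3 := {x | δ ≤ w x} ∩ (frontier E ∩ {x | ¬ ∃ n, IsInterfaceNormal E W x n}) with
      hN
  have hNclosed : IsClosed (frontier E ∩ {x | ¬ ∃ n, IsInterfaceNormal E W x n}) := by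
    rw [← isOpen_compl_iff, isOpen_iff_mem_nhds]
    intro x hx
    by_cases hxf : x ∈ frontier E
    · have : ∃ n, IsInterfaceNormal E W x n := by
        by_contra h
        exact hx ⟨hxf, h⟩
      obtain ⟨n, hn⟩ := this
      filter_upwards [hn.eventually_frontier] with y hy h using h.2 (hy h.1)
    · filter_upwards [isClosed_frontier.isOpen_compl.mem_nhds hxf] with y hy h using hy h.1
  have hsub : {x | δ ≤ w x} ⊆ tsupport w := fun x hx => subset_tsupport _ (by
    have : δ ≤ w x := hx
    rw [Function.mem_support]; linarith)
  have hclδ : IsClosed {x | δ ≤ w x} := isClosed_le continuous_const hw.continuous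
  have hNc : IsCompact N := (hwc.isCompact.of_isClosed_subset hclδ hsub).inter_right hNclosed
  have hNE : (μHE[2] : Measure Space3) N = 0 := by
    rw [ae_restrict_iff' hS] at hreg
    refine measure_mono_null (fun x hx => ?_) hreg
    have hxw : 0 < w x := hδ.trans_le hx.1
    exact fun h => hx.2.2 (h (hfr x hx.2.1 hxw) hxw)
  have hNH : (μH[2] : Measure Space3) N = 0 := by
    rw [Measure.euclideanHausdorffMeasure_def, Measure.smul_apply, smul_eq_zero] at hNE
    have := hNE.resolve_left
      (Measure.addHaarScalarFactor_volume_hausdorffMeasure_ne_zero 2)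
    simpa using this
  -- Surface measure need not be finite on `S`, but the load measure is. Its outer regularity yields
  -- a neighbourhood of `N` with small load.
  set ν : Measure Space3 := ((μHE[2] : Measure Space3).restrict S).withDensity
    (fun x => ENNReal.ofReal (w x)) with hν
  have : IsFiniteMeasure ν := by
    refine isFiniteMeasure_withDensity_ofReal ?_
    exact hi.2
  have hνN : ν N = 0 := withDensity_absolutelyContinuous _ _
    (nonpos_iff_eq_zero.1 ((Measure.restrict_apply_le _ _).trans hNE.le))
  have hregv : ∀ᵐ x ∂(μHE[2] : Measure Space3).restrict S,
      0 < v x → ∃ n, IsInterfaceNormal E W x n := by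
    filter_upwards [hreg] with x hx h using hx (h.trans_le (hvw x))
  have hiv : IntegrableOn v S μHE[2] :=
    Integrable.mono hi hvL.continuous.measurable.aestronglyMeasurable
    (.of_forall fun x => by
      rw [Real.norm_eq_abs, Real.norm_eq_abs, abs_of_nonneg (hv0 x), abs_of_nonneg (hw0 x)]
      exact hvw x)
  set V := (volume (Metric.ball (0 : Space3) 1)).toReal with hV
  have key : ∀ η : ℝ, 0 < η → |(∫ x in E, lineDeriv ℝ v x b) -
      ∫ x in S, v x * inner ℝ b (interfaceNormal E W x) ∂μHE[2]| ≤
        (8 * V * (L + M) * ‖b‖ + ‖b‖) * η := by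
    intro η hη
    obtain ⟨O, hNO, hO, hνO⟩ := N.exists_isOpen_lt_of_lt (μ := ν) (ENNReal.ofReal η)
      (by rw [hνN]; exact ENNReal.ofReal_pos.2 hη)
    obtain ⟨κ, hκ, hκO⟩ := hNc.exists_cthickening_subset_open hO hNO
    -- Radii at most κ/2 keep the double balls inside `O`; radii at most 1 give L r³ ≤ L r² in the
    -- volume estimate.
    obtain ⟨ι, c, r, hcN, hr, hcov, hsum⟩ := exists_ball_cover_of_hausdorffMeasure_two_eq_zero
      hNH (ρ := min 1 (κ / 2)) (by positivity) hη
    obtain ⟨t, ht⟩ := hNc.elim_finite_subcover _ (fun i => Metric.isOpen_ball) hcov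
    -- Each cone is at least `M` on its ball and vanishes outside the double ball. Hence `v - min v
    -- q` vanishes on the balls covering `N`, and its support contains only good points.
    set q : Space3 → ℝ := fun y => ∑ i ∈ t, M * max 0 (2 - dist y (c i) / r i) with hq
    have hq0 : ∀ y, 0 ≤ q y := fun y => Finset.sum_nonneg fun i _ =>
      mul_nonneg hM0 (le_max_left _ _)
    set g : Space3 → ℝ := fun y => min (v y) (q y) with hg
    have hg0 : ∀ y, 0 ≤ g y := fun y => le_min (hv0 y) (hq0 y)
    have hgv : ∀ y, g y ≤ v y := fun y => min_le_left _ _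
    have hgc : HasCompactSupport g := hvc.mono fun x hx => by
      rw [Function.mem_support] at hx ⊢
      intro h
      exact hx (by simp only [hg]; rw [h]; exact min_eq_left (hq0 x))
    have hqlip : LocallyLipschitz q := by
      refine LipschitzWith.locallyLipschitz (K := (∑ i ∈ t, M / r i).toNNReal)
        (LipschitzWith.of_dist_le_mul fun y z => ?_)
      have hs0 : 0 ≤ ∑ i ∈ t, M / r i := Finset.sum_nonneg fun i _ =>
        div_nonneg hM0 (hr i).1.le
      rw [Real.coe_toNNReal _ hs0, Real.dist_eq, hq, ← Finset.sum_sub_distrib, Finset.sum_mul]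
      exact (Finset.abs_sum_le_sum_abs _ _).trans (Finset.sum_le_sum fun i _ =>
        abs_cone_sub_cone_le hM0 (hr i).1 (c i) y z)
    have hglip : LocallyLipschitz g := hvL.locallyLipschitz.min hqlip
    obtain ⟨Kg, hKg⟩ := hglip.exists_lipschitzWith_of_hasCompactSupport hgc
    set u : Space3 → ℝ := fun y => v y - g y with hu
    have hu0 : ∀ y, 0 ≤ u y := fun y => sub_nonneg.2 (hgv y)
    have huK : LipschitzWith (L + Kg) u := hvL.sub hKg
    have huv : ∀ y, u y ≤ v y := fun y => sub_le_self _ (hg0 y)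
    have huc : HasCompactSupport u := hvc.mono fun x hx => by
      rw [Function.mem_support] at hx ⊢
      intro h
      exact hx (le_antisymm ((huv x).trans h.le) (hu0 x))
    have hqM : ∀ y, ∀ i ∈ t, y ∈ Metric.ball (c i) (r i) → M ≤ q y := by
      intro y i hi hy
      refine le_trans ?_ (Finset.single_le_sum (f := fun i => M * max 0 (2 - dist y (c i) / r i))
        (fun j _ => mul_nonneg hM0 (le_max_left _ _)) hi)
      refine le_mul_of_one_le_right hM0 (le_trans ?_ (le_max_right _ _))
      have : dist y (c i) / r i ≤ 1 := (div_le_one (hr i).1).2 (Metric.mem_ball.1 hy).le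
      linarith
    have hts : tsupport u ⊆ {x | δ ≤ w x} ∩ (⋃ i ∈ t, Metric.ball (c i) (r i))ᶜ := by
      refine closure_minimal (fun x hx => ?_)
        (hclδ.inter (isOpen_biUnion fun i _ => Metric.isOpen_ball).isClosed_compl)
      refine ⟨(hvpos x fun h => hx (le_antisymm ((huv x).trans h.le) (hu0 x))).le, fun hxb => ?_⟩
      obtain ⟨i, hi, hxi⟩ := mem_iUnion₂.1 hxb
      apply hx
      simp only [hu, hg]
      rw [min_eq_left ((hvM x).trans (hqM x i hi hxi)), sub_self]
    have hGu := gaussGreen_of_approxGaussGreenAt (b := b) hi hreg huK huc hu0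
      (fun x => (huv x).trans (hvw x)) (fun x hx => by
        by_cases hxf : x ∈ frontier E
        · have hreg' : ∃ n, IsInterfaceNormal E W x n := by
            by_contra h
            exact (hts hx).2 (ht ⟨(hts hx).1, hxf, h⟩)
          obtain ⟨n, hn⟩ := hreg'
          exact approxGaussGreenAt_of_isInterfaceNormal hE hS hfr hreg b hn
        · exact approxGaussGreenAt_of_notMem_frontier hreg b hxf)
    have hgi : IntegrableOn g S μHE[2] :=
      Integrable.mono hiv hKg.continuous.measurable.aestronglyMeasurable
      (.of_forall fun x => by
        rw [Real.norm_eq_abs, Real.norm_eq_abs, abs_of_nonneg (hv0 x), abs_of_nonneg (hg0 x)]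
        exact hgv x)
    have hregg : ∀ᵐ x ∂(μHE[2] : Measure Space3).restrict S,
        0 < g x → ∃ n, IsInterfaceNormal E W x n := by
      filter_upwards [hregv] with x hx h using hx (h.trans_le (hgv x))
    have e1 : ∫ x in E, lineDeriv ℝ u x b =
        (∫ x in E, lineDeriv ℝ v x b) - ∫ x in E, lineDeriv ℝ g x b := by
      rw [← integral_sub (integrable_lineDeriv_of_lipschitz hvL hvc b).integrableOn
        (integrable_lineDeriv_of_lipschitz hKg hgc b).integrableOn]
      refine integral_congr_ae (ae_restrict_of_ae ?_)
      filter_upwards [hvL.ae_differentiableAt (μ := volume),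
        hKg.ae_differentiableAt (μ := volume)] with x hx1 hx2
      have hx := hx1.hasFDerivAt.fun_sub hx2.hasFDerivAt
      rw [hx1.lineDeriv_eq_fderiv, hx2.lineDeriv_eq_fderiv,
        hx.differentiableAt.lineDeriv_eq_fderiv, hx.fderiv, sub_apply]
    have e2 : ∫ x in S, u x * inner ℝ b (interfaceNormal E W x) ∂μHE[2] =
        (∫ x in S, v x * inner ℝ b (interfaceNormal E W x) ∂μHE[2]) -
          ∫ x in S, g x * inner ℝ b (interfaceNormal E W x) ∂μHE[2] := by
      rw [← integral_sub
        (integrableOn_mul_inner_interfaceNormal hvL.continuous.measurable hv0 hiv hregv b)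
        (integrableOn_mul_inner_interfaceNormal hKg.continuous.measurable hg0 hgi hregg b)]
      congr 1 with x
      simp only [hu]
      ring
    rw [e1, e2] at hGu
    -- The gradient bound (L + M/r) times the volume 8 V r³ of the double ball is of order r², and
    -- the sum of the r² is at most η.
    have hvol : |∫ x in E, lineDeriv ℝ g x b| ≤ 8 * V * (L + M) * ‖b‖ * η := by
      set B : Space3 → ℝ := fun x => ∑ i ∈ t, (Metric.closedBall (c i) (2 * r i)).indicator
        (fun _ => (L + M / r i) * ‖b‖) x with hB
      have hBi : ∀ i, Integrable ((Metric.closedBall (c i) (2 * r i)).indicator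
          (fun _ => (L + M / r i) * ‖b‖)) := fun i =>
        (integrable_indicator_iff Metric.isClosed_closedBall.measurableSet).2
          (integrableOn_const measure_closedBall_lt_top.ne)
      have hBint : Integrable B := integrable_finsetSum _ fun i _ => hBi i
      have hB0 : ∀ x, 0 ≤ B x := fun x => (abs_nonneg _).trans
        (abs_lineDeriv_min_sum_cones_le hvL hv0 hM0 t c (fun i => (hr i).1) b x)
      have h1 : |∫ x in E, lineDeriv ℝ g x b| ≤ ∫ x in E, B x := by
        rw [← Real.norm_eq_abs]
        exact norm_integral_le_of_norm_le hBint.integrableOn (.of_forall fun x =>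
          abs_lineDeriv_min_sum_cones_le hvL hv0 hM0 t c (fun i => (hr i).1) b x)
      have h2 : ∫ x in E, B x ≤ ∫ x, B x :=
        setIntegral_le_integral hBint (.of_forall hB0)
      have h3 : ∫ x, B x = ∑ i ∈ t, (L + M / r i) * ‖b‖ * (8 * V * r i ^ 3) := by
        rw [hB, integral_finsetSum _ fun i _ => hBi i]
        refine Finset.sum_congr rfl fun i _ => ?_
        rw [integral_indicator Metric.isClosed_closedBall.measurableSet, setIntegral_const,
          Measure.real, volume_closedBall_two_mul _ (hr i).1.le, smul_eq_mul, mul_comm]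
      have hV0 : 0 ≤ V := ENNReal.toReal_nonneg
      have h4 : ∀ i, (L + M / r i) * ‖b‖ * (8 * V * r i ^ 3) ≤
          8 * V * (L + M) * ‖b‖ * r i ^ 2 := by
        intro i
        have hri := (hr i).1
        have hri1 : r i ≤ 1 := (hr i).2.trans (min_le_left _ _)
        have e : (L + M / r i) * ‖b‖ * (8 * V * r i ^ 3) =
          8 * V * (L * r i + M) * ‖b‖ * r i ^ 2 := by field_simp
        rw [e]
        gcongr
        exact mul_le_of_le_one_right L.2 hri1
      rw [h3] at h2
      refine (h1.trans h2).trans ((Finset.sum_le_sum fun i _ => h4 i).trans ?_)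
      rw [← Finset.mul_sum]
      gcongr
      exact hsum t
    have hsurf : |∫ x in S, g x * inner ℝ b (interfaceNormal E W x) ∂μHE[2]| ≤ ‖b‖ * η := by
      have hgO : ∀ x ∉ O, g x = 0 := by
        intro x hx
        have : q x = 0 := Finset.sum_eq_zero fun i _ => cone_eq_zero (hr i).1 fun hxb => hx (hκO
          (Metric.mem_cthickening_of_dist_le x (c i) κ N (hcN i)
              ((Metric.mem_closedBall.1 hxb).trans
            (by have := (hr i).2.trans (min_le_right _ _); linarith))))
        simp only [hg]
        rw [this]
        exact min_eq_right (hv0 x)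
      have h1 : ∫ x in S, g x ∂μHE[2] ≤ η := by
        rw [← ENNReal.ofReal_le_ofReal_iff hη.le,
          ofReal_integral_eq_lintegral_ofReal hgi (.of_forall hg0)]
        refine le_trans ?_ hνO.le
        rw [hν, withDensity_apply _ hO.measurableSet, ← lintegral_indicator hO.measurableSet]
        refine lintegral_mono fun x => ?_
        by_cases hx : x ∈ O
        · rw [indicator_of_mem hx]
          exact ENNReal.ofReal_le_ofReal ((hgv x).trans (hvw x))
        · rw [hgO x hx]; simp
      rw [← Real.norm_eq_abs]
      refine (norm_integral_le_of_norm_le (hgi.const_mul ‖b‖) (.of_forall fun x =>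
        abs_mul_inner_interfaceNormal_le (hg0 x) b x)).trans ?_
      rw [integral_const_mul]
      gcongr
    have : (∫ x in E, lineDeriv ℝ v x b) -
        ∫ x in S, v x * inner ℝ b (interfaceNormal E W x) ∂μHE[2] =
        (∫ x in E, lineDeriv ℝ g x b) -
          ∫ x in S, g x * inner ℝ b (interfaceNormal E W x) ∂μHE[2] := by linarith
    rw [this]
    refine (abs_sub _ _).trans ?_
    linarith
  set C := 8 * V * (L + M) * ‖b‖ + ‖b‖ with hC
  have hC0 : 0 ≤ C := by
    have : 0 ≤ V := ENNReal.toReal_nonneg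
    positivity
  have hzero : |(∫ x in E, lineDeriv ℝ v x b) -
      ∫ x in S, v x * inner ℝ b (interfaceNormal E W x) ∂μHE[2]| ≤ 0 := by
    refine le_of_forall_pos_le_add fun η hη => ?_
    rw [zero_add]
    refine (key (η / (C + 1)) (by positivity)).trans ?_
    rw [← mul_div_assoc, div_le_iff₀ (by positivity)]
    nlinarith
  exact sub_eq_zero.1 (abs_eq_zero.1 (le_antisymm hzero (abs_nonneg _)))

end GaussGreen

/-! ### Passage to the limit in the truncation level. -/

section GaussGreenLimit

variable {E W S : Set Space3}

/-- The point is a minimum along the line. Differentiability is not required, as the value of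
`deriv` is zero where no derivative exists. -/
theorem lineDeriv_eq_zero_of_eq_zero {w : Space3 → ℝ} (hw0 : ∀ x, 0 ≤ w x) {x : Space3}
    (hx : w x = 0) (b : Space3) : lineDeriv ℝ w x b = 0 := by
  have : IsLocalMin (fun t : ℝ => w (x + t • b)) 0 :=
    .of_forall fun t => by simpa [hx] using hw0 (x + t • b)
  exact this.deriv_eq_zero

/-- The divergence theorem for a nonnegative compactly supported Lipschitz function `w`, on a set
with a `C¹` boundary up to a set of zero area where `w` is positive. -/
theorem gaussGreen_of_nonneg (hE : MeasurableSet E) (hS : MeasurableSet S) {w : Space3 → ℝ}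
    {L : ℝ≥0} (hw : LipschitzWith L w) (hwc : HasCompactSupport w) (hw0 : ∀ x, 0 ≤ w x)
    (hfr : ∀ x ∈ frontier E, 0 < w x → x ∈ S) (hi : IntegrableOn w S μHE[2])
    (hreg : ∀ᵐ x ∂(μHE[2] : Measure Space3).restrict S,
      0 < w x → ∃ n, IsInterfaceNormal E W x n) (b : Space3) :
    ∫ x in E, lineDeriv ℝ w x b =
      ∫ x in S, w x * inner ℝ b (interfaceNormal E W x) ∂μHE[2] := by
  set d : ℕ → ℝ := fun k => 1 / ((k : ℝ) + 1) with hd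
  have hd0 : ∀ k, 0 < d k := fun k => Nat.one_div_pos_of_nat
  have hdlim : Tendsto d atTop (𝓝 0) := tendsto_one_div_add_atTop_nhds_zero_nat
  have hvL : ∀ k, LipschitzWith L (fun y => max (w y - d k) 0) := fun k => by
    simpa using (hw.sub (LipschitzWith.const (d k))).max_const 0
  have hvs : ∀ k, tsupport (fun y => max (w y - d k) 0) ⊆ tsupport w := fun k =>
    closure_mono fun x hx => by
      rw [Function.mem_support] at hx ⊢
      intro h
      exact hx (max_eq_right (by have := hd0 k; linarith))
  have h1 : Tendsto (fun k => ∫ x in E, lineDeriv ℝ (fun y => max (w y - d k) 0) x b) atTop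
      (𝓝 (∫ x in E, lineDeriv ℝ w x b)) := by
    refine tendsto_integral_of_dominated_convergence
      ((tsupport w).indicator fun _ => (L : ℝ) * ‖b‖) (fun k => ?_) ?_ (fun k => ?_) ?_
    · exact aestronglyMeasurable_lineDeriv (hvL k).continuous _
    · exact ((integrable_indicator_iff (isClosed_tsupport w).measurableSet).2
        (integrableOn_const hwc.isCompact.measure_lt_top.ne)).integrableOn
    · refine .of_forall fun x => ?_
      by_cases hx : x ∈ tsupport w
      · rw [indicator_of_mem hx]
        exact norm_lineDeriv_le_of_lipschitz ℝ (hvL k)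
      · rw [indicator_of_notMem hx,
          lineDeriv_eq_zero_of_notMem_tsupport fun h => hx (hvs k h), norm_zero]
    -- The derivatives agree eventually: if `w x = 0`, both functions have a minimum at `x`; if `w x
    -- > 0`, they differ near `x` by a constant once `d k < w x`.
    · refine .of_forall fun x => tendsto_const_nhds.congr' ?_
      rcases (hw0 x).eq_or_lt with h | h
      · filter_upwards with k
        rw [lineDeriv_eq_zero_of_eq_zero hw0 h.symm, lineDeriv_eq_zero_of_eq_zero
          (fun y => le_max_right _ _) (max_eq_right (by have := hd0 k; linarith))]
      · filter_upwards [hdlim.eventually_lt_const h] with k hk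
        have : (fun y => max (w y - d k) 0) =ᶠ[𝓝 x] fun y => w y - d k := by
          filter_upwards [(hw.continuous.tendsto x).eventually_const_lt hk] with y hy
          exact max_eq_left (by linarith)
        rw [this.lineDeriv_eq, lineDeriv, lineDeriv, deriv_sub_const]
  have h2 : Tendsto (fun k => ∫ x in S, max (w x - d k) 0 * inner ℝ b (interfaceNormal E W x)
      ∂μHE[2]) atTop (𝓝 (∫ x in S, w x * inner ℝ b (interfaceNormal E W x) ∂μHE[2])) := by
    have hle : ∀ k x, max (w x - d k) 0 ≤ w x := fun k x =>
      max_le (by have := hd0 k; linarith) (hw0 x)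
    refine tendsto_integral_of_dominated_convergence (fun x => ‖b‖ * w x) (fun k => ?_)
      (hi.const_mul _) (fun k => .of_forall fun x => ?_) (.of_forall fun x => ?_)
    · refine (integrableOn_mul_inner_interfaceNormal (hvL k).continuous.measurable
        (fun x => le_max_right _ _) ?_ ?_ b).aestronglyMeasurable
      · exact Integrable.mono hi (hvL k).continuous.measurable.aestronglyMeasurable
          (.of_forall fun x => by
            rw [Real.norm_eq_abs, Real.norm_eq_abs, abs_of_nonneg (le_max_right _ _),
              abs_of_nonneg (hw0 x)]
            exact hle k x)
      · filter_upwards [hreg] with x hx h using hx (h.trans_le (hle k x))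
    · rw [Real.norm_eq_abs]
      refine (abs_mul_inner_interfaceNormal_le (le_max_right _ _) b x).trans ?_
      gcongr
      exact hle k x
    · refine Tendsto.mul_const _ ?_
      have : Tendsto (fun k => max (w x - d k) 0) atTop (𝓝 (max (w x - 0) 0)) :=
        (tendsto_const_nhds.sub hdlim).max tendsto_const_nhds
      rwa [sub_zero, max_eq_left (hw0 x)] at this
  refine tendsto_nhds_unique h1 (h2.congr fun k => ?_)
  exact (gaussGreen_truncated hE hS hw hwc hw0 hfr hi hreg b (hd0 k)).symm

end GaussGreenLimit

/-! ### Divergence theorem for signed functions and for tractions. -/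

section GaussGreenVector

variable {E W S : Set Space3}

/-- The divergence theorem for a compactly supported Lipschitz function `w`, on a set
with a `C¹` boundary up to a set of zero area where `w` does not vanish. -/
theorem gaussGreen (hE : MeasurableSet E) (hS : MeasurableSet S) {w : Space3 → ℝ}
    {L : ℝ≥0} (hw : LipschitzWith L w) (hwc : HasCompactSupport w)
    (hfr : ∀ x ∈ frontier E, w x ≠ 0 → x ∈ S) (hi : IntegrableOn w S μHE[2])
    (hreg : ∀ᵐ x ∂(μHE[2] : Measure Space3).restrict S,
      w x ≠ 0 → ∃ n, IsInterfaceNormal E W x n) (b : Space3) :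
    IntegrableOn (fun x => w x * inner ℝ b (interfaceNormal E W x)) S μHE[2] ∧
    ∫ x in E, lineDeriv ℝ w x b =
      ∫ x in S, w x * inner ℝ b (interfaceNormal E W x) ∂μHE[2] := by
  -- Used for `f = w` and `f = -w`, that is, for the positive and the negative part of `w`.
  have main : ∀ f : Space3 → ℝ, LipschitzWith L f → (∀ x, w x = 0 → f x = 0) →
      (∀ x, |f x| ≤ |w x|) →
      HasCompactSupport (fun x => max (f x) 0) ∧ LipschitzWith L (fun x => max (f x) 0) ∧
      IntegrableOn (fun x => max (f x) 0 * inner ℝ b (interfaceNormal E W x)) S μHE[2] ∧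
      ∫ x in E, lineDeriv ℝ (fun x => max (f x) 0) x b =
        ∫ x in S, max (f x) 0 * inner ℝ b (interfaceNormal E W x) ∂μHE[2] := by
    intro f hf hf0 hfw
    have hL : LipschitzWith L (fun x => max (f x) 0) := hf.max_const 0
    have hne : ∀ x, 0 < max (f x) 0 → w x ≠ 0 := by
      intro x hx h
      rw [hf0 x h, max_self] at hx
      exact lt_irrefl _ hx
    have hc : HasCompactSupport (fun x => max (f x) 0) := hwc.mono fun x hx =>
      hne x (lt_of_le_of_ne (le_max_right _ _) (Ne.symm hx))
    have hi' : IntegrableOn (fun x => max (f x) 0) S μHE[2] :=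
      Integrable.mono hi hL.continuous.measurable.aestronglyMeasurable (.of_forall fun x => by
        rw [Real.norm_eq_abs, Real.norm_eq_abs, abs_of_nonneg (le_max_right _ _)]
        exact max_le ((le_abs_self _).trans (hfw x)) (abs_nonneg _))
    have hreg' : ∀ᵐ x ∂(μHE[2] : Measure Space3).restrict S,
        0 < max (f x) 0 → ∃ n, IsInterfaceNormal E W x n := by
      filter_upwards [hreg] with x hx h using hx (hne x h)
    exact ⟨hc, hL, integrableOn_mul_inner_interfaceNormal hL.continuous.measurable
      (fun x => le_max_right _ _) hi' hreg' b,
      gaussGreen_of_nonneg hE hS hL hc (fun x => le_max_right _ _)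
        (fun x hx h => hfr x hx (hne x h)) hi' hreg' b⟩
  obtain ⟨c1, l1, i1, e1⟩ := main w hw (fun _ h => h) fun x => le_rfl
  obtain ⟨c2, l2, i2, e2⟩ := main (fun x => -w x) hw.neg
    (fun x h => by simp [h]) fun x => by simp
  have hsplit : ∀ x, w x = max (w x) 0 - max (-w x) 0 := fun x => by
    rcases le_total (w x) 0 with h | h
    · rw [max_eq_right h, max_eq_left (by linarith)]; ring
    · rw [max_eq_left h, max_eq_right (by linarith)]; ring
  have e0 : ∀ x, w x * inner ℝ b (interfaceNormal E W x) =
      max (w x) 0 * inner ℝ b (interfaceNormal E W x) -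
        max (-w x) 0 * inner ℝ b (interfaceNormal E W x) := fun x => by
    rw [← sub_mul, ← hsplit]
  simp_rw [e0]
  refine ⟨i1.sub i2, ?_⟩
  rw [integral_sub i1 i2, ← e1, ← e2,
    ← integral_sub (integrable_lineDeriv_of_lipschitz l1 c1 b).integrableOn
      (integrable_lineDeriv_of_lipschitz l2 c2 b).integrableOn]
  refine integral_congr_ae (ae_restrict_of_ae ?_)
  filter_upwards [l1.ae_differentiableAt (μ := volume),
    l2.ae_differentiableAt (μ := volume)] with x hx1 hx2
  have hx := hx1.hasFDerivAt.fun_sub hx2.hasFDerivAt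
  rw [← funext hsplit] at hx
  rw [hx1.lineDeriv_eq_fderiv, hx2.lineDeriv_eq_fderiv,
    hx.differentiableAt.lineDeriv_eq_fderiv, hx.fderiv, sub_apply]

/-- The divergence of a vector field. -/
noncomputable def divergence (v : Space3 → Space3) (x : Space3) : ℝ :=
  ∑ i, fderiv ℝ v x (EuclideanSpace.single i 1) i

theorem space3_eq_sum (y : Space3) : y = ∑ i, y i • EuclideanSpace.single i (1 : ℝ) := by
  have := (EuclideanSpace.basisFun (Fin 3) ℝ).sum_repr y
  simpa using this.symm

/-- The divergence theorem for the traction load of a pressure field `p`, along a `C¹` velocity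
field `v`. -/
theorem gaussGreen_traction (hE : MeasurableSet E) (hS : MeasurableSet S) {p : Space3 → ℝ}
    {L : ℝ≥0} (hp : LipschitzWith L p) (hpc : HasCompactSupport p) (hp0 : ∀ x, 0 ≤ p x)
    {v : Space3 → Space3} (hv : ContDiff ℝ 1 v)
    (hfr : ∀ x ∈ frontier E, 0 < p x → x ∈ S) (hi : IntegrableOn p S μHE[2])
    (hreg : ∀ᵐ x ∂(μHE[2] : Measure Space3).restrict S,
      0 < p x → ∃ n, IsInterfaceNormal E W x n) :
    IntegrableOn (powerDensity p E W v) S μHE[2] ∧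
    ∫ x in E, (fderiv ℝ p x (v x) + p x * divergence v x) = tractionPower p S E W v := by
  set e : Fin 3 → Space3 := fun i => EuclideanSpace.single i 1 with he
  set w : Fin 3 → Space3 → ℝ := fun i x => p x * v x i with hw
  have hvi : ∀ i, ContDiff ℝ 1 (fun x => v x i) := fun i => (contDiff_euclidean.1 hv) i
  have hwc : ∀ i, HasCompactSupport (w i) := fun i => hpc.mul_right
  -- The velocity need not be bounded or globally Lipschitz, but the compact support of `p` makes
  -- each component `p * v i` globally Lipschitz.
  have hwL : ∀ i, ∃ K, LipschitzWith K (w i) := fun i =>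
    (hp.locallyLipschitz.mul_real
      (hvi i).locallyLipschitz).exists_lipschitzWith_of_hasCompactSupport (hwc i)
  have hwp : ∀ i x, w i x ≠ 0 → 0 < p x := fun i x hx =>
    lt_of_le_of_ne (hp0 x) fun h => hx (by simp [hw, ← h])
  have hwi : ∀ i, IntegrableOn (w i) S μHE[2] := by
    intro i
    obtain ⟨C, hC⟩ := hpc.isCompact.exists_bound_of_continuousOn
      ((hvi i).continuous.continuousOn (s := tsupport p))
    refine (hi.const_mul C).mono' (hwL i).choose_spec.continuous.measurable.aestronglyMeasurable
      (.of_forall fun x => ?_)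
    rw [hw, Real.norm_eq_abs, abs_mul, abs_of_nonneg (hp0 x), mul_comm]
    by_cases hx : x ∈ tsupport p
    · exact mul_le_mul_of_nonneg_right (hC x hx) (hp0 x)
    · simp [image_eq_zero_of_notMem_tsupport hx]
  have hG := fun i => gaussGreen hE hS (hwL i).choose_spec (hwc i)
    (fun x hx h => hfr x hx (hwp i x h)) (hwi i)
    (by filter_upwards [hreg] with x hx h using hx (hwp i x h)) (e i)
  have hpd : ∀ x, powerDensity p E W v x =
      ∑ i, w i x * inner ℝ (e i) (interfaceNormal E W x) := by
    intro x
    rw [powerDensity, inner_smul_right]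
    conv_lhs => rw [space3_eq_sum (v x), sum_inner]
    rw [Finset.mul_sum]
    refine Finset.sum_congr rfl fun i _ => ?_
    rw [real_inner_smul_left, hw]
    ring
  have hpd' : powerDensity p E W v =
      fun x => ∑ i, w i x * inner ℝ (e i) (interfaceNormal E W x) := funext hpd
  refine ⟨?_, ?_⟩
  · rw [hpd']
    exact integrable_finsetSum _ fun i _ => (hG i).1
  · rw [tractionPower, hpd', integral_finsetSum _ fun i _ => (hG i).1]
    simp_rw [← fun i => (hG i).2]
    rw [← integral_finsetSum _ fun i _ =>
      (integrable_lineDeriv_of_lipschitz (hwL i).choose_spec (hwc i) (e i)).integrableOn]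
    refine integral_congr_ae (ae_restrict_of_ae ?_)
    filter_upwards [hp.ae_differentiableAt (μ := volume)] with x hx
    have hd : ∀ i, lineDeriv ℝ (w i) x (e i) =
        v x i * fderiv ℝ p x (e i) + p x * fderiv ℝ v x (e i) i := by
      intro i
      have hvx : DifferentiableAt ℝ v x := (hv.differentiable one_ne_zero) x
      have h1 : HasFDerivAt (fun y => v y i) ((EuclideanSpace.proj i).comp (fderiv ℝ v x)) x :=
        (EuclideanSpace.proj (𝕜 := ℝ) i).hasFDerivAt.comp x hvx.hasFDerivAt
      have h2 := hx.hasFDerivAt.fun_mul h1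
      rw [h2.differentiableAt.lineDeriv_eq_fderiv, h2.fderiv]
      simp
      ring
    simp_rw [hd]
    rw [Finset.sum_add_distrib, ← Finset.mul_sum]
    congr 1
    conv_lhs => rw [space3_eq_sum (v x), map_sum]
    simp [he]

end GaussGreenVector

/-! ### Integrals of locally Lipschitz families of functions. -/

section ParametricIntegral

/-- Two times in a compact interval: a locally Lipschitz family of functions which vanish off a
fixed compact set is uniformly Lipschitz in the parameter. -/
theorem LocallyLipschitz.exists_forall_lipschitzOnWith {X : Type*} [PseudoMetricSpace X]
    {F : ℝ × X → ℝ} (hF : LocallyLipschitz F) {K : Set X} (hK : IsCompact K) {a b : ℝ}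
    (h0 : ∀ s ∈ Icc a b, ∀ x ∉ K, F (s, x) = 0) :
    ∃ C : ℝ≥0, ∀ x, LipschitzOnWith (K.indicator (fun _ => C) x) (fun s => F (s, x)) (Icc a b) := by
  obtain ⟨C, hC⟩ := (hF.locallyLipschitzOn (s := Icc a b ×ˢ K)).exists_lipschitzOnWith_of_compact
    (isCompact_Icc.prod hK)
  refine ⟨C, fun x => ?_⟩
  by_cases hx : x ∈ K
  · rw [indicator_of_mem hx]
    refine LipschitzOnWith.of_dist_le_mul fun s hs s' hs' => ?_
    refine (hC.dist_le_mul (s, x) ⟨hs, hx⟩ (s', x) ⟨hs', hx⟩).trans_eq ?_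
    simp [Prod.dist_eq]
  · rw [indicator_of_notMem hx]
    refine LipschitzOnWith.of_dist_le_mul fun s hs s' hs' => ?_
    simp [h0 s hs x hx, h0 s' hs' x hx]

variable {F : ℝ × Space3 → ℝ} {K : Set Space3} {a b : ℝ}

theorem LocallyLipschitz.integrable_of_vanishing (hF : LocallyLipschitz F) (hK : IsCompact K)
    {s : ℝ} (h0 : ∀ x ∉ K, F (s, x) = 0) : Integrable (fun x => F (s, x)) :=
  (hF.continuous.comp (by fun_prop : Continuous fun x : Space3 =>
      (s, x))).integrable_of_hasCompactSupport
    (HasCompactSupport.intro hK h0)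

theorem LocallyLipschitz.exists_lipschitzOnWith_setIntegral (hF : LocallyLipschitz F)
    (hK : IsCompact K)
    (h0 : ∀ s ∈ Icc a b, ∀ x ∉ K, F (s, x) = 0) (E : Set Space3) :
    ∃ C, LipschitzOnWith C (fun s => ∫ x in E, F (s, x)) (Icc a b) := by
  obtain ⟨C, hC⟩ := hF.exists_forall_lipschitzOnWith hK h0
  have hi : Integrable (K.indicator fun _ => (C : ℝ)) :=
    (integrable_indicator_iff hK.measurableSet).2 (integrableOn_const hK.measure_lt_top.ne)
  have hn : 0 ≤ ∫ x, K.indicator (fun _ => (C : ℝ)) x :=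
    integral_nonneg fun x => indicator_nonneg (fun _ _ => C.2) x
  refine ⟨(∫ x, K.indicator (fun _ => (C : ℝ)) x).toNNReal,
    LipschitzOnWith.of_dist_le_mul fun s hs s' hs' => ?_⟩
  rw [Real.coe_toNNReal _ hn, dist_eq_norm, ← integral_sub
    (hF.integrable_of_vanishing hK (h0 s hs)).integrableOn
    (hF.integrable_of_vanishing hK (h0 s' hs')).integrableOn, ← integral_mul_const]
  refine (norm_integral_le_of_norm_le (hi.mul_const _).integrableOn (.of_forall fun x => ?_)).trans
    (setIntegral_le_integral (hi.mul_const _) (.of_forall fun x =>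
      mul_nonneg (indicator_nonneg (fun _ _ => C.2) x) dist_nonneg))
  have := (hC x).dist_le_mul s hs s' hs'
  rw [dist_eq_norm] at this
  refine this.trans_eq ?_
  by_cases hx : x ∈ K <;> simp [hx]

/-- The difference quotients are dominated by a constant times the indicator of `K`, so a derivative
at almost every `x` suffices for differentiation under the integral. -/
theorem LocallyLipschitz.hasDerivAt_setIntegral (hF : LocallyLipschitz F) (hK : IsCompact K)
    (h0 : ∀ s ∈ Icc a b, ∀ x ∉ K, F (s, x) = 0) (E : Set Space3) {t : ℝ} (ht : t ∈ Ioo a b)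
    {F' : Space3 → ℝ} (hF' : ∀ᵐ x ∂volume.restrict E, HasDerivAt (fun s => F (s, x)) (F' x) t) :
    HasDerivAt (fun s => ∫ x in E, F (s, x)) (∫ x in E, F' x) t := by
  obtain ⟨C, hC⟩ := hF.exists_forall_lipschitzOnWith hK h0
  have hi : Integrable (K.indicator fun _ => (C : ℝ)) :=
    (integrable_indicator_iff hK.measurableSet).2 (integrableOn_const hK.measure_lt_top.ne)
  have hn : Icc a b ∈ 𝓝 t := Icc_mem_nhds ht.1 ht.2
  have hc : ∀ s, Continuous fun x : Space3 => F (s, x) := fun s =>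
    hF.continuous.comp (by fun_prop)
  refine (hasDerivAt_integral_of_dominated_loc_of_lip (bound := K.indicator fun _ => (C : ℝ)) hn
    (.of_forall fun s => (hc s).aestronglyMeasurable)
    (hF.integrable_of_vanishing hK (h0 t (Ioo_subset_Icc_self ht))).integrableOn ?_ ?_
    hi.integrableOn hF').2
  · refine aestronglyMeasurable_of_tendsto_ae (𝓝[≠] (0 : ℝ))
      (f := fun u x => u⁻¹ * (F (t + u, x) - F (t, x)))
      (fun u => (((hc _).sub (hc _)).const_mul _ |>.aestronglyMeasurable)) ?_
    filter_upwards [hF'] with x hx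
    simpa using hasDerivAt_iff_tendsto_slope_zero.1 hx
  · refine .of_forall fun x => ?_
    have h : Real.nnabs (K.indicator (fun _ => (C : ℝ)) x) = K.indicator (fun _ => C) x := by
      by_cases hx : x ∈ K <;> simp [hx]
    rw [h]
    exact hC x

end ParametricIntegral

/-- A Lipschitz function is the integral of any function which is its derivative almost
everywhere. -/
theorem LipschitzOnWith.intervalIntegrable_and_integral_eq_sub {f P : ℝ → ℝ} {C : ℝ≥0} {a b : ℝ}
    (hab : a ≤ b)
    (hf : LipschitzOnWith C f (Icc a b))
    (hP : ∀ᵐ t ∂volume.restrict (Icc a b), HasDerivWithinAt f (P t) (Icc a b) t) :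
    IntervalIntegrable P volume a b ∧ ∫ t in a..b, P t = f b - f a := by
  have hac : AbsolutelyContinuousOnInterval f a b :=
    LipschitzOnWith.absolutelyContinuousOnInterval (K := C) (by rwa [uIcc_of_le hab])
  have he : deriv f =ᵐ[volume.restrict (uIoc a b)] P := by
    rw [uIoc_of_le hab, ← restrict_Ioo_eq_restrict_Ioc]
    have h1 := ae_mono (Measure.restrict_mono_set volume Ioo_subset_Icc_self) hP
    filter_upwards [h1, ae_restrict_mem measurableSet_Ioo] with t h ht
    exact (h.hasDerivAt (Icc_mem_nhds ht.1 ht.2)).deriv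
  refine ⟨hac.intervalIntegrable_deriv.congr_ae he, ?_⟩
  rw [← hac.integral_deriv_eq_sub]
  exact (intervalIntegral.integral_congr_ae_restrict he).symm

/-! ### Reynolds' transport theorem. -/

section Transport

/-- The time derivative of the spatial derivative is the spatial derivative of the velocity. -/
theorem ContDiff.hasDerivAt_fderiv_slice {H : ℝ × Space3 → Space3} (hH : ContDiff ℝ 2 H) (t : ℝ)
    (x w : Space3) :
    HasDerivAt (fun s => fderiv ℝ (fun y => H (s, y)) x w)
      (fderiv ℝ (fun y => deriv (fun s => H (s, y)) t) x w) t := by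
  have hd : Differentiable ℝ H := hH.differentiable (by norm_num)
  have hd' : Differentiable ℝ (fderiv ℝ H) :=
    (hH.fderiv_right (m := 1) (by norm_num)).differentiable (by norm_num)
  have e1 : ∀ s y, fderiv ℝ (fun y => H (s, y)) y w = fderiv ℝ H (s, y) (0, w) := fun s y => by
    have h2 := ((hd (s, y)).hasFDerivAt.comp y (hasFDerivAt_prodMk_right s y)).fderiv
    change fderiv ℝ (fun y => H (s, y)) y = _ at h2
    simp [h2]
  have e2 : ∀ y, deriv (fun s => H (s, y)) t = fderiv ℝ H (t, y) (1, 0) := fun y => by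
    have h2 := ((hd (t, y)).hasFDerivAt.comp t (hasFDerivAt_prodMk_left t y)).hasDerivAt.deriv
    change deriv (fun s => H (s, y)) t = _ at h2
    simp [h2]
  have hs : IsSymmSndFDerivAt ℝ H (t, x) := hH.contDiffAt.isSymmSndFDerivAt (by simp)
  have h3 : HasFDerivAt (fun y => fderiv ℝ H (t, y) (1, 0))
      (((fderiv ℝ (fderiv ℝ H) (t, x)).comp (ContinuousLinearMap.inr ℝ ℝ Space3)).flip (1, 0)) x :=
    ((ContinuousLinearMap.apply ℝ Space3 ((1 : ℝ), (0 : Space3))).hasFDerivAt.comp x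
      ((hd' (t, x)).hasFDerivAt.comp x (hasFDerivAt_prodMk_right t x)))
  have h4 : HasDerivAt (fun s => fderiv ℝ H (s, x)) (fderiv ℝ (fderiv ℝ H) (t, x) (1, 0)) t := by
    have h := ((hd' (t, x)).hasFDerivAt.comp t (hasFDerivAt_prodMk_left t x)).hasDerivAt
    refine h.congr_deriv ?_
    simp
  simp_rw [e1, e2]
  rw [h3.fderiv]
  have h5 := h4.clm_apply (hasDerivAt_const t ((0 : ℝ), w))
  simpa [hs (0, w) (1, 0)] using h5

theorem ContinuousLinearMap.det_space3 (M : Space3 →L[ℝ] Space3) :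
    M.det = (Matrix.of fun i j => M (EuclideanSpace.single j 1) i).det := by
  rw [ContinuousLinearMap.det, ← LinearMap.det_toMatrix (EuclideanSpace.basisFun (Fin 3) ℝ).toBasis]
  congr 1

/-- Jacobi's formula at the identity: each product in the expansion other than the diagonal one has
at least two off-diagonal factors, which vanish at time `t`, so only the trace remains. -/
theorem hasDerivAt_det_of_eq_id {M : ℝ → Space3 →L[ℝ] Space3} {M' : Space3 →L[ℝ] Space3} {t : ℝ}
    (hM : ∀ w, HasDerivAt (fun s => M s w) (M' w) t) (ht : M t = ContinuousLinearMap.id ℝ Space3) :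
    HasDerivAt (fun s => (M s).det) (∑ i, M' (EuclideanSpace.single i 1) i) t := by
  have h : ∀ i j, HasDerivAt (fun s => M s (EuclideanSpace.single j 1) i)
      (M' (EuclideanSpace.single j 1) i) t := fun i j =>
    (EuclideanSpace.proj i : Space3 →L[ℝ] ℝ).hasFDerivAt.comp_hasDerivAt t
      (hM (EuclideanSpace.single j 1))
  simp_rw [ContinuousLinearMap.det_space3, Matrix.det_fin_three, Matrix.of_apply]
  have := ((((((h 0 0).mul (h 1 1)).mul (h 2 2)).sub (((h 0 0).mul (h 1 2)).mul (h 2 1))).sub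
    (((h 0 1).mul (h 1 0)).mul (h 2 2))).add (((h 0 1).mul (h 1 2)).mul (h 2 0))).add
    (((h 0 2).mul (h 1 0)).mul (h 2 1)) |>.sub (((h 0 2).mul (h 1 1)).mul (h 2 0))
  refine this.congr_deriv ?_
  simp [ht, Fin.sum_univ_three]

theorem contDiff_det {X : Type*} [NormedAddCommGroup X] [NormedSpace ℝ X]
    {M : X → Space3 →L[ℝ] Space3} (hM : ContDiff ℝ 1 M) : ContDiff ℝ 1 fun x => (M x).det := by
  have h : ∀ i j, ContDiff ℝ 1 fun x => M x (EuclideanSpace.single j 1) i := fun i j =>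
    contDiff_euclidean.1 (hM.clm_apply contDiff_const) i
  simp_rw [ContinuousLinearMap.det_space3, Matrix.det_fin_three, Matrix.of_apply]
  have := h
  fun_prop

variable {Φ : ℝ → Space3 ≃ Space3}

/-- Taking the configuration at time `t` as reference makes the motion the identity at that time;
its Jacobian is then 1 and its velocity is the spatial velocity field. -/
theorem IsSmoothMotion.trans_symm (hΦ : IsSmoothMotion Φ) (t : ℝ) :
    IsSmoothMotion fun s => (Φ t).symm.trans (Φ s) where
  contDiff := by
    have h1 := hΦ.contDiff
    have h2 := hΦ.contDiff_symm
    exact h1.comp (contDiff_fst.prodMk (h2.comp (contDiff_const (c := t) |>.prodMk contDiff_snd)))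
  contDiff_symm := by
    have h1 := hΦ.contDiff
    have h2 := hΦ.contDiff_symm
    exact h1.comp (contDiff_const (c := t) |>.prodMk h2)

theorem IsSmoothMotion.contDiff_slice (hΦ : IsSmoothMotion Φ) (t : ℝ) : ContDiff ℝ 2 (Φ t) :=
  hΦ.contDiff.comp (contDiff_const (c := t) |>.prodMk contDiff_id)

theorem IsSmoothMotion.contDiff_symm_slice (hΦ : IsSmoothMotion Φ) (t : ℝ) :
    ContDiff ℝ 2 (Φ t).symm :=
  hΦ.contDiff_symm.comp (contDiff_const (c := t) |>.prodMk contDiff_id)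

theorem IsSmoothMotion.measurableSet_image (hΦ : IsSmoothMotion Φ) {D : Set Space3}
    (hD : MeasurableSet D) (t : ℝ) : MeasurableSet (Φ t '' D) := by
  rw [Equiv.image_eq_preimage_symm]
  exact hD.preimage (hΦ.contDiff_symm_slice t).continuous.measurable

theorem IsSmoothMotion.contDiff_intruderVelocity (hΦ : IsSmoothMotion Φ) (t : ℝ) :
    ContDiff ℝ 1 (PressureBody.intruderVelocity Φ t) := by
  have h := (hΦ.trans_symm t).contDiff
  have hd : Differentiable ℝ fun q : ℝ × Space3 => (Φ t).symm.trans (Φ q.1) q.2 :=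
    h.differentiable (by norm_num)
  have e : PressureBody.intruderVelocity Φ t =
      fun y => fderiv ℝ (fun q : ℝ × Space3 => (Φ t).symm.trans (Φ q.1) q.2) (t, y) (1, 0) := by
    funext y
    have h2 := ((hd (t, y)).hasFDerivAt.comp t (hasFDerivAt_prodMk_left t y)).hasDerivAt.deriv
    change deriv (fun s => Φ s ((Φ t).symm y)) t = _ at h2
    simpa [PressureBody.intruderVelocity, materialVelocity] using h2
  rw [e]
  exact ((h.fderiv_right (m := 1) (by norm_num)).comp
    (contDiff_const (c := t) |>.prodMk contDiff_id)).clm_apply contDiff_const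

theorem IsSmoothMotion.hasDerivAt_intruderVelocity (hΦ : IsSmoothMotion Φ) (t : ℝ) (x : Space3) :
    HasDerivAt (fun s => Φ s ((Φ t).symm x)) (PressureBody.intruderVelocity Φ t x) t :=
  ((hΦ.contDiff.comp (contDiff_id.prodMk (contDiff_const (c := (Φ t).symm x)))).differentiable
    (by norm_num) t).hasDerivAt

/-- The integrand of `∫ q` over a moving region, in the coordinates of the initial region. -/
theorem IsSmoothMotion.setIntegral_image (hΦ : IsSmoothMotion Φ) {D : Set Space3}
    (hD : MeasurableSet D) (q : Space3 → ℝ) (s : ℝ) :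
    ∫ x in Φ s '' D, q x = ∫ x in D, |(fderiv ℝ (fun y => Φ s y) x).det| * q (Φ s x) := by
  simp_rw [← smul_eq_mul]
  exact integral_image_eq_integral_abs_det_fderiv_smul volume hD
    (fun x _ => (((hΦ.contDiff_slice s).differentiable
        (by norm_num)) x).hasFDerivAt.hasFDerivWithinAt)
    (Φ s).injective.injOn q

variable {q : Space3 → ℝ} {L : ℝ≥0}

/-- The Jacobian determinant of a C² motion is jointly C¹ in time and space, hence locally
Lipschitz. -/
theorem IsSmoothMotion.locallyLipschitz_pullback (hΦ : IsSmoothMotion Φ) (hq : LipschitzWith L q) :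
    LocallyLipschitz fun z : ℝ × Space3 =>
      |(fderiv ℝ (fun y => Φ z.1 y) z.2).det| * q (Φ z.1 z.2) := by
  refine LocallyLipschitz.mul_real ?_ ?_
  · have h : ContDiff ℝ 1 fun z : ℝ × Space3 => fderiv ℝ (fun y => Φ z.1 y) z.2 :=
      ContDiff.fderiv (m := 2) (f := fun z y => Φ z.1 y)
        (hΦ.contDiff.comp ((contDiff_fst.comp contDiff_fst).prodMk contDiff_snd))
        contDiff_snd (by norm_num)
    exact lipschitzWith_one_norm.locallyLipschitz.comp (contDiff_det h).locallyLipschitz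
  · exact hq.locallyLipschitz.comp (hΦ.contDiff.of_le (by norm_num)).locallyLipschitz

theorem IsSmoothMotion.exists_isCompact (hΦ : IsSmoothMotion Φ) (hqc : HasCompactSupport q)
    (a b : ℝ) : ∃ K, IsCompact K ∧ ∀ s ∈ Icc a b, ∀ x ∉ K, q (Φ s x) = 0 := by
  refine ⟨(fun z : ℝ × Space3 => (Φ z.1).symm z.2) '' (Icc a b ×ˢ tsupport q),
    (isCompact_Icc.prod hqc).image hΦ.contDiff_symm.continuous, fun s hs x hx => ?_⟩
  by_contra h
  exact hx ⟨(s, Φ s x), ⟨hs, subset_tsupport _ h⟩, by simp⟩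

theorem IsSmoothMotion.exists_lipschitzOnWith_setIntegral (hΦ : IsSmoothMotion Φ) {D : Set Space3}
    (hD : MeasurableSet D) (hq : LipschitzWith L q) (hqc : HasCompactSupport q) (a b : ℝ) :
    ∃ C, LipschitzOnWith C (fun s => ∫ x in Φ s '' D, q x) (Icc a b) := by
  simp_rw [hΦ.setIntegral_image hD]
  obtain ⟨K, hK, h0⟩ := hΦ.exists_isCompact hqc a b
  exact (hΦ.locallyLipschitz_pullback hq).exists_lipschitzOnWith_setIntegral hK
    (fun s hs x hx => by simp [h0 s hs x hx]) D

/-- Reynolds' transport theorem for a Lipschitz function of compact support. -/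
theorem IsSmoothMotion.hasDerivAt_setIntegral (hΦ : IsSmoothMotion Φ) {D : Set Space3}
    (hD : MeasurableSet D) (hq : LipschitzWith L q) (hqc : HasCompactSupport q) (t : ℝ) :
    HasDerivAt (fun s => ∫ x in Φ s '' D, q x)
      (∫ x in Φ t '' D, (fderiv ℝ q x (PressureBody.intruderVelocity Φ t x) +
        q x * divergence (PressureBody.intruderVelocity Φ t) x)) t := by
  have hΨ := hΦ.trans_symm t
  set Ψ : ℝ → Space3 ≃ Space3 := fun s => (Φ t).symm.trans (Φ s) with hΨd
  have e : ∀ s, Φ s '' D = Ψ s '' (Φ t '' D) := fun s => by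
    rw [image_image]; simp [hΨd]
  have e' : (fun s => ∫ x in Φ s '' D, q x) = fun s => ∫ x in Φ t '' D,
      |(fderiv ℝ (fun y => Ψ s y) x).det| * q (Ψ s x) := by
    funext s
    rw [e s, hΨ.setIntegral_image (hΦ.measurableSet_image hD t)]
  rw [e']
  obtain ⟨K, hK, h0⟩ := hΨ.exists_isCompact hqc (t - 1) (t + 1)
  refine (hΨ.locallyLipschitz_pullback hq).hasDerivAt_setIntegral hK
    (a := t - 1) (b := t + 1) (fun s hs x hx => by simp [h0 s hs x hx]) _
        (by constructor <;> linarith) ?_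
  filter_upwards [ae_restrict_of_ae hq.ae_differentiableAt] with x hx
  have hid : (fun y => Ψ t y) = id := by funext y; simp [hΨd]
  have hM := hasDerivAt_det_of_eq_id (M := fun s => fderiv ℝ (fun y => Ψ s y) x)
    (fun w => hΨ.contDiff.hasDerivAt_fderiv_slice t x w) (by simp only [hid]; exact fderiv_id)
  -- The determinant is positive near time `t`, so the absolute value in the change of variables can
  -- be dropped.
  have hdet : (fderiv ℝ (fun y => Ψ t y) x).det = 1 := by
    simp only [hid]; rw [fderiv_id]; simp [ContinuousLinearMap.det]
  have hM' : HasDerivAt (fun s => |(fderiv ℝ (fun y => Ψ s y) x).det|)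
      (divergence (PressureBody.intruderVelocity Φ t) x) t := by
    refine HasDerivAt.congr_of_eventuallyEq hM ?_
    have := hM.continuousAt.eventually (lt_mem_nhds (one_pos.trans_eq hdet.symm))
    filter_upwards [this] with s hs using abs_of_pos hs
  have hΨx : Ψ t x = x := congrFun hid x
  have hq' : HasDerivAt (fun s => q (Ψ s x)) (fderiv ℝ q x
      (PressureBody.intruderVelocity Φ t x)) t := by
    refine HasFDerivAt.comp_hasDerivAt t ?_ (hΦ.hasDerivAt_intruderVelocity t x)
    rw [hΨx]
    exact hx.hasFDerivAt
  have := hM'.mul hq'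
  refine this.congr_deriv ?_
  rw [hdet, hΨx]
  simp
  ring

end Transport

/-! ### Extension by zero across the frontier. -/

section ZeroExtension

variable {E : Type*} [NormedAddCommGroup E] [NormedSpace ℝ E] {s : Set E} {y z : E}

/-- A segment is connected, so it cannot be split between the interior of `s` and the complement. -/
theorem exists_mem_segment_frontier (hs : IsClosed s) (hy : y ∈ s) (hz : z ∉ s) :
    ∃ w ∈ segment ℝ y z, w ∈ frontier s := by
  by_contra! h
  have hc : segment ℝ y z ⊆ interior s ∪ sᶜ := fun w hw => by
    by_cases hws : w ∈ s
    · refine .inl (by_contra fun hi => h w hw ?_)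
      rw [hs.frontier_eq]
      exact ⟨hws, hi⟩
    · exact .inr hws
  obtain ⟨w, -, hw, hw'⟩ := (convex_segment y z).isPreconnected _ _ isOpen_interior hs.isOpen_compl
      hc
    ⟨y, left_mem_segment ℝ y z, (hc (left_mem_segment ℝ y z)).resolve_right fun h => h hy⟩
    ⟨z, right_mem_segment ℝ y z, hz⟩
  exact hw' (interior_subset hw)

/-- The extension by zero of a locally Lipschitz function which vanishes on the frontier. -/
theorem LocallyLipschitzOn.locallyLipschitz_indicator {f : E → ℝ} (hf : LocallyLipschitzOn s f)
    (hs : IsClosed s) (h0 : ∀ x ∈ frontier s, f x = 0) : LocallyLipschitz (s.indicator f) := by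
  intro x
  by_cases hx : x ∈ s
  · obtain ⟨K, t, ht, hK⟩ := hf hx
    obtain ⟨r, hr, hrt⟩ := Metric.mem_nhdsWithin_iff.1 ht
    -- The segment from `y` inside to `z` outside crosses the frontier at a point of the ball where
    -- `f` vanishes and which is no farther from `y` than `z`.
    have key : ∀ y ∈ Metric.ball x r, ∀ z ∈ Metric.ball x r, y ∈ s → z ∉ s →
        |f y| ≤ K * dist y z := by
      intro y hy z hz hys hzs
      obtain ⟨w, hw, hwf⟩ := exists_mem_segment_frontier hs hys hzs
      have h1 := hK.dist_le_mul y (hrt ⟨hy, hys⟩) w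
        (hrt ⟨(convex_ball x r).segment_subset hy hz hw, hs.frontier_subset hwf⟩)
      rw [h0 w hwf, dist_zero_right, Real.norm_eq_abs] at h1
      have h2 := dist_add_dist_of_mem_segment hw
      refine h1.trans (mul_le_mul_of_nonneg_left ?_ K.2)
      linarith [dist_nonneg (x := w) (y := z)]
    refine ⟨K, Metric.ball x r, Metric.ball_mem_nhds x hr,
      LipschitzOnWith.of_dist_le_mul fun y hy z hz => ?_⟩
    by_cases hys : y ∈ s <;> by_cases hzs : z ∈ s <;> simp only [hys, hzs, indicator_of_mem,
      indicator_of_notMem, not_false_eq_true, dist_zero_right, dist_zero_left, dist_self]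
    · exact hK.dist_le_mul y (hrt ⟨hy, hys⟩) z (hrt ⟨hz, hzs⟩)
    · exact key y hy z hz hys hzs
    · rw [dist_comm]; exact key z hz y hy hzs hys
    · positivity
  · refine ⟨0, sᶜ, hs.isOpen_compl.mem_nhds hx, LipschitzOnWith.of_dist_le_mul fun y hy z hz => ?_⟩
    simp [indicator_of_notMem hy, indicator_of_notMem hz]

end ZeroExtension

/-! ### Energy and power for one pressure field. -/

namespace PressureBody

variable (A : PressureBody)

/-- The pressure field, extended by zero. -/
noncomputable def extendedPressure : Space3 → ℝ := A.carrier.indicator A.pressure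

theorem extendedPressure_nonneg (x : Space3) : 0 ≤ A.extendedPressure x :=
  indicator_nonneg A.pressure_nonneg x

theorem locallyLipschitz_extendedPressure : LocallyLipschitz A.extendedPressure :=
  A.locallyLipschitz_pressure.locallyLipschitz_indicator A.isClosed_carrier A.pressure_frontier

/-- A globally Lipschitz field of compact support which is the pressure in a given ball. -/
theorem exists_truncation (R : ℝ) : ∃ (q : Space3 → ℝ) (L : ℝ≥0), LipschitzWith L q ∧
    HasCompactSupport q ∧ (∀ x, 0 ≤ q x) ∧ (∀ x ∉ A.carrier, q x = 0) ∧
    ∀ x ∈ Metric.closedBall 0 R, q x = A.extendedPressure x := by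
  -- The maximum with 1 only keeps the inner radius positive when `R` is not.
  let χ : ContDiffBump (0 : Space3) := ⟨max R 1, max R 1 + 1, by positivity, by linarith⟩
  have hc : HasCompactSupport fun x => A.extendedPressure x * χ x := χ.hasCompactSupport.mul_left
  obtain ⟨L, hL⟩ := (A.locallyLipschitz_extendedPressure.mul_real
    (χ.contDiff (n := 1)).locallyLipschitz).exists_lipschitzWith_of_hasCompactSupport hc
  refine ⟨_, L, hL, hc, fun x => mul_nonneg (A.extendedPressure_nonneg x) χ.nonneg, fun x hx => ?_,
    fun x hx => ?_⟩
  · simp [extendedPressure, hx]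
  · rw [χ.one_of_mem_closedBall (Metric.closedBall_subset_closedBall (le_max_left R 1) hx), mul_one]

variable {A} {D : Set Space3} {Φ : ℝ → Space3 ≃ Space3}

theorem exists_overlapVolume_subset_closedBall (hΦ : IsSmoothMotion Φ)
    (hb : Bornology.IsBounded A.carrier ∨ Bornology.IsBounded D) (a b : ℝ) :
    ∃ R, ∀ t ∈ Icc a b, A.overlapVolume D Φ t ⊆ Metric.closedBall 0 R := by
  rcases hb with hb | hb
  · obtain ⟨R, hR⟩ := hb.subset_closedBall 0
    exact ⟨R, fun t _ => inter_subset_left.trans hR⟩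
  · have hK : IsCompact ((fun z : ℝ × Space3 => Φ z.1 z.2) '' (Icc a b ×ˢ closure D)) :=
      (isCompact_Icc.prod hb.isCompact_closure).image hΦ.contDiff.continuous
    obtain ⟨R, hR⟩ := hK.isBounded.subset_closedBall 0
    refine ⟨R, fun t ht => ?_⟩
    rintro _ ⟨-, y, hy, rfl⟩
    exact hR ⟨(t, y), ⟨ht, subset_closure hy⟩, rfl⟩

theorem measurableSet_overlapVolume (hΦ : IsSmoothMotion Φ) (hD : MeasurableSet D) (t : ℝ) :
    MeasurableSet (A.overlapVolume D Φ t) :=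
  A.isClosed_carrier.measurableSet.inter (hΦ.measurableSet_image hD t)

/-- This keeps the frontier of the overlap in the carrier and in the ball, where the cut-off field
agrees with the pressure. -/
theorem closure_overlapVolume_subset {R : ℝ} {t : ℝ}
    (hR : A.overlapVolume D Φ t ⊆ Metric.closedBall 0 R) :
    closure (A.overlapVolume D Φ t) ⊆ A.carrier ∩ Metric.closedBall 0 R :=
  closure_minimal (subset_inter inter_subset_left hR)
    (A.isClosed_carrier.inter Metric.isClosed_closedBall)

theorem integrableOn_overlapVolume (hΦ : IsSmoothMotion Φ) (hD : MeasurableSet D)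
    (hb : Bornology.IsBounded A.carrier ∨ Bornology.IsBounded D) (t : ℝ) :
    IntegrableOn A.pressure (A.overlapVolume D Φ t) := by
  obtain ⟨R, hR⟩ := A.exists_overlapVolume_subset_closedBall hΦ hb t t
  have hR := hR t (by simp)
  obtain ⟨q, L, hL, hc, -, -, hq⟩ := A.exists_truncation R
  refine IntegrableOn.congr_fun (hL.continuous.integrable_of_hasCompactSupport hc).integrableOn
    (fun x hx => ?_) (measurableSet_overlapVolume hΦ hD t)
  rw [hq x (hR hx), extendedPressure, indicator_of_mem hx.1]

/-- Since `q` vanishes off the carrier, the integral over a fixed set cut by a moving one becomes an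
integral over the moving region alone, to which the transport theorem applies. -/
theorem fieldEnergy_eq_setIntegral_image (hΦ : IsSmoothMotion Φ) (hD : MeasurableSet D) {R : ℝ}
    {t : ℝ} (hR : A.overlapVolume D Φ t ⊆ Metric.closedBall 0 R) {q : Space3 → ℝ}
    (hq0 : ∀ x ∉ A.carrier, q x = 0)
    (hq : ∀ x ∈ Metric.closedBall 0 R, q x = A.extendedPressure x) :
    A.fieldEnergy (A.overlapVolume D Φ t) = ∫ x in Φ t '' D, q x := by
  rw [setIntegral_eq_of_subset_of_forall_sdiff_eq_zero (s := A.overlapVolume D Φ t)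
    (hΦ.measurableSet_image hD t) inter_subset_right fun x hx => hq0 x fun h => hx.2 ⟨h, hx.1⟩]
  refine setIntegral_congr_fun (measurableSet_overlapVolume hΦ hD t) fun x hx => ?_
  rw [hq x (hR hx), extendedPressure, indicator_of_mem hx.1]

theorem exists_lipschitzOnWith_fieldEnergy (hΦ : IsSmoothMotion Φ) (hD : MeasurableSet D)
    (hb : Bornology.IsBounded A.carrier ∨ Bornology.IsBounded D) (a b : ℝ) :
    ∃ C, LipschitzOnWith C (fun t => A.fieldEnergy (A.overlapVolume D Φ t)) (Icc a b) := by
  obtain ⟨R, hR⟩ := A.exists_overlapVolume_subset_closedBall hΦ hb a b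
  obtain ⟨q, L, hL, hc, -, hq0, hq⟩ := A.exists_truncation R
  obtain ⟨C, hC⟩ := hΦ.exists_lipschitzOnWith_setIntegral hD hL hc a b
  refine ⟨C, fun s hs t ht => ?_⟩
  simp only [fieldEnergy_eq_setIntegral_image hΦ hD (hR s hs) hq0 hq,
    fieldEnergy_eq_setIntegral_image hΦ hD (hR t ht) hq0 hq]
  exact hC hs ht

/-- The power balance for one pressure field. -/
theorem RegularOverlap.hasDerivAt_fieldEnergy {t : ℝ} (h : A.RegularOverlap D Φ t)
    (hΦ : IsSmoothMotion Φ) (hD : MeasurableSet D)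
    (hb : Bornology.IsBounded A.carrier ∨ Bornology.IsBounded D) :
    IntegrableOn (powerDensity A.pressure (A.overlapVolume D Φ t) (A.overlapVolume D Φ t)ᶜ
      (intruderVelocity Φ t)) (frontier (A.overlapVolume D Φ t)) μHE[2] ∧
    HasDerivAt (fun s => A.fieldEnergy (A.overlapVolume D Φ s)) (A.overlapPower D Φ t) t := by
  obtain ⟨R, hR⟩ := A.exists_overlapVolume_subset_closedBall hΦ hb (t - 1) (t + 1)
  obtain ⟨q, L, hL, hc, hqn, hq0, hq⟩ := A.exists_truncation R
  have hn : Icc (t - 1) (t + 1) ∈ 𝓝 t := Icc_mem_nhds (by linarith) (by linarith)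
  have hqS : ∀ x ∈ frontier (A.overlapVolume D Φ t), q x = A.pressure x := fun x hx => by
    have hx' := closure_overlapVolume_subset (hR t (mem_of_mem_nhds hn))
        (frontier_subset_closure hx)
    rw [hq x hx'.2, extendedPressure, indicator_of_mem hx'.1]
  have hS : MeasurableSet (frontier (A.overlapVolume D Φ t)) := isClosed_frontier.measurableSet
  have hpd : ∀ x ∈ frontier (A.overlapVolume D Φ t),
      powerDensity q (A.overlapVolume D Φ t) (A.overlapVolume D Φ t)ᶜ (intruderVelocity Φ t) x =
      powerDensity A.pressure (A.overlapVolume D Φ t) (A.overlapVolume D Φ t)ᶜ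
        (intruderVelocity Φ t) x := fun x hx => by
    simp only [powerDensity, hqS x hx]
  obtain ⟨hi, he⟩ := gaussGreen_traction (W := (A.overlapVolume D Φ t)ᶜ)
    (measurableSet_overlapVolume (A := A) hΦ hD t) hS hL hc hqn (hΦ.contDiff_intruderVelocity t)
    (fun x hx _ => hx) (h.finite_load.congr_fun (fun x hx => (hqS x hx).symm) hS) (by
      filter_upwards [h.ae_interface, ae_restrict_mem hS] with x hx hxS
      rwa [hqS x hxS])
  refine ⟨hi.congr_fun hpd hS, ?_⟩
  have e : A.overlapPower D Φ t = ∫ x in Φ t '' D, (fderiv ℝ q x (intruderVelocity Φ t x) +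
      q x * divergence (intruderVelocity Φ t) x) := by
    rw [setIntegral_eq_of_subset_of_forall_sdiff_eq_zero (s := A.overlapVolume D Φ t)
      (hΦ.measurableSet_image hD t) inter_subset_right, he]
    · exact (setIntegral_congr_fun hS hpd).symm
    · intro x hx
      have hx0 : q x = 0 := hq0 x fun h => hx.2 ⟨h, hx.1⟩
      -- Off the carrier `q` attains its minimum 0, so the derivative in the transport integrand
      -- vanishes along with `q`.
      have : IsLocalMin q x := .of_forall fun y => by rw [hx0]; exact hqn y
      simp [this.fderiv_eq_zero, hx0]
  rw [e]
  refine (hΦ.hasDerivAt_setIntegral hD hL hc t).congr_of_eventuallyEq ?_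
  filter_upwards [hn] with s hs
  exact fieldEnergy_eq_setIntegral_image hΦ hD (hR s hs) hq0 hq

/-- The work needed to displace one pressure field. -/
theorem integral_overlapPower (hΦ : IsSmoothMotion Φ) (hD : MeasurableSet D)
    (hb : Bornology.IsBounded A.carrier ∨ Bornology.IsBounded D) {t₀ t₁ : ℝ} (ht : t₀ ≤ t₁)
    (h : ∀ᵐ t ∂volume.restrict (Icc t₀ t₁), A.RegularOverlap D Φ t) :
    IntervalIntegrable (A.overlapPower D Φ) volume t₀ t₁ ∧
    ∫ t in t₀..t₁, A.overlapPower D Φ t =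
      A.fieldEnergy (A.overlapVolume D Φ t₁) - A.fieldEnergy (A.overlapVolume D Φ t₀) := by
  obtain ⟨C, hC⟩ := A.exists_lipschitzOnWith_fieldEnergy hΦ hD hb t₀ t₁
  refine hC.intervalIntegrable_and_integral_eq_sub ht ?_
  filter_upwards [h] with t h
  exact (h.hasDerivAt_fieldEnergy hΦ hD hb).2.hasDerivWithinAt

end PressureBody

/-! ### Rigid motions: regularity, incompressibility and carried fields. -/

section RigidMotion

theorem Pose.apply_eq (g : Pose) (x : Space3) : g x = g.linearIsometryEquiv x + g 0 := by
  simpa using g.map_vadd 0 x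

/-- A pose is affine in the images of the origin and the basis vectors. This upgrades regularity in
time for each fixed point to joint regularity in time and space. -/
theorem Pose.apply_eq_sum (g : Pose) (x : Space3) :
    g x = g 0 + ∑ i, x i • (g (EuclideanSpace.single i 1) - g 0) := by
  have h : ∀ y, g y - g 0 = g.linearIsometryEquiv y := fun y => by rw [Pose.apply_eq g y]; abel
  simp_rw [h, ← map_smul, ← map_sum, ← space3_eq_sum, ← h]
  abel

/-- The inverse of an isometry reads off coordinates in the moved orthonormal frame, so it inherits
joint regularity without the inverse function theorem. -/
theorem Pose.symm_apply_coord (g : Pose) (x : Space3) (i : Fin 3) :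
    g.symm x i = inner ℝ (g (EuclideanSpace.single i 1) - g 0) (x - g 0) := by
  have h : ∀ y, g y - g 0 = g.linearIsometryEquiv y := fun y => by rw [Pose.apply_eq g y]; abel
  obtain ⟨y, rfl⟩ := g.surjective x
  rw [h, h, LinearIsometryEquiv.inner_map_map, EuclideanSpace.inner_single_left]
  simp

theorem Pose.measurePreserving (g : Pose) : MeasurePreserving g
    (volume : Measure Space3) volume := by
  have := (measurePreserving_add_right (volume : Measure Space3) (g 0)).comp
    g.linearIsometryEquiv.measurePreserving
  rwa [show (fun x => x + g 0) ∘ g.linearIsometryEquiv = g from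
    funext fun x => (Pose.apply_eq g x).symm] at this

variable {g : ℝ → Pose}

theorem IsRigidMotion.contDiff (hg : IsRigidMotion g) :
    ContDiff ℝ 1 fun z : ℝ × Space3 => g z.1 z.2 := by
  simp_rw [fun z : ℝ × Space3 => Pose.apply_eq_sum (g z.1) z.2]
  have h : ∀ y, ContDiff ℝ 1 fun z : ℝ × Space3 => g z.1 y := fun y => (hg y).comp contDiff_fst
  exact (h 0).add (ContDiff.sum fun i _ =>
    ContDiff.smul (contDiff_euclidean.1 contDiff_snd i) ((h _).sub (h 0)))

theorem IsRigidMotion.contDiff_symm (hg : IsRigidMotion g) :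
    ContDiff ℝ 1 fun z : ℝ × Space3 => (g z.1).symm z.2 := by
  have h : ∀ y, ContDiff ℝ 1 fun z : ℝ × Space3 => g z.1 y := fun y => (hg y).comp contDiff_fst
  refine contDiff_euclidean.2 fun i => ?_
  simp_rw [Pose.symm_apply_coord]
  exact ((h _).sub (h 0)).inner ℝ (contDiff_snd.sub (h 0))

theorem IsRigidMotion.hasDerivAt_rigidVelocity (hg : IsRigidMotion g) (t : ℝ) (x : Space3) :
    HasDerivAt (fun s => g s ((g t).symm x)) (rigidVelocity g t x) t :=
  ((hg _).differentiable (by norm_num) t).hasDerivAt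

theorem IsRigidMotion.contDiff_rigidVelocity (hg : IsRigidMotion g) (t : ℝ) :
    ContDiff ℝ 1 (rigidVelocity g t) := by
  have hd : ∀ y, HasDerivAt (fun s => g s y) (deriv (fun s => g s y) t) t := fun y =>
    ((hg y).differentiable (by norm_num) t).hasDerivAt
  have e : ∀ x, rigidVelocity g t x = deriv (fun s => g s 0) t + ∑ i, (g t).symm x i •
      (deriv (fun s => g s (EuclideanSpace.single i 1)) t - deriv (fun s => g s 0) t) := fun x => by
    refine (hg.hasDerivAt_rigidVelocity t x).unique ?_
    simp_rw [fun s => Pose.apply_eq_sum (g s) ((g t).symm x)]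
    exact (hd 0).add (HasDerivAt.fun_sum fun i _ => ((hd _).sub (hd 0)).fun_const_smul _)
  have h : ContDiff ℝ 1 (g t).symm := hg.contDiff_symm.comp (contDiff_const (c :=
      t) |>.prodMk contDiff_id)
  rw [funext e]
  exact contDiff_const.add (ContDiff.sum fun i _ => (contDiff_euclidean.1 h i).smul contDiff_const)

/-- Differentiate the constant squared distance between two points of the body. -/
theorem IsRigidMotion.inner_rigidVelocity_sub (hg : IsRigidMotion g) (t : ℝ) (x y : Space3) :
    inner ℝ (rigidVelocity g t x - rigidVelocity g t y) (x - y) = 0 := by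
  have h := (hg.hasDerivAt_rigidVelocity t x).sub (hg.hasDerivAt_rigidVelocity t y)
  have h2 := h.inner ℝ h
  have e : (fun s => inner ℝ (g s ((g t).symm x) - g s ((g t).symm y))
      (g s ((g t).symm x) - g s ((g t).symm y))) = fun _ => dist x y ^ 2 := by
    funext s
    rw [real_inner_self_eq_norm_sq, ← dist_eq_norm, (g s).dist_map, (g t).symm.dist_map]
  have h3 := h2.unique ((hasDerivAt_const t (dist x y ^ 2)).congr_of_eventuallyEq
    (.of_eq e))
  simp only [Pi.sub_apply, AffineIsometryEquiv.apply_symm_apply] at h3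
  rw [real_inner_comm] at h3
  linarith

/-- A rigid motion preserves volume. -/
theorem IsRigidMotion.divergence_rigidVelocity (hg : IsRigidMotion g) (t : ℝ) (x : Space3) :
    divergence (rigidVelocity g t) x = 0 := by
  refine Finset.sum_eq_zero fun i _ => ?_
  set w : Space3 := EuclideanSpace.single i 1 with hw
  have h1 : HasLineDerivAt ℝ (rigidVelocity g t) (fderiv ℝ (rigidVelocity g t) x w) x w :=
    ((hg.contDiff_rigidVelocity t).differentiable (by norm_num) x).hasFDerivAt.hasLineDerivAt w
  have h2 := (HasDerivAt.sub_const (rigidVelocity g t x) h1).inner ℝ (hasDerivAt_const (0 : ℝ) w)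
  -- Rigidity between `x` and `x + r • w` makes the component of the relative velocity along `w`
  -- vanish, so every diagonal entry of the velocity gradient is zero.
  have e : (fun r : ℝ => inner ℝ (rigidVelocity g t (x + r • w) - rigidVelocity g t x) w) =
      fun _ => (0 : ℝ) := by
    funext r
    have := hg.inner_rigidVelocity_sub t (x + r • w) x
    rw [add_sub_cancel_left, inner_smul_right] at this
    rcases mul_eq_zero.1 this with h | h
    · simp [h]
    · exact h
  rw [e] at h2
  have h3 := h2.unique (hasDerivAt_const _ _)
  rw [inner_zero_right, zero_add, hw, real_inner_comm, EuclideanSpace.inner_single_left] at h3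
  simpa using h3

/-- The material derivative of a field which is carried along by a rigid motion vanishes. -/
theorem IsRigidMotion.hasDerivAt_comp_symm (hg : IsRigidMotion g) {q : Space3 → ℝ} {t : ℝ}
    {x : Space3} (hq : DifferentiableAt ℝ (fun y => q ((g t).symm y)) x) :
    HasDerivAt (fun s => q ((g s).symm x))
      (-fderiv ℝ (fun y => q ((g t).symm y)) x (rigidVelocity g t x)) t := by
  have hH : Differentiable ℝ fun z : ℝ × Space3 => g z.1 z.2 :=
      hg.contDiff.differentiable (by norm_num)
  set H' := fderiv ℝ (fun z : ℝ × Space3 => g z.1 z.2) (t, (g t).symm x) with hH'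
  have hH0 : HasFDerivAt (fun z : ℝ × Space3 => g z.1 z.2) H' (t, (g t).symm x) :=
      (hH _).hasFDerivAt
  have key : ∀ {σ : ℝ → ℝ} {η : ℝ → Space3} {σ' : ℝ} {η' : Space3}, HasDerivAt σ σ' t →
      HasDerivAt η η' t → σ t = t → η t = (g t).symm x →
      HasDerivAt (fun s => g (σ s) (η s)) (H' (σ', η')) t := fun h1 h2 e1 e2 => by
    have hp : (t, (g t).symm x) = (_, _) := Prod.ext e1.symm e2.symm
    rw [hp] at hH0
    exact HasFDerivAt.comp_hasDerivAt t hH0 (h1.prodMk h2)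
  obtain ⟨c, hc⟩ : ∃ c, HasDerivAt (fun s => (g s).symm x) c t :=
    ⟨_, ((hg.contDiff_symm.comp (contDiff_id.prodMk (contDiff_const (c := x)))).differentiable
      (by norm_num) t).hasDerivAt⟩
  have h1 := key (hasDerivAt_id t) hc rfl rfl
  have h2 := key (hasDerivAt_id t) (hasDerivAt_const t ((g t).symm x)) rfl rfl
  have h3 := key (hasDerivAt_const t t) hc rfl rfl
  -- Here `g s ((g s).symm x) = x` is differentiated. Subtracting the motion of a fixed body point
  -- leaves minus the velocity for the variation of `(g s).symm x` with the pose frozen at `t`.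
  have e1 : H' (1, c) = 0 := by
    simp only [id_eq, AffineIsometryEquiv.apply_symm_apply] at h1
    exact h1.unique (hasDerivAt_const t x)
  have e2 : H' (1, 0) = rigidVelocity g t x := h2.unique (hg.hasDerivAt_rigidVelocity t x)
  have e3 : H' (0, c) = -rigidVelocity g t x := by
    have : ((1 : ℝ), c) = (1, 0) + (0, c) := by simp
    rw [this, map_add, e2] at e1
    exact eq_neg_of_add_eq_zero_right e1
  rw [e3] at h3
  -- The field at time `s` is the field at time `t` evaluated at `g t ((g s).symm x)`; only
  -- differentiability of the latter field at `x` is used.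
  have h4 : HasDerivAt (fun s => (fun y => q ((g t).symm y)) (g t ((g s).symm x)))
      (fderiv ℝ (fun y => q ((g t).symm y)) x (-rigidVelocity g t x)) t := by
    have hx : g t ((g t).symm x) = x := (g t).apply_symm_apply x
    have h5 : HasFDerivAt (fun y => q ((g t).symm y)) (fderiv ℝ (fun y => q ((g t).symm y)) x)
        (g t ((g t).symm x)) := by rw [hx]; exact hq.hasFDerivAt
    exact HasFDerivAt.comp_hasDerivAt (f := fun s => g t ((g s).symm x)) t h5 h3
  simpa using h4

variable {q : Space3 → ℝ} {L : ℝ≥0}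

theorem IsRigidMotion.locallyLipschitz_comp_symm (hg : IsRigidMotion g) (hq : LipschitzWith L q) :
    LocallyLipschitz fun z : ℝ × Space3 => q ((g z.1).symm z.2) :=
  hq.locallyLipschitz.comp hg.contDiff_symm.locallyLipschitz

theorem IsRigidMotion.exists_isCompact (hg : IsRigidMotion g) (hqc : HasCompactSupport q)
    (a b : ℝ) : ∃ K, IsCompact K ∧ ∀ s ∈ Icc a b, ∀ x ∉ K, q ((g s).symm x) = 0 := by
  refine ⟨(fun z : ℝ × Space3 => g z.1 z.2) '' (Icc a b ×ˢ tsupport q),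
    (isCompact_Icc.prod hqc).image hg.contDiff.continuous, fun s hs x hx => ?_⟩
  by_contra h
  exact hx ⟨(s, (g s).symm x), ⟨hs, subset_tsupport _ h⟩, by simp⟩

end RigidMotion

/-! ### Time derivative of the integral of the smaller pressure. -/

section MinIntegral

variable {a b : Space3 → ℝ} {L : ℝ≥0}

theorem integrable_fderiv_apply_of_lipschitz {v : Space3 → Space3} (ha : LipschitzWith L a)
    (hc : HasCompactSupport a) (hv : Continuous v) : Integrable fun x => fderiv ℝ a x (v x) := by
  obtain ⟨C, hC⟩ := (hc.isCompact.image_of_continuousOn hv.continuousOn).isBounded.exists_norm_le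
  have hs : Function.support (fun x => fderiv ℝ a x (v x)) ⊆ tsupport a := fun x hx =>
    support_fderiv_subset ℝ fun h => hx (by simp [h])
  rw [← integrableOn_iff_integrable_of_support_subset hs]
  have hm : Measurable fun x => fderiv ℝ a x (v x) := by
    have := measurable_fderiv ℝ a
    have e : ∀ x, fderiv ℝ a x (v x) = ∑ i, v x i * fderiv ℝ a x (EuclideanSpace.single i 1) :=
        fun x => by
      conv_lhs => rw [space3_eq_sum (v x)]
      simp
    simp_rw [e]
    refine Finset.measurable_sum _ fun i _ => Measurable.mul ?_
        (measurable_fderiv_apply_const ℝ a _)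
    exact ((EuclideanSpace.proj i : Space3 →L[ℝ] ℝ).continuous.comp hv).measurable
  refine Measure.integrableOn_of_bounded (M := L * C) hc.isCompact.measure_lt_top.ne
    hm.aestronglyMeasurable ?_
  filter_upwards [ae_restrict_mem hc.isCompact.measurableSet] with x hx
  refine (ContinuousLinearMap.le_opNorm _ _).trans ?_
  gcongr
  · exact norm_fderiv_le_of_lipschitz ℝ ha
  · exact hC _ (mem_image_of_mem v hx)

/-- The minimum is squeezed between 0 and `f`, which is of smaller order than `s - t`. No
differentiability of `f'` is needed. -/
theorem hasDerivAt_min_of_nonneg {f f' : ℝ → ℝ} {t : ℝ} (hf : ∀ s, 0 ≤ f s) (hf' : ∀ s, 0 ≤ f' s)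
    (h : HasDerivAt f 0 t) (h0 : f t = 0) : HasDerivAt (fun s => min (f s) (f' s)) 0 t := by
  rw [hasDerivAt_iff_isLittleO] at h ⊢
  refine (Asymptotics.IsBigO.of_norm_le fun s => ?_).trans_isLittleO h
  have h1 : min (f t) (f' t) = 0 := by rw [h0, min_eq_left (hf' t)]
  rw [h1, h0]
  simp only [sub_zero, smul_zero, Real.norm_eq_abs]
  rw [abs_of_nonneg (le_min (hf s) (hf' s))]
  exact min_le_left _ _

variable {g h : ℝ → Pose} {α β : Space3 → ℝ} {t : ℝ}

theorem IsRigidMotion.exists_lipschitzOnWith_integral_min (hg : IsRigidMotion g)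
    (hh : IsRigidMotion h)
    (hα : LipschitzWith L α) (hαc : HasCompactSupport α) {L' : ℝ≥0} (hβ : LipschitzWith L' β)
    (hβ0 : ∀ x, 0 ≤ β x) (t₀ t₁ : ℝ) :
    ∃ C, LipschitzOnWith C (fun s => ∫ x, min (α ((g s).symm x)) (β ((h s).symm x)))
      (Icc t₀ t₁) := by
  obtain ⟨K, hK, h0⟩ := hg.exists_isCompact hαc t₀ t₁
  have := ((hg.locallyLipschitz_comp_symm hα).min
    (hh.locallyLipschitz_comp_symm hβ)).exists_lipschitzOnWith_setIntegral hK (a := t₀) (b := t₁)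
    (fun s hs x hx => by simp [h0 s hs x hx, hβ0]) univ
  simpa only [setIntegral_univ] using this

/-- At almost every point the minimum follows the strictly smaller field for a short time, or both
fields vanish and its derivative is zero. The region {`a < b`} itself need not be differentiated. -/
theorem IsRigidMotion.hasDerivAt_integral_min (hg : IsRigidMotion g) (hh : IsRigidMotion h)
    (hα : LipschitzWith L α) (hαc : HasCompactSupport α) {L' : ℝ≥0} (hβ : LipschitzWith L' β)
    (hβc : HasCompactSupport β) (hα0 : ∀ x, 0 ≤ α x) (hβ0 : ∀ x, 0 ≤ β x)
    (ha : a = fun x => α ((g t).symm x)) (hb : b = fun x => β ((h t).symm x))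
    (hn : volume {x | a x = b x ∧ 0 < a x} = 0) :
    HasDerivAt (fun s => ∫ x, min (α ((g s).symm x)) (β ((h s).symm x)))
      (-((∫ x in {x | a x < b x}, fderiv ℝ a x (rigidVelocity g t x)) +
        ∫ x in {x | b x < a x}, fderiv ℝ b x (rigidVelocity h t x))) t := by
  have haL : LipschitzWith L a := by
    have := hα.comp (g t).symm.lipschitz
    rw [mul_one] at this
    rw [ha]; exact this
  have hbL : LipschitzWith L' b := by
    have := hβ.comp (h t).symm.lipschitz
    rw [mul_one] at this
    rw [hb]; exact this
  have hac : HasCompactSupport a := by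
    rw [ha]; exact hαc.comp_homeomorph (g t).symm.toHomeomorph
  have hbc : HasCompactSupport b := by
    rw [hb]; exact hβc.comp_homeomorph (h t).symm.toHomeomorph
  have hm : MeasurableSet {x | a x < b x} :=
      measurableSet_lt haL.continuous.measurable hbL.continuous.measurable
  have hm' : MeasurableSet {x | b x < a x} :=
      measurableSet_lt hbL.continuous.measurable haL.continuous.measurable
  have hia := integrable_fderiv_apply_of_lipschitz haL hac (hg.contDiff_rigidVelocity t).continuous
  have hib := integrable_fderiv_apply_of_lipschitz hbL hbc (hh.contDiff_rigidVelocity t).continuous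
  rw [← integral_indicator hm, ← integral_indicator hm', ← integral_add (hia.indicator hm)
    (hib.indicator hm'), ← integral_neg, ← setIntegral_univ]
  have e : (fun s => ∫ x, min (α ((g s).symm x)) (β ((h s).symm x))) =
      fun s => ∫ x in univ, min (α ((g s).symm x)) (β ((h s).symm x)) := by
    simp only [setIntegral_univ]
  rw [e]
  obtain ⟨K, hK, h0⟩ := hg.exists_isCompact hαc (t - 1) (t + 1)
  refine ((hg.locallyLipschitz_comp_symm hα).min
    (hh.locallyLipschitz_comp_symm hβ)).hasDerivAt_setIntegral hK (a := t - 1) (b := t + 1)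
    (fun s hs x hx => by simp [h0 s hs x hx, hβ0]) univ (by constructor <;> linarith) ?_
  rw [Measure.restrict_univ]
  filter_upwards [haL.ae_differentiableAt, hbL.ae_differentiableAt,
    measure_eq_zero_iff_ae_notMem.1 hn] with x hxa hxb hx
  have d1 : HasDerivAt (fun s => α ((g s).symm x)) (-fderiv ℝ a x (rigidVelocity g t x)) t := by
    subst ha; exact hg.hasDerivAt_comp_symm hxa
  have d2 : HasDerivAt (fun s => β ((h s).symm x)) (-fderiv ℝ b x (rigidVelocity h t x)) t := by
    subst hb; exact hh.hasDerivAt_comp_symm hxb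
  have ea : α ((g t).symm x) = a x := by rw [ha]
  have eb : β ((h t).symm x) = b x := by rw [hb]
  rcases lt_trichotomy (a x) (b x) with hlt | heq | hgt
  · rw [indicator_of_mem (show x ∈ {x | a x < b x} from hlt),
      indicator_of_notMem (show x ∉ {x | b x < a x} from hlt.not_gt), add_zero]
    refine d1.congr_of_eventuallyEq ?_
    filter_upwards [d1.continuousAt.eventually_lt d2.continuousAt (by rwa [ea, eb])] with s hs
    exact min_eq_left hs.le
  · rw [indicator_of_notMem (show x ∉ {x | a x < b x} from heq.not_lt),
      indicator_of_notMem (show x ∉ {x | b x < a x} from heq.not_gt), add_zero, neg_zero]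
    -- Outside the null set of `hn`, equality is possible only at zero pressure, where `a` has a
    -- minimum and hence zero derivative.
    have hax : a x = 0 := by
      have h1 : 0 ≤ a x := by rw [← ea]; exact hα0 _
      by_contra h2
      exact hx ⟨heq, lt_of_le_of_ne h1 (Ne.symm h2)⟩
    have hmin : IsLocalMin a x := .of_forall fun y => by rw [hax, ha]; exact hα0 _
    rw [hmin.fderiv_eq_zero] at d1
    exact hasDerivAt_min_of_nonneg (fun s => hα0 _) (fun s => hβ0 _) (by simpa using d1)
        (ea.trans hax)
  · rw [indicator_of_mem (show x ∈ {x | b x < a x} from hgt),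
      indicator_of_notMem (show x ∉ {x | a x < b x} from hgt.not_gt), zero_add]
    refine d2.congr_of_eventuallyEq ?_
    filter_upwards [d2.continuousAt.eventually_lt d1.continuousAt (by rwa [ea, eb])] with s hs
    exact min_eq_right hs.le

end MinIntegral

open PressureBody

/-! ### Energy and power for two objects in contact. -/

section Contact

variable {A B : PressureBody} {g h : Pose}

theorem contactSurface_comm (A B : PressureBody) (g h : Pose) :
    contactSurface B A h g = contactSurface A B g h := by
  ext x
  simp only [contactSurface, mem_ofPred_eq, mem_inter_iff]
  exact and_congr and_comm eq_comm

theorem PressureBody.mem_placed_iff {x : Space3} : x ∈ A.placed g ↔ g.symm x ∈ A.carrier := by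
  rw [placed, mem_image]
  exact ⟨fun ⟨y, hy, e⟩ => by rwa [← e, g.symm_apply_apply],
      fun hx => ⟨_, hx, g.apply_symm_apply x⟩⟩

theorem PressureBody.isClosed_placed (A : PressureBody) (g : Pose) : IsClosed (A.placed g) :=
  g.toHomeomorph.isClosedMap _ A.isClosed_carrier

/-- `a`, `b` are globally Lipschitz fields of compact support which coincide on the overlap of the
two objects with their pressure fields. -/
structure IsTruncatedPair (A B : PressureBody) (g h : Pose) (a b : Space3 → ℝ) : Prop where
  lipschitz_left : ∃ L, LipschitzWith L a
  lipschitz_right : ∃ L, LipschitzWith L b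
  compact_left : HasCompactSupport a
  compact_right : HasCompactSupport b
  nonneg_left : ∀ x, 0 ≤ a x
  nonneg_right : ∀ x, 0 ≤ b x
  zero_left : ∀ x ∉ A.placed g, a x = 0
  zero_right : ∀ x ∉ B.placed h, b x = 0
  eq_left : ∀ x ∈ A.placed g ∩ B.placed h, a x = A.placedPressure g x
  eq_right : ∀ x ∈ A.placed g ∩ B.placed h, b x = B.placedPressure h x

namespace IsTruncatedPair

variable {a b : Space3 → ℝ}

theorem symm (H : IsTruncatedPair A B g h a b) : IsTruncatedPair B A h g b a where
  lipschitz_left := H.lipschitz_right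
  lipschitz_right := H.lipschitz_left
  compact_left := H.compact_right
  compact_right := H.compact_left
  nonneg_left := H.nonneg_right
  nonneg_right := H.nonneg_left
  zero_left := H.zero_right
  zero_right := H.zero_left
  eq_left x hx := H.eq_right x hx.symm
  eq_right x hx := H.eq_left x hx.symm

theorem continuous_left (H : IsTruncatedPair A B g h a b) : Continuous a :=
  H.lipschitz_left.elim fun _ h => h.continuous

theorem continuous_right (H : IsTruncatedPair A B g h a b) : Continuous b :=
  H.symm.continuous_left

theorem integrable_left (H : IsTruncatedPair A B g h a b) : Integrable a :=
  H.continuous_left.integrable_of_hasCompactSupport H.compact_left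

theorem displacedVolume_eq (H : IsTruncatedPair A B g h a b) :
    displacedVolume A B g h = A.placed g ∩ B.placed h ∩ {x | a x < b x} := by
  ext x
  simp only [displacedVolume, mem_ofPred_eq, mem_inter_iff]
  refine and_congr_right fun hx => ?_
  rw [H.eq_left x hx, H.eq_right x hx]

theorem contactSurface_eq (H : IsTruncatedPair A B g h a b) :
    contactSurface A B g h = A.placed g ∩ B.placed h ∩ {x | a x = b x} := by
  ext x
  simp only [contactSurface, mem_ofPred_eq, mem_inter_iff]
  refine and_congr_right fun hx => ?_
  rw [H.eq_left x hx, H.eq_right x hx]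

theorem isClosed_contactSurface (H : IsTruncatedPair A B g h a b) :
    IsClosed (contactSurface A B g h) := by
  rw [H.contactSurface_eq]
  exact ((A.isClosed_placed g).inter (B.isClosed_placed h)).inter
    (isClosed_eq H.continuous_left H.continuous_right)

theorem measurableSet_displacedVolume (H : IsTruncatedPair A B g h a b) :
    MeasurableSet (displacedVolume A B g h) := by
  rw [H.displacedVolume_eq]
  exact ((A.isClosed_placed g).inter (B.isClosed_placed h)).measurableSet.inter
    (isOpen_lt H.continuous_left H.continuous_right).measurableSet

theorem measurableSet_lt (H : IsTruncatedPair A B g h a b) : MeasurableSet {x | a x < b x} :=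
  (isOpen_lt H.continuous_left H.continuous_right).measurableSet

theorem mem_placed_right (H : IsTruncatedPair A B g h a b) {x : Space3} (hx : a x < b x) :
    x ∈ B.placed h := by
  by_contra hB
  exact (H.nonneg_left x).not_gt (hx.trans_eq (H.zero_right x hB))

/-- Since `0 ≤ a x < b x`, the point lies in the second object; if it is not displaced, it must be
off the first. So {`a < b`} can replace the displaced volume for integrands that vanish with `a`. -/
theorem eq_zero_of_notMem_displacedVolume (H : IsTruncatedPair A B g h a b) {x : Space3}
    (hx : a x < b x) (hx' : x ∉ displacedVolume A B g h) : a x = 0 := by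
  refine H.zero_left x fun hA => hx' ?_
  rw [H.displacedVolume_eq]
  exact ⟨⟨hA, H.mem_placed_right hx⟩, hx⟩

theorem displacedVolume_subset (H : IsTruncatedPair A B g h a b) :
    displacedVolume A B g h ⊆ {x | a x < b x} := by
  rw [H.displacedVolume_eq]
  exact inter_subset_right

theorem integrableOn_displacedVolume (H : IsTruncatedPair A B g h a b) :
    IntegrableOn (A.placedPressure g) (displacedVolume A B g h) :=
  H.integrable_left.integrableOn.congr_fun (fun x hx => H.eq_left x hx.1)
    H.measurableSet_displacedVolume

theorem setIntegral_lt_eq (H : IsTruncatedPair A B g h a b) {f : Space3 → ℝ}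
    (hf : ∀ x, a x = 0 → f x = 0) :
    ∫ x in {x | a x < b x}, f x = ∫ x in displacedVolume A B g h, f x :=
  setIntegral_eq_of_subset_of_forall_sdiff_eq_zero H.measurableSet_lt H.displacedVolume_subset
    fun x hx => hf x (H.eq_zero_of_notMem_displacedVolume hx.1 hx.2)

theorem strainEnergy_eq (H : IsTruncatedPair A B g h a b) :
    strainEnergy A B g h = ∫ x in {x | a x < b x}, a x := by
  rw [H.setIntegral_lt_eq fun x hx => hx, strainEnergy]
  exact setIntegral_congr_fun H.measurableSet_displacedVolume fun x hx => (H.eq_left x hx.1).symm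

theorem volume_eq_zero (H : IsTruncatedPair A B g h a b) (hn : NoEqualPressureVolume A B g h) :
    volume {x | a x = b x ∧ 0 < a x} = 0 := by
  refine measure_mono_null ?_ hn
  rintro x ⟨h1, h2⟩
  have hA : x ∈ A.placed g := by
    by_contra hA
    exact h2.ne' (H.zero_left x hA)
  have hB : x ∈ B.placed h := by
    by_contra hB
    exact (h2.trans_eq h1).ne' (H.zero_right x hB)
  refine ⟨?_, by rwa [← H.eq_left x ⟨hA, hB⟩]⟩
  rw [H.contactSurface_eq]
  exact ⟨⟨hA, hB⟩, h1⟩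

/-- The two displaced regions and the set of equality exhaust space, and almost everywhere on the
latter the pressure is zero. The minimum has the advantage of being Lipschitz in time. -/
theorem contactEnergy_eq (H : IsTruncatedPair A B g h a b) (hn : NoEqualPressureVolume A B g h) :
    contactEnergy A B g h = ∫ x, min (a x) (b x) := by
  rw [contactEnergy, H.strainEnergy_eq, H.symm.strainEnergy_eq,
    ← integral_indicator H.measurableSet_lt, ← integral_indicator H.symm.measurableSet_lt,
    ← integral_add (H.integrable_left.indicator H.measurableSet_lt)
      (H.symm.integrable_left.indicator H.symm.measurableSet_lt)]
  refine integral_congr_ae ?_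
  filter_upwards [measure_eq_zero_iff_ae_notMem.1 (H.volume_eq_zero hn)] with x hx
  rcases lt_trichotomy (a x) (b x) with hlt | heq | hgt
  · rw [indicator_of_mem (show x ∈ {x | a x < b x} from hlt),
      indicator_of_notMem (show x ∉ {x | b x < a x} from hlt.not_gt), add_zero, min_eq_left hlt.le]
  · rw [indicator_of_notMem (show x ∉ {x | a x < b x} from heq.not_lt),
      indicator_of_notMem (show x ∉ {x | b x < a x} from heq.not_gt), add_zero, min_eq_left heq.le]
    by_contra h2
    exact hx ⟨heq, lt_of_le_of_ne (H.nonneg_left x) h2⟩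
  · rw [indicator_of_mem (show x ∈ {x | b x < a x} from hgt),
      indicator_of_notMem (show x ∉ {x | a x < b x} from hgt.not_gt), zero_add, min_eq_right hgt.le]

/-- On the closure `a ≤ b` holds inside both objects. Strict inequality with `a > 0` is an open
condition that implies membership, so it would put the point in the interior. -/
theorem mem_contactSurface_of_mem_frontier (H : IsTruncatedPair A B g h a b) {x : Space3}
    (hx : x ∈ frontier (displacedVolume A B g h)) (h0 : 0 < a x) : x ∈ contactSurface A B g h := by
  have hcl : closure (displacedVolume A B g h) ⊆ A.placed g ∩ B.placed h ∩ {x | a x ≤ b x} := by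
    refine closure_minimal ?_ (((A.isClosed_placed g).inter (B.isClosed_placed h)).inter
      (isClosed_le H.continuous_left H.continuous_right))
    rw [H.displacedVolume_eq]
    exact inter_subset_inter_right _ fun x hx =>
      show a x ≤ b x from le_of_lt hx
  obtain ⟨hx1, hx2⟩ := hcl (frontier_subset_closure hx)
  rw [H.contactSurface_eq]
  refine ⟨hx1, le_antisymm hx2 (not_lt.1 fun hlt => hx.2 ?_)⟩
  have ho : IsOpen {x | 0 < a x ∧ a x < b x} :=
    (isOpen_lt continuous_const H.continuous_left).inter
      (isOpen_lt H.continuous_left H.continuous_right)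
  refine interior_maximal (fun y hy => ?_) ho ⟨h0, hlt⟩
  by_contra hy'
  exact hy.1.ne' (H.eq_zero_of_notMem_displacedVolume hy.2 hy')

end IsTruncatedPair

theorem RegularConfiguration.symm (hr : RegularConfiguration A B g h) (hS : MeasurableSet
    (contactSurface A B g h)) :
    RegularConfiguration B A h g := by
  have he : ∀ x ∈ contactSurface A B g h, A.placedPressure g x = B.placedPressure h x :=
    fun x hx => hx.2
  constructor <;> rw [contactSurface_comm]
  · exact hr.finite_load.congr_fun he hS
  · filter_upwards [hr.ae_interface, ae_restrict_mem hS] with x hx hxS h0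
    obtain ⟨n, hn⟩ := hx (by rwa [he x hxS])
    exact ⟨-n, hn.swap⟩

/-- The power of the pressure forces on one of the objects, as a volume integral. -/
theorem IsTruncatedPair.tractionPower_eq {a b : Space3 → ℝ} (H : IsTruncatedPair A B g h a b)
    (hr : RegularConfiguration A B g h) {v : Space3 → Space3} (hv : ContDiff ℝ 1 v)
    (hdiv : ∀ x, divergence v x = 0) :
    IntegrableOn (powerDensity (A.placedPressure g) (displacedVolume A B g h)
      (displacedVolume B A h g) v) (contactSurface A B g h) μHE[2] ∧
    tractionPower (A.placedPressure g) (contactSurface A B g h) (displacedVolume A B g h)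
      (displacedVolume B A h g) v = ∫ x in {x | a x < b x}, fderiv ℝ a x (v x) := by
  have hS := H.isClosed_contactSurface.measurableSet
  have he : ∀ x ∈ contactSurface A B g h, a x = A.placedPressure g x :=
    fun x hx => H.eq_left x hx.1
  have hpd : ∀ x ∈ contactSurface A B g h,
      powerDensity a (displacedVolume A B g h) (displacedVolume B A h g) v x =
      powerDensity (A.placedPressure g) (displacedVolume A B g h) (displacedVolume B A h g) v x :=
    fun x hx => by simp only [powerDensity, he x hx]
  obtain ⟨L, hL⟩ := H.lipschitz_left
  obtain ⟨hi, hI⟩ := gaussGreen_traction (W := displacedVolume B A h g)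
    H.measurableSet_displacedVolume hS hL H.compact_left H.nonneg_left hv
    (fun x hx h0 => H.mem_contactSurface_of_mem_frontier hx h0)
    (hr.finite_load.congr_fun (fun x hx => (he x hx).symm) hS) (by
      filter_upwards [hr.ae_interface, ae_restrict_mem hS] with x hx hxS
      rwa [he x hxS])
  refine ⟨hi.congr_fun hpd hS, ?_⟩
  rw [H.setIntegral_lt_eq]
  · simp only [hdiv, mul_zero, add_zero] at hI
    rw [hI]
    exact (setIntegral_congr_fun hS hpd).symm
  · intro x hx
    have : IsLocalMin a x := .of_forall fun y => by rw [hx]; exact H.nonneg_left y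
    simp [this.fderiv_eq_zero]

/-- The pressure fields can be truncated uniformly during a motion. -/
theorem exists_isTruncatedPair {g h : ℝ → Pose} (hg : IsRigidMotion g) (hh : IsRigidMotion h)
    (hb : Bornology.IsBounded A.carrier ∨ Bornology.IsBounded B.carrier) (t₀ t₁ : ℝ) :
    ∃ (α β : Space3 → ℝ) (L L' : ℝ≥0), LipschitzWith L α ∧ LipschitzWith L' β ∧
      HasCompactSupport α ∧ HasCompactSupport β ∧ (∀ x, 0 ≤ α x) ∧ (∀ x, 0 ≤ β x) ∧
      ∀ t ∈ Icc t₀ t₁, IsTruncatedPair A B (g t) (h t) (fun x => α ((g t).symm x))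
        (fun x => β ((h t).symm x)) := by
  have hK : ∃ K, IsCompact K ∧ ∀ t ∈ Icc t₀ t₁, A.placed (g t) ∩ B.placed (h t) ⊆ K := by
    have key : ∀ {C : PressureBody} {k : ℝ → Pose}, IsRigidMotion k →
        Bornology.IsBounded C.carrier → ∃ K, IsCompact K ∧ ∀ t ∈ Icc t₀ t₁, C.placed (k t) ⊆ K := by
      intro C k hk hC
      refine ⟨(fun z : ℝ × Space3 => k z.1 z.2) '' (Icc t₀ t₁ ×ˢ closure C.carrier),
        (isCompact_Icc.prod hC.isCompact_closure).image hk.contDiff.continuous, fun t ht => ?_⟩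
      rintro _ ⟨y, hy, rfl⟩
      exact ⟨(t, y), ⟨ht, subset_closure hy⟩, rfl⟩
    rcases hb with hb | hb
    · obtain ⟨K, hK, h⟩ := key hg hb
      exact ⟨K, hK, fun t ht => inter_subset_left.trans (h t ht)⟩
    · obtain ⟨K, hK, h⟩ := key hh hb
      exact ⟨K, hK, fun t ht => inter_subset_right.trans (h t ht)⟩
  obtain ⟨K, hK, hKt⟩ := hK
  -- Pulled back to object coordinates, the overlaps at all times of the interval stay in one ball,
  -- so one cut-off per object serves the whole motion.
  have hR : ∀ {k : ℝ → Pose}, IsRigidMotion k →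
      ∃ R, ∀ t ∈ Icc t₀ t₁, ∀ x ∈ K, (k t).symm x ∈ Metric.closedBall (0 : Space3) R := by
    intro k hk
    obtain ⟨R, hR⟩ := ((isCompact_Icc (a := t₀) (b := t₁)).prod hK).image
      hk.contDiff_symm.continuous |>.isBounded.subset_closedBall 0
    exact ⟨R, fun t ht x hx => hR ⟨(t, x), ⟨ht, hx⟩, rfl⟩⟩
  obtain ⟨R, hR1⟩ := hR hg
  obtain ⟨R', hR2⟩ := hR hh
  obtain ⟨α, L, hL, hc, hn, h0, he⟩ := A.exists_truncation R
  obtain ⟨β, L', hL', hc', hn', h0', he'⟩ := B.exists_truncation R'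
  refine ⟨α, β, L, L', hL, hL', hc, hc', hn, hn', fun t ht => ⟨⟨L * 1, ?_⟩, ⟨L' * 1, ?_⟩, ?_, ?_,
    fun x => hn _, fun x => hn' _, fun x hx => h0 _ (mt mem_placed_iff.2 hx),
    fun x hx => h0' _ (mt mem_placed_iff.2 hx), fun x hx => ?_, fun x hx => ?_⟩⟩
  · exact hL.comp (g t).symm.lipschitz
  · exact hL'.comp (h t).symm.lipschitz
  · exact hc.comp_homeomorph (g t).symm.toHomeomorph
  · exact hc'.comp_homeomorph (h t).symm.toHomeomorph
  · rw [he _ (hR1 t ht x (hKt t ht hx)), extendedPressure, indicator_of_mem (mem_placed_iff.1 hx.1),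
      placedPressure]
  · rw [he' _ (hR2 t ht x (hKt t ht hx)), extendedPressure,
      indicator_of_mem (mem_placed_iff.1 hx.2), placedPressure]

theorem integrableOn_displacedVolume
    (hb : Bornology.IsBounded A.carrier ∨ Bornology.IsBounded B.carrier) (g h : Pose) :
    IntegrableOn (A.placedPressure g) (displacedVolume A B g h) ∧
      IntegrableOn (B.placedPressure h) (displacedVolume B A h g) := by
  obtain ⟨α, β, -, -, -, -, -, -, -, -, H⟩ := exists_isTruncatedPair (g := fun _ => g)
    (h := fun _ => h) (fun _ => contDiff_const) (fun _ => contDiff_const) hb 0 0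
  have H := H 0 (by simp)
  exact ⟨H.integrableOn_displacedVolume, H.symm.integrableOn_displacedVolume⟩

/-- Moving both objects by `k` moves the displaced volume and the field by an isometry, which
preserves volume. -/
theorem strainEnergy_eq_of_comp (A B : PressureBody) (k g h : Pose) :
    strainEnergy A B (k * g) (k * h) = strainEnergy A B g h := by
  have e : displacedVolume A B g h = k ⁻¹' displacedVolume A B (k * g) (k * h) := by
    have hs : ∀ (f : Pose) x, (k * f).symm (k x) = f.symm x := fun f x => by
      rw [AffineIsometryEquiv.symm_apply_eq]
      simp
    ext x
    simp only [displacedVolume, mem_preimage, mem_ofPred_eq, mem_inter_iff, mem_placed_iff,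
      placedPressure, hs]
  have he : MeasurableEmbedding k := k.toHomeomorph.measurableEmbedding
  rw [strainEnergy, strainEnergy, ← (Pose.measurePreserving k).setIntegral_preimage_emb he, ← e]
  congr 1
  funext x
  have hs : (k * g).symm (k x) = g.symm x := by
    rw [AffineIsometryEquiv.symm_apply_eq]
    simp
  rw [placedPressure, placedPressure, hs]

/-- The strain energy depends only on the relative pose. -/
theorem contactEnergy_eq_of_relativePose_eq {g' h' : Pose}
    (hr : relativePose g h = relativePose g' h') :
    contactEnergy A B g h = contactEnergy A B g' h' := by
  have e1 : g' = g' * g⁻¹ * g := by group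
  have e2 : h' = g' * g⁻¹ * h := by
    rw [mul_assoc]
    change _ = g' * relativePose g h
    rw [hr, relativePose]
    group
  rw [contactEnergy, contactEnergy, e1, e2, strainEnergy_eq_of_comp, strainEnergy_eq_of_comp]

theorem contactEnergy_eq_zero_of_disjoint (hd : Disjoint (A.placed g) (B.placed h)) :
    contactEnergy A B g h = 0 := by
  have h1 : displacedVolume A B g h = ∅ :=
    eq_empty_of_forall_notMem fun x hx => hd.le_bot hx.1
  have h2 : displacedVolume B A h g = ∅ :=
    eq_empty_of_forall_notMem fun x hx => hd.le_bot hx.1.symm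
  simp [contactEnergy, strainEnergy, h1, h2]

variable {g h : ℝ → Pose} {t₀ t₁ : ℝ}

/-- The power balance for two objects in contact. -/
theorem IsAdmissibleMotion.hasDerivWithinAt_contactEnergy (H : IsAdmissibleMotion A B g h t₀ t₁)
    (hb : Bornology.IsBounded A.carrier ∨ Bornology.IsBounded B.carrier) {t : ℝ}
    (ht : t ∈ Icc t₀ t₁) (hr : RegularConfiguration A B (g t) (h t)) :
    IntegrableOn (powerDensity (A.placedPressure (g t)) (displacedVolume A B (g t) (h t))
      (displacedVolume B A (h t) (g t)) (rigidVelocity g t))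
      (contactSurface A B (g t) (h t)) μHE[2] ∧
    IntegrableOn (powerDensity (B.placedPressure (h t)) (displacedVolume B A (h t) (g t))
      (displacedVolume A B (g t) (h t)) (rigidVelocity h t))
      (contactSurface B A (h t) (g t)) μHE[2] ∧
    HasDerivWithinAt (fun s => contactEnergy A B (g s) (h s))
      (-contactPower A B g h t) (Icc t₀ t₁) t := by
  obtain ⟨α, β, L, L', hL, hL', hc, hc', hn, hn', hT⟩ :=
    exists_isTruncatedPair H.left H.right hb t₀ t₁
  obtain ⟨i1, e1⟩ := (hT t ht).tractionPower_eq hr (H.left.contDiff_rigidVelocity t)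
    (H.left.divergence_rigidVelocity t)
  obtain ⟨i2, e2⟩ := (hT t ht).symm.tractionPower_eq
    (hr.symm (hT t ht).isClosed_contactSurface.measurableSet) (H.right.contDiff_rigidVelocity t)
    (H.right.divergence_rigidVelocity t)
  refine ⟨i1, i2, ?_⟩
  rw [contactPower, powerOn, powerOn, e1, e2]
  have hd := H.left.hasDerivAt_integral_min H.right hL hc hL' hc' hn hn' rfl rfl
    ((hT t ht).volume_eq_zero (H.no_volume t ht))
  -- The formula with the minimum holds only at times without equal-pressure volume, which are
  -- guaranteed only on `Icc t₀ t₁`; hence the one-sided derivatives at the end points.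
  exact hd.hasDerivWithinAt.congr_of_mem
    (fun s hs => (hT s hs).contactEnergy_eq (H.no_volume s hs)) ht

/-- The work of the pressure forces is the loss of strain energy. -/
theorem IsAdmissibleMotion.contactWork_eq (H : IsAdmissibleMotion A B g h t₀ t₁)
    (hb : Bornology.IsBounded A.carrier ∨ Bornology.IsBounded B.carrier) :
    IntervalIntegrable (contactPower A B g h) volume t₀ t₁ ∧
    contactWork A B g h t₀ t₁ =
      contactEnergy A B (g t₀) (h t₀) - contactEnergy A B (g t₁) (h t₁) := by
  obtain ⟨α, β, L, L', hL, hL', hc, hc', hn, hn', hT⟩ :=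
    exists_isTruncatedPair H.left H.right hb t₀ t₁
  obtain ⟨C, hC⟩ := H.left.exists_lipschitzOnWith_integral_min H.right hL hc hL' hn' t₀ t₁
  have hC' : LipschitzOnWith C (fun s => contactEnergy A B (g s) (h s)) (Icc t₀ t₁) :=
    fun s hs s' hs' => by
      simp only [(hT s hs).contactEnergy_eq (H.no_volume s hs),
        (hT s' hs').contactEnergy_eq (H.no_volume s' hs')]
      exact hC hs hs'
  obtain ⟨hi, he⟩ := hC'.intervalIntegrable_and_integral_eq_sub H.le
    (P := fun t => -contactPower A B g h t) (by
      filter_upwards [H.ae_regular, ae_restrict_mem measurableSet_Icc] with t ht htI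
      exact (H.hasDerivWithinAt_contactEnergy hb htI ht).2.2)
  have hi' := hi.neg
  rw [show (-fun t => -contactPower A B g h t) = contactPower A B g h from
    funext fun t => neg_neg _] at hi'
  refine ⟨hi', ?_⟩
  rw [intervalIntegral.integral_neg] at he
  rw [contactWork]
  linarith

end Contact

/-! ### Power balance and conservation of energy. -/

theorem mainTheorem1 :
    -- one pressure field, displaced by a moving region, in the object-fixed frame
    (∀ (A : PressureBody) (D : Set Space3) (Φ : ℝ → Space3 ≃ Space3),
      MeasurableSet D → IsSmoothMotion Φ →
      (Bornology.IsBounded A.carrier ∨ Bornology.IsBounded D) →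
      (∀ t, IntegrableOn A.pressure (A.overlapVolume D Φ t)) ∧
      (∀ t, A.RegularOverlap D Φ t →
        IntegrableOn (powerDensity A.pressure (A.overlapVolume D Φ t) (A.overlapVolume D Φ t)ᶜ
          (PressureBody.intruderVelocity Φ t)) (frontier (A.overlapVolume D Φ t)) μHE[2] ∧
        HasDerivAt (fun s => A.fieldEnergy (A.overlapVolume D Φ s)) (A.overlapPower D Φ t) t) ∧
      ∀ t₀ t₁ : ℝ, t₀ ≤ t₁ →
        (∀ᵐ t ∂volume.restrict (Icc t₀ t₁), A.RegularOverlap D Φ t) →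
        IntervalIntegrable (A.overlapPower D Φ) volume t₀ t₁ ∧
        ∫ t in t₀..t₁, A.overlapPower D Φ t =
          A.fieldEnergy (A.overlapVolume D Φ t₁) - A.fieldEnergy (A.overlapVolume D Φ t₀) ∧
        (A.overlapVolume D Φ t₀ = ∅ →
          ∫ t in t₀..t₁, A.overlapPower D Φ t = A.fieldEnergy (A.overlapVolume D Φ t₁)) ∧
        (A.overlapVolume D Φ t₁ = A.overlapVolume D Φ t₀ →
          ∫ t in t₀..t₁, A.overlapPower D Φ t = 0)) ∧
    -- two objects in contact, each with its own pressure field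
    (∀ (A B : PressureBody),
      (Bornology.IsBounded A.carrier ∨ Bornology.IsBounded B.carrier) →
      -- the energy is well defined and depends only on the relative pose
      (∀ g h : Pose, IntegrableOn (A.placedPressure g) (displacedVolume A B g h) ∧
        IntegrableOn (B.placedPressure h) (displacedVolume B A h g)) ∧
      (∀ g h g' h' : Pose, relativePose g h = relativePose g' h' →
        contactEnergy A B g h = contactEnergy A B g' h') ∧
      (∀ (g h : ℝ → Pose) (t₀ t₁ : ℝ), IsAdmissibleMotion A B g h t₀ t₁ →
        -- power balance
        (∀ t ∈ Icc t₀ t₁, RegularConfiguration A B (g t) (h t) →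
          IntegrableOn (powerDensity (A.placedPressure (g t)) (displacedVolume A B (g t) (h t))
            (displacedVolume B A (h t) (g t)) (rigidVelocity g t))
            (contactSurface A B (g t) (h t)) μHE[2] ∧
          IntegrableOn (powerDensity (B.placedPressure (h t)) (displacedVolume B A (h t) (g t))
            (displacedVolume A B (g t) (h t)) (rigidVelocity h t))
            (contactSurface B A (h t) (g t)) μHE[2] ∧
          HasDerivWithinAt (fun s => contactEnergy A B (g s) (h s))
            (-contactPower A B g h t) (Icc t₀ t₁) t) ∧
        IntervalIntegrable (contactPower A B g h) volume t₀ t₁ ∧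
        -- the pressure forces do work at the expense of the energy
        contactWork A B g h t₀ t₁ =
          contactEnergy A B (g t₀) (h t₀) - contactEnergy A B (g t₁) (h t₁) ∧
        -- starting out of contact, the work done against the pressure forces is the energy
        (Disjoint (A.placed (g t₀)) (B.placed (h t₀)) →
          -contactWork A B g h t₀ t₁ = contactEnergy A B (g t₁) (h t₁)) ∧
        -- from out of contact to out of contact, no net work is done
        (Disjoint (A.placed (g t₀)) (B.placed (h t₀)) →
          Disjoint (A.placed (g t₁)) (B.placed (h t₁)) → contactWork A B g h t₀ t₁ = 0) ∧
        -- no net work is done in a closed cycle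
        (relativePose (g t₀) (h t₀) = relativePose (g t₁) (h t₁) →
          contactWork A B g h t₀ t₁ = 0)) ∧
      -- the work is independent of the path
      (∀ (g h g' h' : ℝ → Pose) (t₀ t₁ s₀ s₁ : ℝ), IsAdmissibleMotion A B g h t₀ t₁ →
        IsAdmissibleMotion A B g' h' s₀ s₁ →
        relativePose (g t₀) (h t₀) = relativePose (g' s₀) (h' s₀) →
        relativePose (g t₁) (h t₁) = relativePose (g' s₁) (h' s₁) →
        contactWork A B g h t₀ t₁ = contactWork A B g' h' s₀ s₁)) := by
  refine ⟨fun A D Φ hD hΦ hb => ⟨fun t => integrableOn_overlapVolume hΦ hD hb t,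
    fun t ht => ht.hasDerivAt_fieldEnergy hΦ hD hb, fun t₀ t₁ ht h => ?_⟩,
    fun A B hb => ⟨integrableOn_displacedVolume hb,
      fun g h g' h' hr => contactEnergy_eq_of_relativePose_eq hr, fun g h t₀ t₁ H => ?_, ?_⟩⟩
  · obtain ⟨hi, he⟩ := integral_overlapPower hΦ hD hb ht h
    refine ⟨hi, he, fun h0 => ?_, fun h0 => ?_⟩
    · rw [he, h0]
      simp [fieldEnergy]
    · rw [he, h0, sub_self]
  · obtain ⟨hi, he⟩ := H.contactWork_eq hb
    refine ⟨fun t ht hr => H.hasDerivWithinAt_contactEnergy hb ht hr, hi, he, fun h0 => ?_,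
      fun h0 h1 => ?_, fun hr => ?_⟩
    · rw [he, contactEnergy_eq_zero_of_disjoint h0]
      ring
    · rw [he, contactEnergy_eq_zero_of_disjoint h0, contactEnergy_eq_zero_of_disjoint h1, sub_self]
    · rw [he, contactEnergy_eq_of_relativePose_eq hr, sub_self]
  · intro g h g' h' t₀ t₁ s₀ s₁ H H' h0 h1
    rw [(H.contactWork_eq hb).2, (H'.contactWork_eq hb).2, contactEnergy_eq_of_relativePose_eq h0,
      contactEnergy_eq_of_relativePose_eq h1]
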